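/- Let $n\ge 1$ and let $\Omega\subset\mathbb{R}^n$ be a bounded open set whose boundary $\Sigma=\partial\Omega$ is Lipschitz (locally, after a rigid motion, $\Omega$ is the region strictly above the graph of a Lipschitz function) and satisfies an interior sphere condition: there is $R>0$ such that every $x\in\Sigma$ lies on the boundary of a ball of radius $R$ contained in $\Omega$. Let $\beta\in L^\infty(\Sigma)$ satisfy $|\beta|\le 1-a$ almost everywhere on $\Sigma$ for some $a>0$. For $u\in L^1(\Omega)$ put $$\int_\Omega\sqrt{1+|Du|^2}=\sup\Big\{\int_\Omega \big(g_{n+1}+u\,\mathrm{div}\,g\big)\,dx\Big\},\qquad \int_\Omega\sqrt{u^2+|Du|^2}=\sup\Big\{\int_\Omega u\,\big(g_{n+1}+\mathrm{div}\,g\big)\,dx\Big\},$$ where both suprema are over all $g_1,\dots,g_{n+1}\in C^1_c(\Omega)$ with $\sum_{i=1}^{n+1}g_i^2\le 1$, and $\mathrm{div}\,g=\sum_{i=1}^n D_ig_i$. Let $BV(\Omega)=\{u\in L^1(\Omega):\int_\Omega\sqrt{1+|Du|^2}<\infty\}$ and $BV^+(\Omega)=\{u\in BV(\Omega): u\ge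 0 \text{ a.e. in }\Omega\}$. For $v\in BV^+(\Omega)$ let $$\mathcal J_1(v)=\int_\Omega\sqrt{v^2+|Dv|^2}+\int_\Omega\int_1^{v(x)}\ln h\,dh\,dx-\int_\Sigma\beta\,(1-v)\,ds,$$ where $v$ on $\Sigma$ denotes the trace, $v(x)=\lim_{r\to0^+}|B_r(x)\cap\Omega|^{-1}\int_{B_r(x)\cap\Omega}v\,dy$ for almost every $x\in\Sigma$, and $ds$ is the $(n-1)$-dimensional Hausdorff (surface) measure. If $v\in BV^+(\Omega)$ minimises $\mathcal J_1$ in $BV^+(\Omega)$, that is, $\mathcal J_1(v)\le\mathcal J_1(w)$ for all $w\in BV^+(\Omega)$, then $v$ is essentially bounded above: there is $M<\infty$ with $v\le M$ almost everywhere in $\Omega$. -/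

import Mathlib

open MeasureTheory Topology Filter
open scoped ENNReal NNReal

namespace Capillary

noncomputable section

/-- The Euclidean space `ℝⁿ`. -/
abbrev E (n : ℕ) : Type := EuclideanSpace ℝ (Fin n)

/-- `∂Ω` is Lipschitz: near each of its points, and after a rigid motion, `Ω` is the set of points
lying strictly above the graph of a Lipschitz function. Here `e` is the vertical direction, and
`x - ⟪e, x⟫ e` is the orthogonal projection of `x` to the hyperplane `e^⊥`. -/
def HasLipschitzBoundary {n : ℕ} (Ω : Set (E n)) : Prop :=
  ∀ x₀ ∈ frontier Ω, ∃ (e : E n) (ψ : E n → ℝ) (K : ℝ≥0) (r : ℝ),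
    ‖e‖ = 1 ∧ LipschitzWith K ψ ∧ 0 < r ∧
      ∀ x ∈ Metric.ball x₀ r, x ∈ Ω ↔ ψ (x - inner ℝ e x • e) < inner ℝ e x

/-- The interior sphere condition of radius `R`: every boundary point lies on the boundary of
an open ball of radius `R` that is contained in `Ω`. -/
def InteriorSphereCondition {n : ℕ} (Ω : Set (E n)) (R : ℝ) : Prop :=
  ∀ x ∈ frontier Ω, ∃ c : E n, Metric.ball c R ⊆ Ω ∧ dist x c = R

/-- The divergence `∑ i, D_i g_i`. -/
def divg {n : ℕ} (g : E n → E n) (x : E n) : ℝ :=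
  ∑ i : Fin n, fderiv ℝ g x (EuclideanSpace.single i 1) i

/-- `(g, g₀) = (g₁, …, g_n, g_{n+1})` has all components in `C¹` with compact support in `Ω`, and
satisfies `∑ g_i² ≤ 1`. -/
structure IsTestField {n : ℕ} (Ω : Set (E n)) (g : E n → E n) (g₀ : E n → ℝ) : Prop where
  contDiff : ContDiff ℝ 1 g
  contDiff₀ : ContDiff ℝ 1 g₀
  hasCompactSupport : HasCompactSupport g
  hasCompactSupport₀ : HasCompactSupport g₀
  tsupport_subset : tsupport g ⊆ Ω
  tsupport_subset₀ : tsupport g₀ ⊆ Ω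
  sq_le_one : ∀ x, ‖g x‖ ^ 2 + g₀ x ^ 2 ≤ 1

/-- `∫_Ω √(1 + |Du|²)`, for `u ∈ L¹(Ω)`. -/
def area {n : ℕ} (Ω : Set (E n)) (u : E n → ℝ) : EReal :=
  ⨆ (g : E n → E n) (g₀ : E n → ℝ) (_ : IsTestField Ω g g₀),
    ((∫ x in Ω, (g₀ x + u x * divg g x) : ℝ) : EReal)

/-- `∫_Ω √(v² + |Dv|²)`, for `v ∈ L¹(Ω)`. -/
def surfaceEnergy {n : ℕ} (Ω : Set (E n)) (v : E n → ℝ) : EReal :=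
  ⨆ (g : E n → E n) (g₀ : E n → ℝ) (_ : IsTestField Ω g g₀),
    ((∫ x in Ω, v x * (g₀ x + divg g x) : ℝ) : EReal)

/-- `BV(Ω)`. -/
def BV {n : ℕ} (Ω : Set (E n)) : Set (E n → ℝ) :=
  {u | IntegrableOn u Ω ∧ area Ω u < ⊤}

/-- `BV⁺(Ω)`. -/
def BVPlus {n : ℕ} (Ω : Set (E n)) : Set (E n → ℝ) :=
  {u | u ∈ BV Ω ∧ ∀ᵐ x ∂(volume.restrict Ω), 0 ≤ u x}

/-- The boundary trace of `v ∈ BV(Ω)`: the limit as `r → 0+` of the mean values of `v` over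
`B_r(x) ∩ Ω`. On a Lipschitz domain it exists at almost every boundary point. -/
def trace {n : ℕ} (Ω : Set (E n)) (v : E n → ℝ) (x : E n) : ℝ :=
  limUnder (𝓝[>] (0 : ℝ)) fun r => ⨍ y in Metric.ball x r ∩ Ω, v y

/-- The potential energy `∫_Ω ∫_1^v ln h dh dx`. For `v ≥ 0` the inner integral is
`v ln v - v + 1 ≥ 0`, so the outer one is the integral of a non-negative function, with value
in `[0, ∞]`. -/
def potentialEnergy {n : ℕ} (Ω : Set (E n)) (v : E n → ℝ) : ℝ≥0∞ :=
  ∫⁻ x in Ω, ENNReal.ofReal (∫ h in (1 : ℝ)..v x, Real.log h)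

/-- The surface measure on `∂Ω`: the `(n-1)`-dimensional Hausdorff measure, with the
normalisation for which it is the Lebesgue measure on hyperplanes. -/
def surfaceMeasure {n : ℕ} (Ω : Set (E n)) : Measure (E n) :=
  (Measure.euclideanHausdorffMeasure (n - 1)).restrict (frontier Ω)

/-- The wetting energy `-∫_{∂Ω} β (1 - v) ds`, where `v` on `∂Ω` is the trace. -/
def wettingEnergy {n : ℕ} (Ω : Set (E n)) (β : E n → ℝ) (v : E n → ℝ) : ℝ :=
  -∫ x, β x * (1 - trace Ω v x) ∂(surfaceMeasure Ω)

/-- The energy `J₁`, with values in `(-∞, ∞]`. -/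
def J₁ {n : ℕ} (Ω : Set (E n)) (β : E n → ℝ) (v : E n → ℝ) : EReal :=
  surfaceEnergy Ω v + (potentialEnergy Ω v : EReal) + (wettingEnergy Ω β v : EReal)

/-- `v` minimises `J₁` in `BV⁺(Ω)`. -/
def IsMinimiser {n : ℕ} (Ω : Set (E n)) (β : E n → ℝ) (v : E n → ℝ) : Prop :=
  v ∈ BVPlus Ω ∧ ∀ w ∈ BVPlus Ω, J₁ Ω β v ≤ J₁ Ω β w

end

end Capillary

/-! The minimiser `v` is compared with its truncation `min v ψ` by a barrier `ψ = k * exp φ`. Write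
`f = max (v - ψ) 0`. The barrier is chosen so that truncation lowers the energy by at least `∫ f`,
up to a boundary error that tends to zero.

Surface energy. The integrand `√(v² + |Dv|²)` is the support function of the unit ball, so it
dominates `v z₀ + Dv·Z` whenever `|Z|² + z₀² ≤ 1`. The field `(Z, z₀) = (∇φ, 1) / √(1 + |∇φ|²)`
gives equality for `ψ`. Using it as a calibration on `{v > ψ}` and integrating by parts, truncation
raises the surface energy by at most `∫ f div Z` plus the boundary integral of `f Z·ν`, where `ν` is
the inward normal (`calibration_le`, `BoundaryAtlas.surfaceEnergy_min_le`).

The field. Take `φ = l / (2R) * d²`, where `d` is the distance to the set of centres of the balls of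
radius `R` contained in `Ω`. As an infimum of functions `|x - c|²`, `d²` is semiconcave, and this
alone gives `div Z ≤ C = (l / R) n` (`divg_unitField_le`). On the boundary `d = R`, and at almost
every boundary point all touching balls have the same centre, on the normal. Hence `∇d² = -2Rν`
there and `Z·ν = -l / √(1 + l²)`. The slope `l` is chosen so that this is `-b`, with `b < 1` a bound
for `|β|`; the surface term then cancels the change of the wetting energy, which is at most `b ∫ f`
over the boundary. Finally `log k = C + 1` makes the potential energy drop by at least `(C + 1) ∫
f`, and minimality leaves `∫ f ≤ 0`.

Since `d²` need not be `C²`, it is replaced by mollifications. These keep the semiconcavity constant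
and are bounded on `Ω` uniformly, and on the boundary their gradients converge almost everywhere
(`GraphChart.IsChartOf.tendsto_inner_grad_smoothSqDist`). The boundary terms therefore cancel in the
limit by dominated convergence (`BoundaryAtlas.tendsto_integral_defect`), and the integral of the
excess of `v` over a common upper bound `M` of the barriers is zero.

Much of the work makes the boundary integrals rigorous: in graph coordinates `v` has bounded
variation on almost every vertical line, its limits there are integrable and agree with the trace
defined by means over balls, and the surface measure is bounded by the area density of the graphs.
-/

namespace Capillary

/-! ### Divergence and integration by parts -/

/-- A smooth cutoff function which is `1` near a compact set. -/
theorem exists_cutoff {n : ℕ} {K U : Set (E n)} (hK : IsCompact K) (hU : IsOpen U) (hKU : K ⊆ U) :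
    ∃ η : E n → ℝ, ContDiff ℝ 2 η ∧ HasCompactSupport η ∧ tsupport η ⊆ U ∧
      (∀ᶠ x in 𝓝ˢ K, η x = 1) ∧ ∀ x, η x ∈ Set.Icc (0 : ℝ) 1 := by
  obtain ⟨L, hL, hKL, hLU⟩ := exists_compact_between hK hU hKU
  obtain ⟨f, h1, h0, h01⟩ := exists_contMDiffMap_one_nhds_of_subset_interior
    (I := modelWithCornersSelf ℝ (E n)) (n := 2) hK.isClosed hKL
  have hsupp : tsupport f ⊆ L := by
    refine closure_minimal (fun x hx => ?_) hL.isClosed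
    by_contra hxL
    exact hx (h0 x hxL)
  exact ⟨f, f.contMDiff.contDiff, HasCompactSupport.of_support_subset_isCompact hL
    (fun x hx => hsupp (subset_tsupport _ hx)), hsupp.trans hLU, h1, h01⟩

theorem apply_eq_sum_single {n : ℕ} (L : E n →L[ℝ] ℝ) (z : E n) :
    L z = ∑ i, z i * L (EuclideanSpace.single i 1) := by
  conv_lhs => rw [← (EuclideanSpace.basisFun (Fin n) ℝ).sum_repr z]
  simp

theorem divg_congr {n : ℕ} {g g' : E n → E n} {x : E n} (h : g =ᶠ[𝓝 x] g') :
    divg g x = divg g' x := by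
  simp [divg, h.fderiv_eq]

theorem divg_smul {n : ℕ} {f : E n → ℝ} {Z : E n → E n} {x : E n}
    (hf : DifferentiableAt ℝ f x) (hZ : DifferentiableAt ℝ Z x) :
    divg (fun y => f y • Z y) x = f x * divg Z x + fderiv ℝ f x (Z x) := by
  simp only [divg]
  rw [apply_eq_sum_single (fderiv ℝ f x), Finset.mul_sum, ← Finset.sum_add_distrib]
  refine Finset.sum_congr rfl fun i _ => ?_
  rw [fderiv_fun_smul hf hZ]
  simp [mul_comm]

theorem continuous_divg {n : ℕ} {g : E n → E n} (hg : ContDiff ℝ 1 g) : Continuous (divg g) := by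
  unfold divg
  refine continuous_finsetSum _ fun i _ => ?_
  have : Continuous fun x => fderiv ℝ g x (EuclideanSpace.single i 1) :=
    (hg.continuous_fderiv one_ne_zero).clm_apply continuous_const
  exact (EuclideanSpace.proj (𝕜 := ℝ) i).continuous.comp this

theorem divg_eq_zero_of_notMem {n : ℕ} {g : E n → E n} {x : E n} (hx : x ∉ tsupport g) :
    divg g x = 0 := by
  have : g =ᶠ[𝓝 x] fun _ => 0 := notMem_tsupport_iff_eventuallyEq.1 hx
  rw [divg_congr this]
  simp [divg]

/-- The Gauss-Green formula on the whole space for a Lipschitz function with compact support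
and a `C¹` field. -/
theorem integral_mul_divg {n : ℕ} {χ : E n → ℝ} {C : ℝ≥0} {F : E n → E n}
    (hχ : LipschitzWith C χ) (hχc : HasCompactSupport χ) (hF : ContDiff ℝ 1 F) :
    ∫ x, χ x * divg F x = -∫ x, fderiv ℝ χ x (F x) := by
  -- The components of `F` are only `C¹`; multiplied by `η` they become globally Lipschitz and are
  -- unchanged near the support of `χ`, so the integration by parts for two Lipschitz functions
  -- applies.
  obtain ⟨η, hη, hηc, -, hη1, -⟩ := exists_cutoff hχc.isCompact isOpen_univ (Set.subset_univ _)
  set f : Fin n → E n → ℝ := fun i x => η x * F x i with hf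
  have hfC : ∀ i, ContDiff ℝ 1 (f i) := fun i =>
    (hη.of_le (by norm_num)).mul ((contDiff_euclidean.1 hF) i)
  have hfc : ∀ i, HasCompactSupport (f i) := fun i => hηc.mul_right
  have hfL : ∀ i, ∃ D, LipschitzWith D (f i) := fun i =>
    ⟨_, (hfC i).lipschitzWith_of_hasCompactSupport (hfc i) one_ne_zero |>.choose_spec⟩
  have hnear : ∀ x ∈ tsupport χ, ∀ i, f i =ᶠ[𝓝 x] fun y => F y i := by
    intro x hx i
    filter_upwards [(mem_nhdsSet_iff_forall.1 hη1) x hx] with y hy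
    replace hy : η y = 1 := hy
    simp [hf, hy]
  have key : ∀ i, ∫ x, lineDeriv ℝ (f i) x (EuclideanSpace.single i 1) * χ x
      = -∫ x, lineDeriv ℝ χ x (EuclideanSpace.single i 1) * f i x := by
    intro i
    obtain ⟨D, hD⟩ := hfL i
    rw [LipschitzWith.integral_lineDeriv_mul_eq hD hχ hχc, ← integral_neg]
    congr 1; ext x
    rw [lineDeriv_neg]; ring
  have hint1 : ∀ i, Integrable fun x => lineDeriv ℝ (f i) x (EuclideanSpace.single i 1) * χ x := by
    intro i
    have : Continuous fun x => lineDeriv ℝ (f i) x (EuclideanSpace.single i 1) := by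
      have h1 : (fun x => lineDeriv ℝ (f i) x (EuclideanSpace.single i 1)) =
          fun x => fderiv ℝ (f i) x (EuclideanSpace.single i 1) := by
        ext x
        exact ((hfC i).differentiable one_ne_zero x).lineDeriv_eq_fderiv
      rw [h1]
      exact ((hfC i).continuous_fderiv one_ne_zero).clm_apply continuous_const
    exact (this.mul hχ.continuous).integrable_of_hasCompactSupport hχc.mul_left
  have hint2 : ∀ i, Integrable fun x => lineDeriv ℝ χ x (EuclideanSpace.single i 1) * f i x := by
    intro i
    refine ((hfC i).continuous.integrable_of_hasCompactSupport (hfc i)).bdd_mul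
      (c := C * ‖EuclideanSpace.single i (1 : ℝ)‖)
      (aestronglyMeasurable_lineDeriv hχ.continuous _) (Eventually.of_forall fun x => ?_)
    exact norm_lineDeriv_le_of_lipschitz ℝ hχ
  have e1 : ∫ x, χ x * divg F x =
      ∑ i, ∫ x, lineDeriv ℝ (f i) x (EuclideanSpace.single i 1) * χ x := by
    rw [← integral_finsetSum _ fun i _ => hint1 i]
    congr 1; ext x
    by_cases hx : x ∈ tsupport χ
    · simp only [divg, Finset.mul_sum]
      refine Finset.sum_congr rfl fun i _ => ?_
      have hd : DifferentiableAt ℝ F x := hF.differentiable one_ne_zero x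
      rw [((hfC i).differentiable one_ne_zero x).lineDeriv_eq_fderiv, (hnear x hx i).fderiv_eq,
        mul_comm]
      congr 1
      have := ((EuclideanSpace.proj (𝕜 := ℝ) i).hasFDerivAt.comp x hd.hasFDerivAt).fderiv
      have h2 : fderiv ℝ (fun y => F y i) x = _ := this
      rw [h2]; rfl
    · have : χ x = 0 := image_eq_zero_of_notMem_tsupport hx
      simp [this]
  have e2 : ∫ x, fderiv ℝ χ x (F x) =
      ∑ i, ∫ x, lineDeriv ℝ χ x (EuclideanSpace.single i 1) * f i x := by
    rw [← integral_finsetSum _ fun i _ => hint2 i]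
    refine integral_congr_ae ?_
    filter_upwards [hχ.ae_differentiableAt (μ := volume)] with x hx
    by_cases hxs : x ∈ tsupport χ
    · rw [apply_eq_sum_single]
      refine Finset.sum_congr rfl fun i _ => ?_
      rw [hx.lineDeriv_eq_fderiv, (hnear x hxs i).eq_of_nhds, mul_comm]
    · have h0 : χ =ᶠ[𝓝 x] fun _ => 0 := notMem_tsupport_iff_eventuallyEq.1 hxs
      have hz : fderiv ℝ χ x = 0 := by rw [h0.fderiv_eq]; simp
      have : ∀ i, lineDeriv ℝ χ x (EuclideanSpace.single i 1) = 0 := fun i => by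
        rw [hx.lineDeriv_eq_fderiv, hz]; rfl
      simp [this, hz]
  rw [e1, e2, ← Finset.sum_neg_distrib]
  exact Finset.sum_congr rfl fun i _ => key i

/-- Here the compact support belongs to the field, so `V` can be cut off away from it and the
previous formula applies. -/
theorem integral_mul_divg_of_contDiff {n : ℕ} {V : E n → ℝ} {g : E n → E n} (hV : ContDiff ℝ 1 V)
    (hg : ContDiff ℝ 1 g) (hgc : HasCompactSupport g) :
    ∫ x, V x * divg g x = -∫ x, fderiv ℝ V x (g x) := by
  obtain ⟨η, hη, hηc, -, hη1, -⟩ := exists_cutoff hgc.isCompact isOpen_univ (Set.subset_univ _)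
  have hηV : ContDiff ℝ 1 (fun x => η x * V x) := (hη.of_le (by norm_num)).mul hV
  have hc : HasCompactSupport (fun x => η x * V x) := hηc.mul_right
  obtain ⟨C, hC⟩ := hηV.lipschitzWith_of_hasCompactSupport hc one_ne_zero
  have hnear : ∀ x ∈ tsupport g, (fun x => η x * V x) =ᶠ[𝓝 x] V := by
    intro x hx
    filter_upwards [(mem_nhdsSet_iff_forall.1 hη1) x hx] with y hy
    replace hy : η y = 1 := hy
    simp [hy]
  have := integral_mul_divg hC hc hg
  have e1 : ∀ x, η x * V x * divg g x = V x * divg g x := fun x => by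
    by_cases hx : x ∈ tsupport g
    · have : η x * V x = V x := (hnear x hx).eq_of_nhds
      rw [this]
    · simp [divg_eq_zero_of_notMem hx]
  have e2 : ∀ x, fderiv ℝ (fun x => η x * V x) x (g x) = fderiv ℝ V x (g x) := fun x => by
    by_cases hx : x ∈ tsupport g
    · rw [(hnear x hx).fderiv_eq]
    · simp [image_eq_zero_of_notMem_tsupport hx]
  simpa only [e1, e2] using this

end Capillary

/-! ### Mollification of functions and of test fields -/

namespace Capillary

/-- The mollification of `f` by the normalised bump function `φ`. -/
noncomputable def mollify {n : ℕ} {F : Type*} [NormedAddCommGroup F] [NormedSpace ℝ F]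
    (φ : ContDiffBump (0 : E n)) (f : E n → F) : E n → F :=
  convolution (φ.normed volume) f (ContinuousLinearMap.lsmul ℝ ℝ) volume

section mollify

variable {n : ℕ} {F : Type*} [NormedAddCommGroup F] [NormedSpace ℝ F] (φ : ContDiffBump (0 : E n))

theorem mollify_apply (f : E n → F) (x : E n) :
    mollify φ f x = ∫ t, φ.normed volume t • f (x - t) := by
  simp [mollify, convolution_lsmul]

theorem mollify_apply' (f : E n → F) (x : E n) :
    mollify φ f x = ∫ t, φ.normed volume (x - t) • f t := by
  simp [mollify, convolution_lsmul_swap]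

theorem contDiff_mollify [CompleteSpace F] {f : E n → F} (hf : LocallyIntegrable f)
    (k : ℕ∞) : ContDiff ℝ k (mollify φ f) :=
  φ.hasCompactSupport_normed.contDiff_convolution_left _ φ.contDiff_normed hf

theorem integrable_normed_smul {f : E n → F} (hf : LocallyIntegrable f) (x : E n) :
    Integrable fun t => φ.normed volume t • f (x - t) :=
  φ.hasCompactSupport_normed.convolutionExists_left (ContinuousLinearMap.lsmul ℝ ℝ)
    φ.continuous_normed hf x

theorem support_mollify_subset (f : E n → F) {K : Set (E n)} (hf : tsupport f ⊆ K) :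
    Function.support (mollify φ f) ⊆ {x | ∃ y ∈ K, dist x y < φ.rOut} := by
  intro x hx
  by_contra hcon
  refine hx ?_
  rw [mollify_apply]
  refine integral_eq_zero_of_ae (Eventually.of_forall fun t => ?_)
  by_cases ht : t ∈ Metric.ball (0 : E n) φ.rOut
  · have : f (x - t) = 0 := by
      by_contra h0
      exact hcon ⟨x - t, hf (subset_tsupport _ h0), by simpa using ht⟩
    simp [this]
  · have : φ.normed volume t = 0 := by
      rw [← Function.notMem_support, φ.support_normed_eq]; exact ht
    simp [this]

theorem fderiv_mollify_apply [CompleteSpace F] {f : E n → F} (hf : ContDiff ℝ 1 f)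
    (hfc : HasCompactSupport f) (x e : E n) :
    fderiv ℝ (mollify φ f) x e = mollify φ (fun y => fderiv ℝ f y e) x := by
  have hL : LocallyIntegrable (φ.normed volume) (volume : Measure (E n)) :=
    φ.continuous_normed.locallyIntegrable
  have h := (hfc.hasFDerivAt_convolution_right (ContinuousLinearMap.lsmul ℝ ℝ) hL hf x).fderiv
  unfold mollify
  rw [h, convolution_precompR_apply _ hL (hfc.fderiv ℝ) (hf.continuous_fderiv one_ne_zero)]

theorem mollify_add {f g : E n → F} (hf : LocallyIntegrable f) (hg : LocallyIntegrable g)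
    (x : E n) : mollify φ (fun y => f y + g y) x = mollify φ f x + mollify φ g x := by
  simp only [mollify_apply, smul_add]
  exact integral_add (integrable_normed_smul φ hf x) (integrable_normed_smul φ hg x)

theorem mollify_finsetSum {ι : Type*} (s : Finset ι) {f : ι → E n → F}
    (hf : ∀ i, LocallyIntegrable (f i)) (x : E n) :
    mollify φ (fun y => ∑ i ∈ s, f i y) x = ∑ i ∈ s, mollify φ (f i) x := by
  simp only [mollify_apply, Finset.smul_sum]
  exact integral_finsetSum _ fun i _ => integrable_normed_smul φ (hf i) x

theorem mollify_clm_apply [CompleteSpace F] {F' : Type*} [NormedAddCommGroup F'] [NormedSpace ℝ F']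
    [CompleteSpace F']
    (L : F →L[ℝ] F') {f : E n → F} (hf : LocallyIntegrable f) (x : E n) :
    mollify φ (fun y => L (f y)) x = L (mollify φ f x) := by
  simp only [mollify_apply]
  rw [← L.integral_comp_comm (integrable_normed_smul φ hf x)]
  simp

theorem mollify_mono {f g : E n → ℝ} (hf : LocallyIntegrable f) (hg : LocallyIntegrable g)
    {x : E n} (h : ∀ y ∈ Metric.ball x φ.rOut, f y ≤ g y) : mollify φ f x ≤ mollify φ g x := by
  simp only [mollify_apply]
  refine integral_mono (integrable_normed_smul φ hf x) (integrable_normed_smul φ hg x) fun t => ?_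
  by_cases ht : t ∈ Metric.ball (0 : E n) φ.rOut
  · exact smul_le_smul_of_nonneg_left (h _ (by simpa using ht)) (φ.nonneg_normed t)
  · have : φ.normed volume t = 0 := by
      rw [← Function.notMem_support, φ.support_normed_eq]; exact ht
    simp [this]

theorem mollify_const (c : ℝ) (x : E n) : mollify φ (fun _ => c) x = c := by
  simp [mollify_apply, integral_mul_const, φ.integral_normed]

theorem divg_mollify {g : E n → E n} (hg : ContDiff ℝ 1 g) (hgc : HasCompactSupport g) (x : E n) :
    divg (mollify φ g) x = mollify φ (divg g) x := by
  unfold divg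
  have hli : ∀ i, LocallyIntegrable fun y => fderiv ℝ g y (EuclideanSpace.single i 1) := fun i =>
    ((hg.continuous_fderiv one_ne_zero).clm_apply continuous_const).locallyIntegrable
  rw [mollify_finsetSum]
  · refine Finset.sum_congr rfl fun i _ => ?_
    rw [fderiv_mollify_apply φ hg hgc]
    exact (mollify_clm_apply φ (EuclideanSpace.proj (𝕜 := ℝ) i) (hli i) x).symm
  · intro i
    exact ((EuclideanSpace.proj (𝕜 := ℝ) i).continuous.comp
      ((hg.continuous_fderiv one_ne_zero).clm_apply continuous_const)).locallyIntegrable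

/-- Mollification is self-adjoint by Fubini, because the bump function is even. -/
theorem integral_mollify_mul {f h : E n → ℝ} (hf : Integrable f) (hh : Integrable h) :
    ∫ x, mollify φ f x * h x = ∫ x, f x * mollify φ h x := by
  have hint : Integrable (Function.uncurry fun x t => φ.normed volume (x - t) * (f t * h x))
      ((volume : Measure (E n)).prod volume) := by
    have h1 : Integrable (fun z : E n × E n => f z.2 * h z.1) (volume.prod volume) := by
      have := hh.mul_prod hf
      simpa [mul_comm] using this
    obtain ⟨C, hC⟩ := (φ.hasCompactSupport_normed (μ := volume)).exists_bound_of_continuous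
      φ.continuous_normed
    refine h1.bdd_mul (c := C) ?_ (Eventually.of_forall fun z => hC _)
    exact (φ.continuous_normed.comp (continuous_fst.sub continuous_snd)).aestronglyMeasurable
  calc ∫ x, mollify φ f x * h x
      = ∫ x, ∫ t, φ.normed volume (x - t) * (f t * h x) := by
        congr 1; ext x
        rw [mollify_apply', ← integral_mul_const]
        congr 1; ext t; simp [mul_assoc]
    _ = ∫ t, ∫ x, φ.normed volume (x - t) * (f t * h x) := integral_integral_swap hint
    _ = ∫ x, f x * mollify φ h x := by
        congr 1; ext t
        rw [mollify_apply', ← integral_const_mul]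
        congr 1; ext x
        rw [← φ.normed_neg, neg_sub]; simp only [smul_eq_mul]; ring

/-- The pointwise constraint survives because the closed unit ball is convex. Averaging by Jensen is
done by duality: the mollified vector is paired with itself. -/
theorem isTestField_mollify {U Ω : Set (E n)} {g : E n → E n} {g₀ : E n → ℝ}
    (h : IsTestField U g g₀)
    (hU : ∀ x ∈ tsupport g ∪ tsupport g₀, Metric.closedBall x φ.rOut ⊆ Ω) :
    IsTestField Ω (mollify φ g) (mollify φ g₀) := by
  have hli : LocallyIntegrable g := h.contDiff.continuous.locallyIntegrable
  have hli₀ : LocallyIntegrable g₀ := h.contDiff₀.continuous.locallyIntegrable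
  have key : ∀ {F : Type} [NormedAddCommGroup F] [NormedSpace ℝ F] (f : E n → F),
      HasCompactSupport f → (∀ x ∈ tsupport f, Metric.closedBall x φ.rOut ⊆ Ω) →
      HasCompactSupport (mollify φ f) ∧ tsupport (mollify φ f) ⊆ Ω := by
    intro F _ _ f hf hfU
    have hK : IsCompact (Metric.cthickening φ.rOut (tsupport f)) :=
      hf.isCompact.cthickening
    have hs : tsupport (mollify φ f) ⊆ Metric.cthickening φ.rOut (tsupport f) := by
      refine closure_minimal ?_ Metric.isClosed_cthickening
      refine (support_mollify_subset φ f subset_rfl).trans ?_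
      rintro x ⟨y, hy, hxy⟩
      exact Metric.mem_cthickening_of_dist_le x y _ _ hy hxy.le
    refine ⟨hK.of_isClosed_subset (isClosed_tsupport _) hs, hs.trans ?_⟩
    rw [hf.isCompact.cthickening_eq_biUnion_closedBall φ.rOut_pos.le]
    simpa using hfU
  obtain ⟨hc, ht⟩ := key g h.hasCompactSupport fun x hx => hU x (Or.inl hx)
  obtain ⟨hc₀, ht₀⟩ := key g₀ h.hasCompactSupport₀ fun x hx => hU x (Or.inr hx)
  refine ⟨contDiff_mollify φ hli 1, contDiff_mollify φ hli₀ 1, hc, hc₀, ht, ht₀, fun x => ?_⟩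
  set a := mollify φ g x with ha
  set a₀ := mollify φ g₀ x with ha₀
  set s := ‖a‖ ^ 2 + a₀ ^ 2 with hs
  have hs0 : 0 ≤ s := by positivity
  have h1 : mollify φ (fun y => inner ℝ a (g y) + a₀ * g₀ y) x = s := by
    have e1 : LocallyIntegrable fun y => inner ℝ a (g y) :=
      (continuous_const.inner h.contDiff.continuous).locallyIntegrable
    have e2 : LocallyIntegrable fun y => a₀ * g₀ y :=
      (continuous_const.mul h.contDiff₀.continuous).locallyIntegrable
    rw [mollify_add φ e1 e2]
    have e3 := mollify_clm_apply φ (innerSL ℝ a) hli x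
    have e4 := mollify_clm_apply φ (a₀ • ContinuousLinearMap.id ℝ ℝ) hli₀ x
    simp only [innerSL_apply_apply, _root_.smul_apply, ContinuousLinearMap.id_apply,
      smul_eq_mul] at e3 e4
    rw [e3, e4, ← ha, ← ha₀, hs, real_inner_self_eq_norm_sq]; ring
  -- By Cauchy-Schwarz the pairing of the constant vector `(a, a₀)` with `(g, g₀)` is at most `√s`
  -- everywhere, hence so is its average `s`; this forces `s ≤ 1`.
  have h2 : s ≤ √s := by
    conv_lhs => rw [← h1]
    rw [← mollify_const φ (√s) x]
    refine mollify_mono φ ?_ continuous_const.locallyIntegrable fun y _ => ?_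
    · exact ((continuous_const.inner h.contDiff.continuous).add
        (continuous_const.mul h.contDiff₀.continuous)).locallyIntegrable
    · have hi := real_inner_le_norm a (g y)
      have hg := h.sq_le_one y
      refine Real.le_sqrt_of_sq_le ?_
      have hc : (‖a‖ * ‖g y‖ + a₀ * g₀ y) ^ 2 ≤ s := by
        have : (‖a‖ * ‖g y‖ + a₀ * g₀ y) ^ 2 ≤ s * (‖g y‖ ^ 2 + g₀ y ^ 2) := by
          nlinarith [sq_nonneg (‖a‖ * g₀ y - a₀ * ‖g y‖)]
        nlinarith
      have hi' := abs_real_inner_le_norm a (g y)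
      have hc2 : (‖a‖ * ‖g y‖ + |a₀ * g₀ y|) ^ 2 ≤ s := by
        rcases abs_cases (a₀ * g₀ y) with ⟨h5, -⟩ | ⟨h5, -⟩ <;> rw [h5]
        · exact hc
        · have : (‖a‖ * ‖g y‖ + -(a₀ * g₀ y)) ^ 2 ≤ s * (‖g y‖ ^ 2 + g₀ y ^ 2) := by
            nlinarith [sq_nonneg (‖a‖ * g₀ y + a₀ * ‖g y‖)]
          nlinarith
      refine (sq_le_sq' ?_ ?_).trans hc2
      · linarith [neg_abs_le (inner ℝ a (g y)), neg_abs_le (a₀ * g₀ y)]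
      · linarith [le_abs_self (a₀ * g₀ y)]
  have h3 : √s * √s = s := Real.mul_self_sqrt hs0
  have h4 : √s ≤ 1 := by
    by_contra hcon
    push Not at hcon
    nlinarith
  nlinarith [Real.sqrt_nonneg s]

/-- Testing a mollification is testing the function with mollified fields. -/
theorem integral_mollify_test_le {U Ω : Set (E n)} (hΩ : MeasurableSet Ω) {v : E n → ℝ}
    (hv : IntegrableOn v Ω) {g : E n → E n} {g₀ : E n → ℝ} (h : IsTestField U g g₀)
    (hU : ∀ x ∈ tsupport g ∪ tsupport g₀, Metric.closedBall x φ.rOut ⊆ Ω) :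
    ((∫ x, mollify φ (Ω.indicator v) x * (g₀ x + divg g x) : ℝ) : EReal) ≤ surfaceEnergy Ω v := by
  have hc : Continuous fun x => g₀ x + divg g x :=
    h.contDiff₀.continuous.add (continuous_divg h.contDiff)
  have hcs : HasCompactSupport (divg g) := by
    refine h.hasCompactSupport.mono' fun x hx => ?_
    by_contra hcon
    exact hx (divg_eq_zero_of_notMem hcon)
  have hint : Integrable fun x => g₀ x + divg g x :=
    (h.contDiff₀.continuous.integrable_of_hasCompactSupport h.hasCompactSupport₀).add
      ((continuous_divg h.contDiff).integrable_of_hasCompactSupport hcs)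
  rw [integral_mollify_mul φ (hv.integrable_indicator hΩ) hint]
  have e : ∫ x, Ω.indicator v x * mollify φ (fun x => g₀ x + divg g x) x =
      ∫ x in Ω, v x * (mollify φ g₀ x + divg (mollify φ g) x) := by
    rw [← integral_indicator hΩ]
    congr 1; ext x
    rw [mollify_add φ h.contDiff₀.continuous.locallyIntegrable
      (continuous_divg h.contDiff).locallyIntegrable, ← divg_mollify φ h.contDiff h.hasCompactSupport x]
    by_cases hx : x ∈ Ω <;> simp [hx]
  rw [e]
  exact le_iSup₂_of_le _ _ (le_iSup_of_le (isTestField_mollify φ h hU) le_rfl)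

end mollify

end Capillary

/-! ### Surface energy of mollifications -/

namespace Capillary

section energy

variable {n : ℕ}

theorem hasCompactSupport_divg {g : E n → E n} (hg : HasCompactSupport g) :
    HasCompactSupport (divg g) :=
  hg.mono' fun _ hx => by_contra fun hcon => hx (divg_eq_zero_of_notMem hcon)

/-- The gradient as a vector. -/
noncomputable def grad (V : E n → ℝ) (x : E n) : E n :=
  (InnerProductSpace.toDual ℝ (E n)).symm (fderiv ℝ V x)

theorem inner_grad (V : E n → ℝ) (x y : E n) : inner ℝ (grad V x) y = fderiv ℝ V x y := by
  simp [grad]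

theorem norm_grad (V : E n → ℝ) (x : E n) : ‖grad V x‖ = ‖fderiv ℝ V x‖ := by
  simp [grad]

theorem contDiff_grad {V : E n → ℝ} (hV : ContDiff ℝ 2 V) : ContDiff ℝ 1 (grad V) :=
  (InnerProductSpace.toDual ℝ (E n)).symm.contDiff.comp (hV.fderiv_right (by norm_num))

/-- The surface energy dominates the classical energy of a mollification on compact subsets. -/
theorem integral_sqrt_mollify_le {Ω : Set (E n)} (hΩ : MeasurableSet Ω) {v : E n → ℝ}
    (hv : IntegrableOn v Ω) {c : ℝ} (hc : surfaceEnergy Ω v ≤ c) (φ : ContDiffBump (0 : E n))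
    {K : Set (E n)} (hK : IsCompact K) (hKΩ : ∀ x ∈ K, Metric.closedBall x (2 * φ.rOut) ⊆ Ω) :
    ∫ x in K, √(mollify φ (Ω.indicator v) x ^ 2 +
      ‖fderiv ℝ (mollify φ (Ω.indicator v)) x‖ ^ 2) ≤ c := by
  set V := mollify φ (Ω.indicator v) with hVdef
  have hV : ContDiff ℝ 2 V :=
    contDiff_mollify φ (hv.integrable_indicator hΩ).locallyIntegrable 2
  -- One radius is spent on letting the test field reach beyond `K`, a second one on mollifying it;
  -- this is why balls of radius `2 * φ.rOut` must lie in `Ω`.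
  set U := Metric.thickening φ.rOut K
  have hU : ∀ x ∈ U, Metric.closedBall x φ.rOut ⊆ Ω := by
    intro x hx
    obtain ⟨y, hy, hxy⟩ := Metric.mem_thickening_iff.1 hx
    exact (Metric.closedBall_subset_closedBall' (by linarith)).trans (hKΩ y hy)
  obtain ⟨η, hη, hηc, hηU, hη1, hη01⟩ := exists_cutoff hK Metric.isOpen_thickening
    (Metric.self_subset_thickening φ.rOut_pos K)
  have hη1' : ContDiff ℝ 1 η := hη.of_le (by norm_num)
  have hV1 : ContDiff ℝ 1 V := hV.of_le (by norm_num)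
  have hG := contDiff_grad hV
  set q : E n → ℝ := fun x => V x ^ 2 + ‖fderiv ℝ V x‖ ^ 2 with hq
  have hq' : ∀ x, q x = V x ^ 2 + ‖grad V x‖ ^ 2 := fun x => by rw [norm_grad]
  have hqc : ContDiff ℝ 1 q := by
    have : q = fun x => V x ^ 2 + ‖grad V x‖ ^ 2 := funext hq'
    rw [this]
    exact (hV1.pow 2).add (hG.norm_sq ℝ)
  have hq0 : ∀ x, 0 ≤ q x := fun x => by positivity
  have main : ∀ δ : ℝ, 0 < δ → ∫ x in K, √(q x) ≤ c + δ * volume.real K := by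
    intro δ hδ
    -- The optimal field is `(-∇V, V) / √q`, which is singular where `q = 0`; `S` regularises the
    -- denominator. The minus sign is undone by the integration by parts.
    set S : E n → ℝ := fun x => √(δ ^ 2 + q x) with hS
    have hS0 : ∀ x, 0 < S x := fun x => Real.sqrt_pos.2 (by have := hq0 x; positivity)
    have hSc : ContDiff ℝ 1 S := (contDiff_const.add hqc).sqrt fun x => by
      have := hq0 x; positivity
    have hSS : ∀ x, S x ^ 2 = δ ^ 2 + q x := fun x =>
      Real.sq_sqrt (by have := hq0 x; positivity)
    have hr : ContDiff ℝ 1 fun x => η x / S x := hη1'.div hSc fun x => (hS0 x).ne'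
    set g : E n → E n := fun x => (-(η x / S x)) • grad V x with hg
    set g₀ : E n → ℝ := fun x => (η x / S x) * V x with hg₀
    have hsub : ∀ x, x ∉ Function.support η → g x = 0 ∧ g₀ x = 0 := fun x hx => by
      have : η x = 0 := by simpa using hx
      simp [hg, hg₀, this]
    have hs1 : Function.support g ⊆ Function.support η := fun x hx => by
      by_contra h; exact hx (hsub x h).1
    have hs2 : Function.support g₀ ⊆ Function.support η := fun x hx => by
      by_contra h; exact hx (hsub x h).2
    have htest : IsTestField U g g₀ := by
      refine ⟨hr.neg.smul hG, hr.mul hV1, hηc.mono hs1, hηc.mono hs2,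
        (closure_mono hs1).trans hηU, (closure_mono hs2).trans hηU, fun x => ?_⟩
      have e : ‖g x‖ ^ 2 + g₀ x ^ 2 = (η x) ^ 2 * (q x / S x ^ 2) := by
        simp only [hg, hg₀, norm_smul, hq', mul_pow, norm_neg, Real.norm_eq_abs, sq_abs]
        field_simp; ring
      rw [e]
      have h1 : η x ^ 2 ≤ 1 := by
        obtain ⟨h, h'⟩ := hη01 x
        nlinarith
      have h2 : q x / S x ^ 2 ≤ 1 := by
        rw [hSS, div_le_one (by have := hq0 x; positivity)]; nlinarith
      have h3 : 0 ≤ q x / S x ^ 2 := div_nonneg (hq0 x) (sq_nonneg _)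
      nlinarith [sq_nonneg (η x)]
    have h1 := (integral_mollify_test_le φ hΩ hv htest fun x hx => hU x
      (hx.elim (fun h => htest.tsupport_subset h) fun h => htest.tsupport_subset₀ h)).trans hc
    rw [EReal.coe_le_coe_iff] at h1
    have i1 : Integrable fun x => V x * g₀ x :=
      (hV1.continuous.mul htest.contDiff₀.continuous).integrable_of_hasCompactSupport
        htest.hasCompactSupport₀.mul_left
    have i2 : Integrable fun x => V x * divg g x :=
      (hV1.continuous.mul (continuous_divg htest.contDiff)).integrable_of_hasCompactSupport
        (hasCompactSupport_divg htest.hasCompactSupport).mul_left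
    have i3 : Integrable fun x => fderiv ℝ V x (g x) :=
      ((hV1.continuous_fderiv one_ne_zero).clm_apply
        htest.contDiff.continuous).integrable_of_hasCompactSupport
        (htest.hasCompactSupport.mono fun x hx h0 => hx (by simp [h0]))
    have e1 : ∫ x, V x * (g₀ x + divg g x) = ∫ x, η x * (q x / S x) := by
      simp only [mul_add]
      rw [integral_add i1 i2, integral_mul_divg_of_contDiff hV1 htest.contDiff
        htest.hasCompactSupport, ← sub_eq_add_neg, ← integral_sub i1 i3]
      congr 1; ext x
      rw [← inner_grad, hq']
      simp only [hg, hg₀, inner_smul_right, real_inner_self_eq_norm_sq]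
      field_simp; ring
    have hint : Integrable fun x => η x * (q x / S x) :=
      (hη.continuous.mul (hqc.continuous.div hSc.continuous
        fun x => (hS0 x).ne')).integrable_of_hasCompactSupport hηc.mul_right
    -- Pointwise, `q / S = S - δ² / S ≥ S - δ ≥ √q - δ`.
    have e2 : ∫ x in K, (√(q x) - δ) ≤ ∫ x, η x * (q x / S x) := by
      have hle : ∫ x in K, η x * (q x / S x) ≤ ∫ x, η x * (q x / S x) :=
        setIntegral_le_integral hint (Eventually.of_forall fun x =>
          mul_nonneg (hη01 x).1 (div_nonneg (hq0 x) (hS0 x).le))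
      refine le_trans (setIntegral_mono_on ?_ hint.integrableOn hK.measurableSet
        fun x hx => ?_) hle
      · exact (hqc.continuous.sqrt.sub continuous_const).continuousOn.integrableOn_compact hK
      · have : η x = 1 := hη1.self_of_nhdsSet x hx
        rw [this, one_mul, le_div_iff₀ (hS0 x)]
        have h5 : S x ≤ δ + √(q x) := by
          refine Real.sqrt_le_iff.2 ⟨by positivity, ?_⟩
          nlinarith [Real.sq_sqrt (hq0 x), Real.sqrt_nonneg (q x)]
        have h6 : δ ≤ S x := Real.le_sqrt_of_sq_le (by linarith [hq0 x])
        have h7 : √(q x) ≤ S x := Real.sqrt_le_sqrt (by nlinarith)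
        nlinarith [Real.sq_sqrt (hq0 x), Real.sqrt_nonneg (q x), hSS x]
    rw [integral_sub (hqc.continuous.sqrt.continuousOn.integrableOn_compact hK)
      (integrableOn_const hK.measure_lt_top.ne), setIntegral_const, smul_eq_mul] at e2
    rw [e1] at h1
    linarith
  refine le_of_forall_pos_le_add fun ε hε => ?_
  have := main (ε / (volume.real K + 1)) (by positivity)
  refine this.trans ?_
  gcongr
  rw [div_mul_eq_mul_div, div_le_iff₀ (by positivity)]
  nlinarith [measureReal_nonneg (μ := (volume : Measure (E n))) (s := K)]

end energy

end Capillary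

/-! ### Convergence of mollifications in the mean -/

namespace Capillary

section approx

variable {n : ℕ}

theorem integrable_mollify (φ : ContDiffBump (0 : E n)) {f : E n → ℝ} (hf : Integrable f) :
    Integrable (mollify φ f) :=
  Integrable.integrable_convolution (ContinuousLinearMap.lsmul ℝ ℝ)
    (φ.continuous_normed.integrable_of_hasCompactSupport φ.hasCompactSupport_normed) hf

theorem mollify_sub (φ : ContDiffBump (0 : E n)) {f g : E n → ℝ} (hf : LocallyIntegrable f)
    (hg : LocallyIntegrable g) (x : E n) :
    mollify φ (fun y => f y - g y) x = mollify φ f x - mollify φ g x := by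
  simp only [mollify_apply, smul_sub]
  exact integral_sub (integrable_normed_smul φ hf x) (integrable_normed_smul φ hg x)

theorem integral_abs_mollify_le (φ : ContDiffBump (0 : E n)) {f : E n → ℝ} (hf : Integrable f) :
    ∫ x, |mollify φ f x| ≤ ∫ x, |f x| := by
  have h1 : ∫ x, mollify φ (fun y => |f y|) x = ∫ x, |f x| := by
    have hφ : Integrable (φ.normed volume) (volume : Measure (E n)) :=
      φ.continuous_normed.integrable_of_hasCompactSupport φ.hasCompactSupport_normed
    have := integral_convolution (ContinuousLinearMap.lsmul ℝ ℝ) hφ hf.abs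
    simp only [ContinuousLinearMap.lsmul_apply, φ.integral_normed, one_smul] at this
    exact this
  rw [← h1]
  refine integral_mono (integrable_mollify φ hf).abs (integrable_mollify φ hf.abs) fun x => ?_
  simp only [mollify_apply]
  refine (abs_integral_le_integral_abs).trans_eq ?_
  congr 1; ext t
  simp [abs_mul, abs_of_nonneg (φ.nonneg_normed t)]

/-- Mollifications converge in `L¹`. -/
theorem exists_integral_abs_mollify_sub_le {f : E n → ℝ} (hf : Integrable f) {ε : ℝ} (hε : 0 < ε) :
    ∃ r > 0, ∀ φ : ContDiffBump (0 : E n), φ.rOut < r → ∫ x, |mollify φ f x - f x| ≤ ε := by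
  obtain ⟨h, hhc, hfh, hhcont, hhi⟩ := hf.exists_hasCompactSupport_integral_sub_le
    (show (0 : ℝ) < ε / 4 by positivity)
  set K := Metric.cthickening 1 (tsupport h) with hK
  have hKc : IsCompact K := hhc.isCompact.cthickening
  have huc := hhc.uniformContinuous_of_continuous hhcont
  obtain ⟨r, hr, hr'⟩ := Metric.uniformContinuous_iff.1 huc (ε / (4 * (volume.real K + 1)))
    (by positivity)
  refine ⟨min r 1, by positivity, fun φ hφ => ?_⟩
  have hφr : φ.rOut < r := hφ.trans_le (min_le_left _ _)
  have hφ1 : φ.rOut < 1 := hφ.trans_le (min_le_right _ _)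
  have hd : ∀ x, |mollify φ h x - h x| ≤ K.indicator (fun _ => ε / (4 * (volume.real K + 1))) x := by
    intro x
    by_cases hx : x ∈ K
    · rw [Set.indicator_of_mem hx, ← Real.dist_eq]
      refine φ.dist_normed_convolution_le hhcont.aestronglyMeasurable fun y hy => ?_
      exact (hr' (lt_trans hy hφr)).le
    · have h0 : h x = 0 := image_eq_zero_of_notMem_tsupport fun h' =>
        hx (Metric.self_subset_cthickening _ h')
      have h1 : mollify φ h x = 0 := by
        by_contra hne
        obtain ⟨y, hy, hxy⟩ := support_mollify_subset φ h subset_rfl hne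
        exact hx (Metric.mem_cthickening_of_dist_le x y _ _ hy (hxy.trans hφ1).le)
      simp [h0, h1, hx]
  have hb : ∫ x, |mollify φ h x - h x| ≤ ε / 4 := by
    refine (integral_mono ((integrable_mollify φ hhi).sub hhi).abs
      ((integrable_indicator_iff hKc.measurableSet).2 (integrableOn_const hKc.measure_lt_top.ne))
      hd).trans ?_
    rw [integral_indicator hKc.measurableSet, setIntegral_const, smul_eq_mul,
      mul_div_assoc', div_le_div_iff₀ (by positivity) (by norm_num)]
    nlinarith [measureReal_nonneg (μ := (volume : Measure (E n))) (s := K)]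
  have hfh' : ∫ x, |f x - h x| ≤ ε / 4 := by simpa [Real.norm_eq_abs] using hfh
  have hm : ∫ x, |mollify φ f x - mollify φ h x| ≤ ε / 4 := by
    have := integral_abs_mollify_le φ (hf.sub hhi)
    simp only [Pi.sub_def] at this
    rw [← integral_congr_ae (Eventually.of_forall fun x => congrArg abs (mollify_sub φ
      hf.locallyIntegrable hhi.locallyIntegrable x))]
    exact this.trans hfh'
  have i1 : Integrable fun x => |mollify φ f x - mollify φ h x| :=
    ((integrable_mollify φ hf).sub (integrable_mollify φ hhi)).abs
  have i2 : Integrable fun x => |mollify φ h x - h x| := ((integrable_mollify φ hhi).sub hhi).abs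
  have i3 : Integrable fun x => |f x - h x| := (hf.sub hhi).abs
  calc ∫ x, |mollify φ f x - f x|
      ≤ ∫ x, (|mollify φ f x - mollify φ h x| + |mollify φ h x - h x| + |f x - h x|) := by
        refine integral_mono ((integrable_mollify φ hf).sub hf).abs ((i1.add i2).add i3)
          fun x => ?_
        have := abs_sub_le (mollify φ f x) (mollify φ h x) (f x)
        have h2 := abs_sub_le (mollify φ h x) (h x) (f x)
        rw [abs_sub_comm (h x)] at h2
        simp only
        linarith
    _ = _ := by
        rw [integral_add (f := fun x => |mollify φ f x - mollify φ h x| + |mollify φ h x - h x|)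
          (i1.add i2) i3, integral_add (f := fun x => |mollify φ f x - mollify φ h x|) i1 i2]
    _ ≤ ε := by linarith

end approx

/-! ### The calibration inequality -/

section calibration

variable {n : ℕ}

theorem measurable_fderiv_apply {χ : E n → ℝ} {Z : E n → E n} (hZ : Continuous Z) :
    Measurable fun x => fderiv ℝ χ x (Z x) := by
  simp only [fun x => apply_eq_sum_single (fderiv ℝ χ x) (Z x)]
  refine Finset.measurable_fun_sum _ fun i _ => ?_
  exact ((EuclideanSpace.proj (𝕜 := ℝ) i).continuous.comp hZ).measurable.mul
    (measurable_fderiv_apply_const ℝ χ _)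

theorem mul_add_le_sqrt {a b x y : ℝ} (h : x ^ 2 + y ^ 2 ≤ 1) : a * x + b * y ≤ √(a ^ 2 + b ^ 2) := by
  refine Real.le_sqrt_of_sq_le ?_
  nlinarith [sq_nonneg (a * y - b * x), sq_nonneg a, sq_nonneg b]

/-- A smooth approximation of the positive part. -/
noncomputable def softPos (δ t : ℝ) : ℝ := (√(δ ^ 2 + t ^ 2) + t) / 2

/-- The derivative of `softPos`. -/
noncomputable def softPosDeriv (δ t : ℝ) : ℝ := (t / √(δ ^ 2 + t ^ 2) + 1) / 2

theorem hasDerivAt_softPos {δ : ℝ} (hδ : 0 < δ) (t : ℝ) :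
    HasDerivAt (softPos δ) (softPosDeriv δ t) t := by
  have h1 : HasDerivAt (fun t : ℝ => δ ^ 2 + t ^ 2) (2 * t) t := by
    simpa using (hasDerivAt_pow 2 t).const_add (δ ^ 2)
  have h2 := ((h1.sqrt (by positivity)).add (hasDerivAt_id t)).div_const 2
  refine h2.congr_deriv ?_
  simp only [softPosDeriv]
  congr 2
  rw [mul_div_mul_left _ _ (by norm_num)]

theorem contDiff_softPos {δ : ℝ} (hδ : 0 < δ) : ContDiff ℝ 1 (softPos δ) :=
  (((contDiff_const.add (contDiff_id.pow 2)).sqrt fun t => by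
    simp only [id]; positivity).add contDiff_id).div_const 2

theorem softPosDeriv_mem {δ : ℝ} (hδ : 0 < δ) (t : ℝ) : softPosDeriv δ t ∈ Set.Icc (0 : ℝ) 1 := by
  have hS : 0 < √(δ ^ 2 + t ^ 2) := Real.sqrt_pos.2 (by positivity)
  have h1 : |t| ≤ √(δ ^ 2 + t ^ 2) := Real.abs_le_sqrt (by nlinarith)
  have h2 : |t / √(δ ^ 2 + t ^ 2)| ≤ 1 := by
    rw [abs_div, abs_of_pos hS]; exact (div_le_one hS).2 h1
  obtain ⟨h3, h4⟩ := abs_le.1 h2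
  constructor <;> simp only [softPosDeriv] <;> linarith

theorem softPos_nonneg (δ t : ℝ) : 0 ≤ softPos δ t := by
  have : |t| ≤ √(δ ^ 2 + t ^ 2) := Real.abs_le_sqrt (by nlinarith)
  have := neg_abs_le t
  simp only [softPos]; linarith

theorem abs_softPos_sub_le {δ : ℝ} (hδ : 0 < δ) (t : ℝ) : |softPos δ t - max t 0| ≤ δ := by
  have h1 : |t| ≤ √(δ ^ 2 + t ^ 2) := Real.abs_le_sqrt (by nlinarith)
  have h2 : √(δ ^ 2 + t ^ 2) ≤ δ + |t| := by
    refine Real.sqrt_le_iff.2 ⟨by positivity, ?_⟩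
    nlinarith [sq_abs t, abs_nonneg t]
  have h3 : max t 0 = (|t| + t) / 2 := by
    rcases le_total 0 t with h | h
    · rw [max_eq_left h, abs_of_nonneg h]; ring
    · rw [max_eq_right h, abs_of_nonpos h]; ring
  rw [h3, abs_le]
  constructor <;> simp only [softPos] <;> linarith

/-- The positive part is homogeneous of degree one and satisfies Euler's identity; smoothing it
violates the identity by at most `δ / 2`. This is the only error in the pointwise calibration. -/
theorem softPos_sub_mem {δ : ℝ} (hδ : 0 < δ) (t : ℝ) :
    softPos δ t - softPosDeriv δ t * t ∈ Set.Icc 0 (δ / 2) := by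
  have hS : 0 < √(δ ^ 2 + t ^ 2) := Real.sqrt_pos.2 (by positivity)
  have hSS : √(δ ^ 2 + t ^ 2) ^ 2 = δ ^ 2 + t ^ 2 := Real.sq_sqrt (by positivity)
  have h1 : δ ≤ √(δ ^ 2 + t ^ 2) := Real.le_sqrt_of_sq_le (by nlinarith)
  have e : softPos δ t - softPosDeriv δ t * t = δ * (δ / √(δ ^ 2 + t ^ 2)) / 2 := by
    simp only [softPos, softPosDeriv]
    field_simp
    linear_combination hSS
  have h2 : δ / √(δ ^ 2 + t ^ 2) ≤ 1 := (div_le_one hS).2 h1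
  have h3 : 0 ≤ δ / √(δ ^ 2 + t ^ 2) := by positivity
  rw [e]
  constructor
  · positivity
  · nlinarith

/-- The pointwise inequality behind the calibration argument. -/
theorem calibration_pointwise {V ψ z₀ g₀ χ θ b δ DVg DVZ Dψg DψZ N : ℝ} {ng nZ : ℝ}
    (hθ : θ ∈ Set.Icc (0 : ℝ) 1) (hχ : χ ∈ Set.Icc (0 : ℝ) 1)
    (hb : b - θ * (V - ψ) ∈ Set.Icc 0 (δ / 2)) (hb0 : 0 ≤ b) (hz0 : 0 ≤ z₀)
    (hg : ng ^ 2 + g₀ ^ 2 ≤ 1) (hZ : nZ ^ 2 + z₀ ^ 2 ≤ 1)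
    (hDVg : |DVg| ≤ N * ng) (hDVZ : |DVZ| ≤ N * nZ)
    (hcal : ψ * g₀ - Dψg ≤ ψ * z₀ + DψZ) (hcal0 : 0 ≤ ψ * z₀ + DψZ)
    (h : χ = 1 ∨ (g₀ = 0 ∧ DVg = 0 ∧ Dψg = 0)) :
    (V - b) * g₀ - (DVg - θ * (DVg - Dψg)) + χ * (θ * (DVZ - DψZ)) ≤ √(V ^ 2 + N ^ 2) + δ := by
  have hs1 : V * g₀ - DVg ≤ √(V ^ 2 + N ^ 2) := by
    have := mul_add_le_sqrt (a := V) (b := N) (x := g₀) (y := ng) (by linarith)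
    linarith [neg_abs_le DVg]
  have hs2 : V * z₀ + DVZ ≤ √(V ^ 2 + N ^ 2) := by
    have := mul_add_le_sqrt (a := V) (b := N) (x := z₀) (y := nZ) (by linarith)
    linarith [le_abs_self DVZ]
  have hS : 0 ≤ √(V ^ 2 + N ^ 2) := Real.sqrt_nonneg _
  have hz1 : z₀ ≤ 1 := by nlinarith [sq_nonneg nZ]
  have hg1 : -1 ≤ g₀ := by nlinarith [sq_nonneg ng]
  obtain ⟨hθ0, hθ1⟩ := hθ
  obtain ⟨hχ0, hχ1⟩ := hχ
  obtain ⟨hb1, hb2⟩ := hb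
  -- Since `b ≥ 0`, the number `θ * (V - ψ)` is at least `-δ / 2`, and `0 ≤ z₀ ≤ 1`.
  have hP : -(θ * (V - ψ)) * z₀ ≤ δ / 2 := by
    rcases le_total 0 (θ * (V - ψ)) with h5 | h5
    · nlinarith
    · nlinarith
  -- Where `χ = 1` the expression is a convex combination with weights `1 - θ` and `θ`: the first
  -- part is `V` tested with `g`, and in the second the calibration replaces the test of `ψ` with
  -- `g` by that with `Z`, which leaves `V` tested with `Z`. Each is at most the integrand.
  -- Elsewhere the terms in `g` vanish, and only the multiple by `χ` of a quantity below the bound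
  -- remains.
  rcases h with rfl | ⟨rfl, rfl, rfl⟩
  · have e1 : -(b - θ * (V - ψ)) * g₀ ≤ δ / 2 := by nlinarith
    have e2 : (1 - θ) * (V * g₀ - DVg) ≤ (1 - θ) * √(V ^ 2 + N ^ 2) :=
      mul_le_mul_of_nonneg_left hs1 (by linarith)
    have e3 : θ * (ψ * g₀ - Dψg) ≤ θ * (ψ * z₀ + DψZ) := mul_le_mul_of_nonneg_left hcal hθ0
    have e4 : θ * (V * z₀ + DVZ) ≤ θ * √(V ^ 2 + N ^ 2) := mul_le_mul_of_nonneg_left hs2 hθ0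
    linarith
  · have e4 : θ * (V * z₀ + DVZ) ≤ θ * √(V ^ 2 + N ^ 2) := mul_le_mul_of_nonneg_left hs2 hθ0
    have e5 : 0 ≤ θ * (ψ * z₀ + DψZ) := mul_nonneg hθ0 hcal0
    have e6 : θ * (DVZ - DψZ) ≤ √(V ^ 2 + N ^ 2) + δ := by nlinarith
    have e7 : 0 ≤ √(V ^ 2 + N ^ 2) + δ := by linarith
    nlinarith

end calibration

end Capillary

namespace Capillary

section calibration

variable {n : ℕ}

theorem fderiv_softPos_comp {δ : ℝ} (hδ : 0 < δ) {P : E n → ℝ} {x : E n}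
    (hP : DifferentiableAt ℝ P x) (y : E n) :
    fderiv ℝ (fun x => softPos δ (P x)) x y = softPosDeriv δ (P x) * fderiv ℝ P x y := by
  have h : HasFDerivAt (fun x => softPos δ (P x)) (softPosDeriv δ (P x) • fderiv ℝ P x) x :=
    (hasDerivAt_softPos hδ (P x)).comp_hasFDerivAt x hP.hasFDerivAt
  rw [h.fderiv]
  simp

/-- The calibration inequality for a smooth function and the smoothed positive part. -/
theorem calibration_smooth {V : E n → ℝ} (hV : ContDiff ℝ 1 V) {c : ℝ}
    {U : Set (E n)} {g : E n → E n} {g₀ : E n → ℝ} (ht : IsTestField U g g₀)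
    {χ : E n → ℝ} {C : ℝ≥0} (hχ : LipschitzWith C χ) (hχc : HasCompactSupport χ)
    (h01 : ∀ x, χ x ∈ Set.Icc (0 : ℝ) 1) (hχ1 : ∀ x ∈ tsupport g ∪ tsupport g₀, χ x = 1)
    {ψ : E n → ℝ} (hψ : ContDiff ℝ 1 ψ) {Z : E n → E n} (hZ : ContDiff ℝ 1 Z) {z₀ : E n → ℝ}
    (hz₀ : ∀ x, 0 ≤ z₀ x) (hz : ∀ x, ‖Z x‖ ^ 2 + z₀ x ^ 2 ≤ 1)
    (hcal : ∀ x p q, ‖p‖ ^ 2 + q ^ 2 ≤ 1 →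
      ψ x * q - fderiv ℝ ψ x p ≤ ψ x * z₀ x + fderiv ℝ ψ x (Z x))
    (hc : ∫ x in tsupport χ, √(V x ^ 2 + ‖fderiv ℝ V x‖ ^ 2) ≤ c) {δ : ℝ} (hδ : 0 < δ) :
    (∫ x in tsupport χ, ((V x - softPos δ (V x - ψ x)) * (g₀ x + divg g x) -
      softPos δ (V x - ψ x) * (χ x * divg Z x + fderiv ℝ χ x (Z x)))) ≤
      c + δ * volume.real (tsupport χ) := by
  have hK : IsCompact (tsupport χ) := hχc
  have hsub : tsupport g ∪ tsupport g₀ ⊆ tsupport χ := fun x hx =>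
    subset_tsupport χ (by simp [hχ1 x hx])
  set B : E n → ℝ := fun x => softPos δ (V x - ψ x) with hB
  have hP : ContDiff ℝ 1 fun x => V x - ψ x := hV.sub hψ
  have hBc : ContDiff ℝ 1 B := (contDiff_softPos hδ).comp hP
  have hW : ContDiff ℝ 1 fun x => V x - B x := hV.sub hBc
  have hDB : ∀ x y, fderiv ℝ B x y =
      softPosDeriv δ (V x - ψ x) * (fderiv ℝ V x y - fderiv ℝ ψ x y) := by
    intro x y
    have h1 := fderiv_softPos_comp hδ (hP.differentiable one_ne_zero x) y
    have h2 : fderiv ℝ (fun x => V x - ψ x) x y = fderiv ℝ V x y - fderiv ℝ ψ x y := by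
      rw [fderiv_fun_sub (hV.differentiable one_ne_zero x) (hψ.differentiable one_ne_zero x)]
      rfl
    rw [← h2]; exact h1
  have hDW : ∀ x y, fderiv ℝ (fun x => V x - B x) x y = fderiv ℝ V x y - fderiv ℝ B x y := by
    intro x y
    rw [fderiv_fun_sub (hV.differentiable one_ne_zero x) (hBc.differentiable one_ne_zero x)]
    rfl
  have i1 : Integrable fun x => (V x - B x) * g₀ x :=
    (hW.continuous.mul ht.contDiff₀.continuous).integrable_of_hasCompactSupport
      ht.hasCompactSupport₀.mul_left
  have i2 : Integrable fun x => (V x - B x) * divg g x :=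
    (hW.continuous.mul (continuous_divg ht.contDiff)).integrable_of_hasCompactSupport
      (hasCompactSupport_divg ht.hasCompactSupport).mul_left
  have i3 : Integrable fun x => fderiv ℝ (fun x => V x - B x) x (g x) :=
    ((hW.continuous_fderiv one_ne_zero).clm_apply
      ht.contDiff.continuous).integrable_of_hasCompactSupport
      (ht.hasCompactSupport.mono fun x hx h0 => hx (by simp [h0]))
  have i4 : Integrable fun x => χ x * (B x * divg Z x) :=
    (hχ.continuous.mul (hBc.continuous.mul
      (continuous_divg hZ))).integrable_of_hasCompactSupport hχc.mul_right
  have i5 : Integrable fun x => χ x * fderiv ℝ B x (Z x) :=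
    (hχ.continuous.mul ((hBc.continuous_fderiv one_ne_zero).clm_apply
      hZ.continuous)).integrable_of_hasCompactSupport hχc.mul_right
  have i6 : Integrable fun x => B x * fderiv ℝ χ x (Z x) := by
    -- `fderiv ℝ χ` is merely bounded and measurable; the cutoff supplies an integrable majorant
    -- that is exact on the support of `χ`.
    obtain ⟨η, hη, hηc, -, hη1, -⟩ := exists_cutoff hK isOpen_univ (Set.subset_univ _)
    have h1 : Integrable fun x => η x * B x * ‖Z x‖ :=
      ((hη.continuous.mul hBc.continuous).mul hZ.continuous.norm).integrable_of_hasCompactSupport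
        (hηc.mul_right.mul_right)
    refine (h1.norm.const_mul (C : ℝ)).mono
      (hBc.continuous.aestronglyMeasurable.mul
        (measurable_fderiv_apply hZ.continuous).aestronglyMeasurable)
      (Eventually.of_forall fun x => ?_)
    by_cases hx : x ∈ tsupport χ
    · have e : η x = 1 := hη1.self_of_nhdsSet x hx
      have h2 : ‖fderiv ℝ χ x (Z x)‖ ≤ C * ‖Z x‖ :=
        ((fderiv ℝ χ x).le_opNorm _).trans (mul_le_mul_of_nonneg_right
          (norm_fderiv_le_of_lipschitz ℝ hχ) (norm_nonneg _))
      simp only [norm_mul, e, one_mul, Real.norm_eq_abs, NNReal.abs_eq, abs_abs]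
        at h2 ⊢
      simp only [abs_norm]
      nlinarith [abs_nonneg (B x)]
    · have h0 : χ =ᶠ[𝓝 x] fun _ => 0 := notMem_tsupport_iff_eventuallyEq.1 hx
      have : fderiv ℝ χ x = 0 := by rw [h0.fderiv_eq]; simp
      simp only [this, _root_.zero_apply, mul_zero, norm_zero]
      positivity
  -- Both integrations by parts take place inside a compact set, so there is no boundary term. It is
  -- encoded in `fderiv ℝ χ`, and emerges when `χ` increases to `1`.
  have ibp1 := integral_mul_divg_of_contDiff hW ht.contDiff ht.hasCompactSupport
  have ibp2 := integral_mul_divg hχ hχc (hBc.smul hZ)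
  have e2 : ∀ x, χ x * divg (fun y => B y • Z y) x =
      χ x * (B x * divg Z x) + χ x * fderiv ℝ B x (Z x) := fun x => by
    rw [divg_smul (hBc.differentiable one_ne_zero x) (hZ.differentiable one_ne_zero x)]; ring
  have e3 : ∀ x, fderiv ℝ χ x (B x • Z x) = B x * fderiv ℝ χ x (Z x) := fun x => by simp
  have ibp2' : (∫ x, χ x * (B x * divg Z x)) + ∫ x, χ x * fderiv ℝ B x (Z x) =
      -∫ x, B x * fderiv ℝ χ x (Z x) := by
    rw [← integral_add i4 i5, ← integral_congr_ae (Eventually.of_forall e2),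
      ← integral_congr_ae (Eventually.of_forall e3)]
    exact ibp2
  have hout : ∀ x, x ∉ tsupport χ → g x = 0 ∧ g₀ x = 0 ∧ divg g x = 0 ∧ χ x = 0 ∧
      fderiv ℝ χ x = 0 := fun x hx => by
    have h0 : χ =ᶠ[𝓝 x] fun _ => 0 := notMem_tsupport_iff_eventuallyEq.1 hx
    refine ⟨image_eq_zero_of_notMem_tsupport fun h => hx (hsub (Or.inl h)),
      image_eq_zero_of_notMem_tsupport fun h => hx (hsub (Or.inr h)),
      divg_eq_zero_of_notMem fun h => hx (hsub (Or.inl h)), h0.eq_of_nhds, ?_⟩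
    rw [h0.fderiv_eq]; simp
  set I : E n → ℝ := fun x => (V x - B x) * g₀ x - fderiv ℝ (fun x => V x - B x) x (g x) +
    χ x * fderiv ℝ B x (Z x) with hI
  have total : (∫ x in tsupport χ, ((V x - B x) * (g₀ x + divg g x) -
      B x * (χ x * divg Z x + fderiv ℝ χ x (Z x)))) = ∫ x, I x := by
    rw [setIntegral_eq_integral_of_forall_compl_eq_zero (fun x hx => by
      obtain ⟨h1, h2, h3, h4, h5⟩ := hout x hx
      simp [h2, h3, h4, h5])]
    have : ∀ x, (V x - B x) * (g₀ x + divg g x) - B x * (χ x * divg Z x + fderiv ℝ χ x (Z x)) =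
        ((V x - B x) * g₀ x + (V x - B x) * divg g x) -
          (χ x * (B x * divg Z x) + B x * fderiv ℝ χ x (Z x)) := fun x => by ring
    simp only [this, hI]
    have i12 : Integrable fun x => (V x - B x) * g₀ x + (V x - B x) * divg g x := i1.add i2
    have i46 : Integrable fun x => χ x * (B x * divg Z x) + B x * fderiv ℝ χ x (Z x) := i4.add i6
    have i13 : Integrable fun x => (V x - B x) * g₀ x -
      fderiv ℝ (fun x => V x - B x) x (g x) := i1.sub i3
    rw [integral_sub i12 i46, integral_add i1 i2, integral_add i4 i6,
      integral_add i13 i5, integral_sub i1 i3]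
    linarith
  have hIi : Integrable I := (i1.sub i3).add i5
  rw [total, ← setIntegral_eq_integral_of_forall_compl_eq_zero (s := tsupport χ) (f := I)
    (fun x hx => by
      obtain ⟨h1, h2, h3, h4, h5⟩ := hout x hx
      simp [hI, h1, h2, h4])]
  have hqi : IntegrableOn (fun x => √(V x ^ 2 + ‖fderiv ℝ V x‖ ^ 2)) (tsupport χ) :=
    ((hV.continuous.pow 2).add
      ((hV.continuous_fderiv one_ne_zero).norm.pow 2)).sqrt.continuousOn.integrableOn_compact hK
  have hbound : ∀ x ∈ tsupport χ, I x ≤ √(V x ^ 2 + ‖fderiv ℝ V x‖ ^ 2) + δ := by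
    intro x _
    simp only [hI, hDW, hDB]
    refine calibration_pointwise (ng := ‖g x‖) (nZ := ‖Z x‖) (softPosDeriv_mem hδ _) (h01 x)
      (softPos_sub_mem hδ _) (softPos_nonneg _ _) (hz₀ x) (ht.sq_le_one x) (hz x)
      ((fderiv ℝ V x).le_opNorm _) ((fderiv ℝ V x).le_opNorm _)
      (hcal x _ _ (ht.sq_le_one x)) ?_ ?_
    · simpa using hcal x 0 0 (by simp)
    · by_cases hx : x ∈ tsupport g ∪ tsupport g₀
      · exact Or.inl (hχ1 x hx)
      · have h1 : g x = 0 := image_eq_zero_of_notMem_tsupport fun h => hx (Or.inl h)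
        have h2 : g₀ x = 0 := image_eq_zero_of_notMem_tsupport fun h => hx (Or.inr h)
        simp [h1, h2]
  refine (setIntegral_mono_on hIi.integrableOn
    (hqi.add (integrableOn_const hK.measure_lt_top.ne)) hK.measurableSet hbound).trans ?_
  simp only [Pi.add_apply]
  rw [integral_add hqi (integrableOn_const hK.measure_lt_top.ne), setIntegral_const, smul_eq_mul]
  linarith

theorem le_of_forall_pos_le_add_mul {a b D : ℝ} (hD : 0 ≤ D)
    (h : ∀ η > 0, a ≤ b + η * D) : a ≤ b := by
  refine le_of_forall_pos_le_add fun ε hε => ?_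
  refine (h (ε / (D + 1)) (by positivity)).trans ?_
  gcongr
  rw [div_mul_eq_mul_div, div_le_iff₀ (by positivity)]
  nlinarith

/-- The calibration inequality. -/
theorem calibration_le {Ω : Set (E n)} (hΩ : IsOpen Ω) {v : E n → ℝ} (hv : IntegrableOn v Ω)
    {c : ℝ} (hc : surfaceEnergy Ω v ≤ c)
    {g : E n → E n} {g₀ : E n → ℝ} (ht : IsTestField Ω g g₀)
    {χ : E n → ℝ} {C : ℝ≥0} (hχ : LipschitzWith C χ) (hχc : HasCompactSupport χ)
    (hχΩ : tsupport χ ⊆ Ω)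
    (h01 : ∀ x, χ x ∈ Set.Icc (0 : ℝ) 1) (hχ1 : ∀ x ∈ tsupport g ∪ tsupport g₀, χ x = 1)
    {ψ : E n → ℝ} (hψ : ContDiff ℝ 1 ψ) {Z : E n → E n} (hZ : ContDiff ℝ 1 Z) {z₀ : E n → ℝ}
    (hz₀ : ∀ x, 0 ≤ z₀ x) (hz : ∀ x, ‖Z x‖ ^ 2 + z₀ x ^ 2 ≤ 1)
    (hcal : ∀ x p q, ‖p‖ ^ 2 + q ^ 2 ≤ 1 →
      ψ x * q - fderiv ℝ ψ x p ≤ ψ x * z₀ x + fderiv ℝ ψ x (Z x)) :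
    (∫ x in tsupport χ, (min (v x) (ψ x) * (g₀ x + divg g x) -
      max (v x - ψ x) 0 * (χ x * divg Z x + fderiv ℝ χ x (Z x)))) ≤ c := by
  set K := tsupport χ with hKdef
  have hK : IsCompact K := hχc
  obtain ⟨r, hr, hrΩ⟩ := hK.exists_cthickening_subset_open hΩ hχΩ
  set m₁ : E n → ℝ := fun x => g₀ x + divg g x with hm₁
  set m₂ : E n → ℝ := fun x => χ x * divg Z x + fderiv ℝ χ x (Z x) with hm₂
  have hm₁c : Continuous m₁ := ht.contDiff₀.continuous.add (continuous_divg ht.contDiff)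
  have hm₂m : Measurable m₂ := (hχ.continuous.mul (continuous_divg hZ)).measurable.add
    (measurable_fderiv_apply hZ.continuous)
  obtain ⟨B₁, hB₁⟩ := hK.exists_bound_of_continuousOn hm₁c.continuousOn
  obtain ⟨B₂, hB₂⟩ := hK.exists_bound_of_continuousOn
    ((continuous_divg hZ).norm.add (hZ.continuous.norm.const_smul (C : ℝ))).continuousOn
  have hB₂' : ∀ x ∈ K, |m₂ x| ≤ B₂ := by
    intro x hx
    have h1 : |fderiv ℝ χ x (Z x)| ≤ C * ‖Z x‖ :=
      ((fderiv ℝ χ x).le_opNorm _).trans (mul_le_mul_of_nonneg_right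
        (norm_fderiv_le_of_lipschitz ℝ hχ) (norm_nonneg _))
    have h2 : |χ x * divg Z x| ≤ ‖divg Z x‖ := by
      rw [abs_mul, abs_of_nonneg (h01 x).1, Real.norm_eq_abs]
      exact mul_le_of_le_one_left (abs_nonneg _) (h01 x).2
    have h3 : ‖divg Z x‖ + C * ‖Z x‖ ≤ B₂ := (le_abs_self _).trans (hB₂ x hx)
    exact (abs_add_le _ _).trans (by linarith)
  set v' := Ω.indicator v with hv'def
  have hv' : Integrable v' := hv.integrable_indicator hΩ.measurableSet
  have hvK : ∀ x ∈ K, v' x = v x := fun x hx => Set.indicator_of_mem (hχΩ hx) v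
  have hψK : IntegrableOn ψ K := hψ.continuous.continuousOn.integrableOn_compact hK
  have bdd₁ : ∀ {u : E n → ℝ}, IntegrableOn u K → IntegrableOn (fun x => u x * m₁ x) K :=
    fun hu => hu.mul_bdd (c := B₁) hm₁c.aestronglyMeasurable
      ((ae_restrict_iff' hK.measurableSet).2 (Eventually.of_forall hB₁))
  have bdd₂ : ∀ {u : E n → ℝ}, IntegrableOn u K → IntegrableOn (fun x => u x * m₂ x) K :=
    fun hu => hu.mul_bdd (c := B₂) hm₂m.aestronglyMeasurable
      ((ae_restrict_iff' hK.measurableSet).2 (Eventually.of_forall hB₂'))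
  have hD : ∀ x ∈ K, 0 ≤ B₁ ∧ 0 ≤ B₂ := fun x hx =>
    ⟨(norm_nonneg _).trans (hB₁ x hx), (abs_nonneg _).trans (hB₂' x hx)⟩
  -- For empty `K` the claim is `0 ≤ c`, which follows by testing with the zero field. Otherwise a
  -- point of `K` shows that the bounds `B₁` and `B₂` are nonnegative.
  rcases K.eq_empty_or_nonempty with hKe | ⟨x₀, hx₀⟩
  · rw [hKe]
    simp only [Measure.restrict_empty, integral_zero_measure]
    have h0 : IsTestField Ω (fun _ => (0 : E n)) (fun _ => (0 : ℝ)) := by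
      refine ⟨contDiff_const, contDiff_const, HasCompactSupport.zero, HasCompactSupport.zero,
        ?_, ?_, by simp⟩ <;> simp [tsupport, Function.support]
    have h1 := (le_iSup₂_of_le (f := fun g g₀ => ⨆ (_ : IsTestField Ω g g₀),
      ((∫ x in Ω, v x * (g₀ x + divg g x) : ℝ) : EReal)) _ _ (le_iSup_of_le h0 le_rfl)).trans hc
    simpa [divg] using h1
  obtain ⟨hB₁0, hB₂0⟩ := hD x₀ hx₀
  -- The parameter `η` is both the smoothing parameter of the positive part and the `L¹` error of
  -- the mollification. The smooth calibration costs `η * volume.real K`, and the comparison `hpt`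
  -- costs the rest.
  refine le_of_forall_pos_le_add_mul
    (D := volume.real K + (B₁ + B₂) * (2 + volume.real K)) (by positivity) fun η hη => ?_
  obtain ⟨r', hr', hr'φ⟩ := exists_integral_abs_mollify_sub_le hv' hη
  set φ : ContDiffBump (0 : E n) := ⟨min r r' / 8, min r r' / 4, by positivity, by
    have : 0 < min r r' := by positivity
    linarith⟩ with hφ
  have hφr : φ.rOut = min r r' / 4 := rfl
  have hmin : 0 < min r r' := by positivity
  have hL1 := hr'φ φ (by rw [hφr]; linarith [min_le_right r r'])
  set V := mollify φ v' with hVdef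
  have hV : ContDiff ℝ 1 V := contDiff_mollify φ hv'.locallyIntegrable 1
  have hE : ∫ x in K, √(V x ^ 2 + ‖fderiv ℝ V x‖ ^ 2) ≤ c :=
    integral_sqrt_mollify_le hΩ.measurableSet hv hc φ hK fun x hx =>
      (Metric.closedBall_subset_closedBall (by rw [hφr]; linarith [min_le_left r r'])).trans
        ((Metric.closedBall_subset_cthickening hx r).trans hrΩ)
  have hsm := calibration_smooth hV ht hχ hχc h01 hχ1 hψ hZ hz₀ hz hcal hE hη
  have hVi : Integrable V := integrable_mollify φ hv'
  have iB : IntegrableOn (fun x => softPos η (V x - ψ x)) K :=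
    ((contDiff_softPos hη).continuous.comp
      (hV.continuous.sub hψ.continuous)).continuousOn.integrableOn_compact hK
  have iR : IntegrableOn (fun x => max (v' x - ψ x) 0) K :=
    (hv'.integrableOn.sub hψK).pos_part
  have iM : IntegrableOn (fun x => min (v' x) (ψ x)) K := by
    have : (fun x => min (v' x) (ψ x)) = fun x => v' x - max (v' x - ψ x) 0 := by
      ext x
      rcases le_total (v' x) (ψ x) with h | h
      · rw [min_eq_left h, max_eq_right (by linarith)]; ring
      · rw [min_eq_right h, max_eq_left (by linarith)]; ring
    rw [this]
    exact hv'.integrableOn.sub iR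
  have iV : IntegrableOn V K := hVi.integrableOn
  have iA : IntegrableOn (fun x => |V x - v' x|) K := (hVi.sub hv').abs.integrableOn
  have i1 : IntegrableOn (fun x => (V x - softPos η (V x - ψ x)) * m₁ x -
      softPos η (V x - ψ x) * m₂ x) K := (bdd₁ (iV.sub iB)).sub (bdd₂ iB)
  have i2 : IntegrableOn (fun x => (B₁ + B₂) * (2 * |V x - v' x| + η)) K :=
    ((iA.const_mul 2).add (integrableOn_const hK.measure_lt_top.ne)).const_mul _
  have i3 : IntegrableOn (fun x => min (v' x) (ψ x) * m₁ x - max (v' x - ψ x) 0 * m₂ x) K :=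
    (bdd₁ iM).sub (bdd₂ iR)
  have hpt : ∀ x ∈ K, min (v' x) (ψ x) * m₁ x - max (v' x - ψ x) 0 * m₂ x ≤
      ((V x - softPos η (V x - ψ x)) * m₁ x - softPos η (V x - ψ x) * m₂ x) +
        (B₁ + B₂) * (2 * |V x - v' x| + η) := by
    intro x hx
    have h1 : |softPos η (V x - ψ x) - max (v' x - ψ x) 0| ≤ |V x - v' x| + η := by
      have e1 := abs_softPos_sub_le hη (V x - ψ x)
      have e2 : |max (V x - ψ x) 0 - max (v' x - ψ x) 0| ≤ |V x - v' x| := by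
        refine (abs_max_sub_max_le_abs _ _ _).trans_eq ?_
        congr 1; ring
      calc _ ≤ _ := abs_sub_le _ (max (V x - ψ x) 0) _
        _ ≤ _ := by linarith
    have h2 : min (v' x) (ψ x) = v' x - max (v' x - ψ x) 0 := by
      rcases le_total (v' x) (ψ x) with h | h
      · rw [min_eq_left h, max_eq_right (by linarith)]; ring
      · rw [min_eq_right h, max_eq_left (by linarith)]; ring
    have h3 : |min (v' x) (ψ x) - (V x - softPos η (V x - ψ x))| ≤ 2 * |V x - v' x| + η := by
      rw [h2]
      have : v' x - max (v' x - ψ x) 0 - (V x - softPos η (V x - ψ x)) =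
        -(V x - v' x) + (softPos η (V x - ψ x) - max (v' x - ψ x) 0) := by ring
      rw [this]
      refine (abs_add_le _ _).trans ?_
      rw [abs_neg]; linarith
    have h4 : |(min (v' x) (ψ x) - (V x - softPos η (V x - ψ x))) * m₁ x| ≤
        (2 * |V x - v' x| + η) * B₁ := by
      rw [abs_mul]
      exact mul_le_mul h3 (hB₁ x hx) (abs_nonneg _) (by positivity)
    have h5 : |(softPos η (V x - ψ x) - max (v' x - ψ x) 0) * m₂ x| ≤
        (2 * |V x - v' x| + η) * B₂ := by
      rw [abs_mul]
      exact mul_le_mul (h1.trans (by linarith [abs_nonneg (V x - v' x)])) (hB₂' x hx)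
        (abs_nonneg _) (by positivity)
    have h6 := le_abs_self ((min (v' x) (ψ x) - (V x - softPos η (V x - ψ x))) * m₁ x)
    have h7 := le_abs_self ((softPos η (V x - ψ x) - max (v' x - ψ x) 0) * m₂ x)
    linarith
  have e0 : (∫ x in K, (min (v x) (ψ x) * m₁ x - max (v x - ψ x) 0 * m₂ x)) =
      ∫ x in K, (min (v' x) (ψ x) * m₁ x - max (v' x - ψ x) 0 * m₂ x) :=
    setIntegral_congr_fun hK.measurableSet fun x hx => by simp only [hvK x hx]
  rw [e0]
  refine (setIntegral_mono_on i3 (i1.add i2) hK.measurableSet hpt).trans ?_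
  simp only [Pi.add_apply]
  rw [integral_add i1 i2, integral_const_mul, integral_add (iA.const_mul 2)
    (integrableOn_const hK.measure_lt_top.ne), integral_const_mul, setIntegral_const, smul_eq_mul]
  have hL1' : ∫ x in K, |V x - v' x| ≤ η :=
    (setIntegral_le_integral (hVi.sub hv').abs
      (Eventually.of_forall fun x => abs_nonneg _)).trans hL1
  have : (B₁ + B₂) * (2 * ∫ x in K, |V x - v' x|) ≤ (B₁ + B₂) * (2 * η) := by gcongr
  linarith

end calibration

end Capillary

/-! ### Area of Lipschitz graphs -/

namespace Capillary

/-- A Lipschitz graph over the hyperplane orthogonal to a unit vector `e`, which is parametrised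
isometrically by `ι`. -/
structure GraphChart (m : ℕ) where
  /-- The parametrisation of the hyperplane. -/
  ι : E m →ₗᵢ[ℝ] E (m + 1)
  /-- The vertical direction. -/
  e : E (m + 1)
  /-- The height function. -/
  p : E m → ℝ
  /-- The Lipschitz constant. -/
  K : ℝ≥0
  norm_e : ‖e‖ = 1
  inner_e : ∀ y, inner ℝ e (ι y) = 0
  lipschitz : LipschitzWith K p

namespace GraphChart

variable {m : ℕ} (G : GraphChart m)

/-- The graph map. -/
noncomputable def graph (y : E m) : E (m + 1) := G.ι y + G.p y • G.e

/-- The coordinates in which the graph is flat. -/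
noncomputable def flat (z : E m × ℝ) : E (m + 1) := G.ι z.1 + (G.p z.1 + z.2) • G.e

/-- The area density of the graph. -/
noncomputable def jac (y : E m) : ℝ := √(1 + ‖fderiv ℝ G.p y‖ ^ 2)

/-- The linear graph map with slope `q`. -/
noncomputable def linGraph (q : E m →L[ℝ] ℝ) : E m →ₗ[ℝ] E (m + 1) :=
  G.ι.toLinearMap + (q : E m →ₗ[ℝ] ℝ).smulRight G.e

theorem linGraph_apply (q : E m →L[ℝ] ℝ) (y : E m) : G.linGraph q y = G.ι y + q y • G.e := rfl

theorem inner_add_smul (x y : E m) (s t : ℝ) :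
    inner ℝ (G.ι x + s • G.e) (G.ι y + t • G.e) = inner ℝ x y + s * t := by
  have h1 : inner ℝ G.e G.e = (1 : ℝ) := by
    rw [real_inner_self_eq_norm_sq, G.norm_e]; norm_num
  have h2 : inner ℝ (G.ι x) G.e = (0 : ℝ) := by rw [real_inner_comm, G.inner_e]
  simp only [inner_add_left, inner_add_right, inner_smul_left, inner_smul_right, h1, h2, G.inner_e,
    LinearIsometry.inner_map_map]
  simp; ring

theorem norm_add_smul_sq (y : E m) (t : ℝ) : ‖G.ι y + t • G.e‖ ^ 2 = ‖y‖ ^ 2 + t ^ 2 := by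
  rw [← real_inner_self_eq_norm_sq, G.inner_add_smul, real_inner_self_eq_norm_sq]; ring

theorem norm_le_norm_add_smul (y : E m) (t : ℝ) : ‖y‖ ≤ ‖G.ι y + t • G.e‖ := by
  have := G.norm_add_smul_sq y t
  nlinarith [norm_nonneg y, norm_nonneg (G.ι y + t • G.e), sq_nonneg t]

/-- The Gram operator of the linear graph map is the identity plus the rank-one operator `y ↦ q y •
w`, where `w` represents `q`; its determinant is `1 + ‖q‖²`. -/
theorem normDet_linGraph (q : E m →L[ℝ] ℝ) : (G.linGraph q).normDet = √(1 + ‖q‖ ^ 2) := by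
  set w : E m := (InnerProductSpace.toDual ℝ (E m)).symm q with hw
  have hq : ∀ y, q y = inner ℝ w y := fun y => by simp [hw]
  have hwn : ‖w‖ = ‖q‖ := by simp [hw]
  have h := (G.linGraph q).normDet_sq
  have e : (G.linGraph q).adjoint ∘ₗ G.linGraph q = LinearMap.transvection (q : E m →ₗ[ℝ] ℝ) w := by
    ext1 y
    refine ext_inner_left ℝ fun x => ?_
    rw [LinearMap.comp_apply, LinearMap.adjoint_inner_right, linGraph_apply, linGraph_apply,
      G.inner_add_smul]
    simp only [LinearMap.transvection.apply, ContinuousLinearMap.coe_coe, inner_add_right,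
      inner_smul_right]
    rw [hq x, real_inner_comm w x]
    ring
  rw [e, LinearMap.transvection.det] at h
  simp only [RCLike.ofReal_real_eq_id, id_eq, ContinuousLinearMap.coe_coe, hq,
    real_inner_self_eq_norm_sq, hwn] at h
  rw [← h, Real.sqrt_sq (LinearMap.normDet_nonneg _)]

/-- The linear graph map does not decrease distances, so the passage from the linear graph over `S`
to the true graph is Lipschitz with constant `1 + δ`. The area of the linear graph is known exactly.
-/
theorem graph_image_le_of_approximatesLinearOn {q : E m →L[ℝ] ℝ} {S : Set (E m)} {δ : ℝ≥0}
    (h : ApproximatesLinearOn G.p q S δ) :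
    Measure.euclideanHausdorffMeasure m (G.graph '' S) ≤
      ((1 + δ) ^ m : ℝ≥0) * (ENNReal.ofReal √(1 + ‖q‖ ^ 2) * volume S) := by
  have hM : Function.Injective (G.linGraph q) := by
    intro x y hxy
    have h1 : G.linGraph q (x - y) = 0 := by rw [map_sub, hxy, sub_self]
    have h2 := G.norm_le_norm_add_smul (x - y) (q (x - y))
    rw [← linGraph_apply, h1, norm_zero] at h2
    exact sub_eq_zero.1 (norm_le_zero_iff.1 h2)
  set f : E (m + 1) → E (m + 1) := fun z => G.graph (Function.invFun (G.linGraph q) z) with hf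
  have hfM : ∀ y, f (G.linGraph q y) = G.graph y := fun y => by
    simp only [hf, Function.leftInverse_invFun hM y]
  have hL : LipschitzOnWith (1 + δ) f (G.linGraph q '' S) := by
    refine LipschitzOnWith.of_dist_le_mul ?_
    rintro _ ⟨x, hx, rfl⟩ _ ⟨y, hy, rfl⟩
    rw [hfM, hfM, dist_eq_norm, dist_eq_norm, ← map_sub, linGraph_apply]
    have e1 : G.graph x - G.graph y = (G.ι (x - y) + q (x - y) • G.e) +
        (G.p x - G.p y - q (x - y)) • G.e := by
      simp only [graph, map_sub, sub_smul]; abel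
    rw [e1]
    refine (norm_add_le _ _).trans ?_
    rw [norm_smul, G.norm_e, mul_one]
    have h2 := h x hx y hy
    have h3 := G.norm_le_norm_add_smul (x - y) (q (x - y))
    push_cast
    nlinarith [δ.coe_nonneg]
  have himg : G.graph '' S = f '' (G.linGraph q '' S) := by
    rw [Set.image_image]
    exact Set.image_congr fun y _ => (hfM y).symm
  have h1 := hL.hausdorffMeasure_image_le (d := m) (by positivity)
  rw [← himg] at h1
  have h2 := LinearMap.hausdorffMeasure_image (G.linGraph q) S
  rw [G.normDet_linGraph, finrank_euclideanSpace_fin] at h2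
  rw [h2] at h1
  rw [← EuclideanSpace.euclideanHausdorffMeasure_eq_volume]
  simp only [Measure.euclideanHausdorffMeasure_def, Measure.smul_apply]
  refine (smul_le_smul_of_nonneg_left h1 zero_le).trans_eq ?_
  simp only [ENNReal.smul_def, smul_eq_mul, ENNReal.rpow_natCast]
  push_cast
  ring

theorem one_le_jac (y : E m) : 1 ≤ G.jac y := Real.one_le_sqrt.2 (by nlinarith [sq_nonneg ‖fderiv ℝ G.p y‖])

theorem measurable_jac : Measurable G.jac :=
  ((measurable_const.add ((measurable_fderiv ℝ G.p).norm.pow_const 2))).sqrt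

theorem sqrt_one_add_sq_le {s t d : ℝ} (hs : 0 ≤ s) (h : s ≤ t + d) (hd : 0 ≤ d) :
    √(1 + s ^ 2) ≤ √(1 + t ^ 2) + d := by
  refine Real.sqrt_le_iff.2 ⟨by positivity, ?_⟩
  have h1 : √(1 + t ^ 2) ^ 2 = 1 + t ^ 2 := Real.sq_sqrt (by positivity)
  have h2 : t ≤ √(1 + t ^ 2) := Real.le_sqrt_of_sq_le (by linarith)
  nlinarith

/-- The area of a piece of a Lipschitz graph is at most the integral of the area density. -/
theorem measure_graph_image_le {S : Set (E m)} (hS : MeasurableSet S) :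
    Measure.euclideanHausdorffMeasure m (G.graph '' S) ≤ ∫⁻ y in S, ENNReal.ofReal (G.jac y) := by
  have hLip : ∃ C : ℝ≥0, LipschitzWith C G.graph := by
    have h1 : LipschitzWith (1 + G.K * 1) G.graph := by
      refine G.ι.lipschitz.add ?_
      refine LipschitzWith.of_dist_le_mul fun x y => ?_
      rw [dist_eq_norm, ← sub_smul, norm_smul, G.norm_e, mul_one, ← dist_eq_norm]
      simpa using G.lipschitz.dist_le_mul x y
    exact ⟨_, h1⟩
  obtain ⟨C, hC⟩ := hLip
  -- Lipschitz images of null sets are null, which disposes of the points where `G.p` is not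
  -- differentiable.
  have null : ∀ N : Set (E m), volume N = 0 →
      Measure.euclideanHausdorffMeasure m (G.graph '' N) = 0 := by
    intro N hN
    have h1 := hC.hausdorffMeasure_image_le (d := m) (by positivity) N
    rw [← EuclideanSpace.euclideanHausdorffMeasure_eq_volume] at hN
    simp only [Measure.euclideanHausdorffMeasure_def, Measure.smul_apply, ENNReal.smul_def,
      smul_eq_mul, mul_eq_zero, ENNReal.coe_eq_zero,
      Measure.addHaarScalarFactor_volume_hausdorffMeasure_ne_zero, false_or] at hN ⊢
    rw [hN, mul_zero] at h1
    exact le_antisymm h1 zero_le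
  have main : ∀ δ : ℝ≥0, 0 < δ → Measure.euclideanHausdorffMeasure m (G.graph '' S) ≤
      (((1 + δ) ^ m * (1 + 2 * δ) : ℝ≥0) : ℝ≥0∞) * ∫⁻ y in S, ENNReal.ofReal (G.jac y) := by
    intro δ hδ
    set D := {y : E m | DifferentiableAt ℝ G.p y} with hDdef
    have hD : MeasurableSet D := measurableSet_of_differentiableAt ℝ G.p
    have hDc : volume Dᶜ = 0 := G.lipschitz.ae_differentiableAt (μ := volume)
    -- The base is first cut into countably many sets on which the slope varies by less than `2 *
    -- δ`. The approximating maps `A j` are slopes at points of the same set, so their area factor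
    -- is comparable with `G.jac y` throughout.
    set q : ℕ → (E m →L[ℝ] ℝ) := TopologicalSpace.denseSeq _ with hq
    set u : ℕ → Set (E m) := fun k => {y | ‖fderiv ℝ G.p y - q k‖ < δ} with hu
    have hum : ∀ k, MeasurableSet (u k) := fun k =>
      measurableSet_lt ((measurable_fderiv ℝ G.p).sub_const _).norm measurable_const
    have hucov : ⋃ k, u k = Set.univ := by
      refine Set.eq_univ_of_forall fun y => ?_
      obtain ⟨k, hk⟩ := (TopologicalSpace.denseRange_denseSeq
        (E m →L[ℝ] ℝ)).exists_dist_lt (fderiv ℝ G.p y) (ε := δ) (by exact_mod_cast hδ)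
      exact Set.mem_iUnion.2 ⟨k, by rw [dist_eq_norm] at hk; exact hk⟩
    set s : ℕ → Set (E m) := fun k => S ∩ D ∩ disjointed u k with hs
    have hsm : ∀ k, MeasurableSet (s k) := fun k =>
      (hS.inter hD).inter (MeasurableSet.disjointed hum k)
    have hsdisj : Pairwise (Function.onFun Disjoint s) := fun i j hij =>
      (disjoint_disjointed u hij).mono Set.inter_subset_right Set.inter_subset_right
    have hscov : S ∩ D = ⋃ k, s k := by
      rw [← Set.inter_iUnion, iUnion_disjointed, hucov, Set.inter_univ]
    have piece : ∀ k, Measure.euclideanHausdorffMeasure m (G.graph '' s k) ≤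
        (((1 + δ) ^ m * (1 + 2 * δ) : ℝ≥0) : ℝ≥0∞) * ∫⁻ y in s k, ENNReal.ofReal (G.jac y) := by
      intro k
      obtain ⟨t, A, htd, htm, htc, hta, htA⟩ :=
        exists_partition_approximatesLinearOn_of_hasFDerivWithinAt G.p (s k) (fderiv ℝ G.p)
          (fun y hy => hy.1.2.hasFDerivAt.hasFDerivWithinAt) (fun _ => δ) (fun _ => hδ.ne')
      have hcov : s k = ⋃ j, s k ∩ t j := by
        rw [← Set.inter_iUnion, Set.inter_eq_left.2 htc]
      rw [hcov, Set.image_iUnion, lintegral_iUnion (fun j => (hsm k).inter (htm j))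
        (fun i j hij => (htd hij).mono Set.inter_subset_right Set.inter_subset_right),
        ← ENNReal.tsum_mul_left]
      refine (measure_iUnion_le _).trans (ENNReal.tsum_le_tsum fun j => ?_)
      refine (G.graph_image_le_of_approximatesLinearOn (hta j)).trans ?_
      rw [ENNReal.coe_mul, mul_assoc]
      refine mul_le_mul_right ?_ _
      rw [← setLIntegral_const, ← lintegral_const_mul' _ _ ENNReal.coe_ne_top]
      refine setLIntegral_mono_ae' ((hsm k).inter (htm j)) (Eventually.of_forall fun y hy => ?_)
      obtain ⟨y', hy', hAy⟩ := htA ⟨y, hy.1⟩ j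
      have h1 : ‖fderiv ℝ G.p y - q k‖ < δ := disjointed_subset u k hy.1.2
      have h2 : ‖fderiv ℝ G.p y' - q k‖ < δ := disjointed_subset u k hy'.2
      have h3 : ‖A j‖ ≤ ‖fderiv ℝ G.p y‖ + 2 * δ := by
        rw [hAy]
        have e : fderiv ℝ G.p y' = fderiv ℝ G.p y + ((fderiv ℝ G.p y' - q k) -
          (fderiv ℝ G.p y - q k)) := by abel
        rw [e]
        refine (norm_add_le _ _).trans ?_
        have := norm_sub_le (fderiv ℝ G.p y' - q k) (fderiv ℝ G.p y - q k)
        linarith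
      have h4 := sqrt_one_add_sq_le (norm_nonneg (A j)) h3
        (by positivity)
      have h5 : √(1 + ‖A j‖ ^ 2) ≤ (1 + 2 * δ) * G.jac y := by
        have := G.one_le_jac y
        have hj : √(1 + ‖fderiv ℝ G.p y‖ ^ 2) = G.jac y := rfl
        rw [hj] at h4
        nlinarith [δ.coe_nonneg]
      refine (ENNReal.ofReal_le_ofReal h5).trans_eq ?_
      rw [ENNReal.ofReal_mul (by positivity)]
      congr 1
      rw [← ENNReal.ofReal_coe_nnreal]; norm_num
    calc Measure.euclideanHausdorffMeasure m (G.graph '' S)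
        ≤ Measure.euclideanHausdorffMeasure m (G.graph '' (S ∩ D)) +
          Measure.euclideanHausdorffMeasure m (G.graph '' Dᶜ) := by
          refine (measure_mono ?_).trans (measure_union_le _ _)
          rw [← Set.image_union]
          refine Set.image_mono fun y hy => ?_
          by_cases h : y ∈ D
          · exact Or.inl ⟨hy, h⟩
          · exact Or.inr h
      _ = Measure.euclideanHausdorffMeasure m (⋃ k, G.graph '' s k) := by
          rw [null _ hDc, add_zero, hscov, Set.image_iUnion]
      _ ≤ ∑' k, (((1 + δ) ^ m * (1 + 2 * δ) : ℝ≥0) : ℝ≥0∞) *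
          ∫⁻ y in s k, ENNReal.ofReal (G.jac y) :=
          (measure_iUnion_le _).trans (ENNReal.tsum_le_tsum piece)
      _ = (((1 + δ) ^ m * (1 + 2 * δ) : ℝ≥0) : ℝ≥0∞) *
          ∫⁻ y in S ∩ D, ENNReal.ofReal (G.jac y) := by
          rw [ENNReal.tsum_mul_left, hscov, lintegral_iUnion hsm hsdisj]
      _ ≤ _ := by gcongr; exact Set.inter_subset_left
  have hlim : Tendsto (fun δ : ℝ≥0 => (((1 + δ) ^ m * (1 + 2 * δ) : ℝ≥0) : ℝ≥0∞) *
      ∫⁻ y in S, ENNReal.ofReal (G.jac y)) (𝓝[>] 0)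
      (𝓝 (((1 : ℝ≥0) : ℝ≥0∞) * ∫⁻ y in S, ENNReal.ofReal (G.jac y))) := by
    refine ENNReal.Tendsto.mul_const ?_ (Or.inl (by simp))
    refine ENNReal.tendsto_coe.2 ?_
    have : Continuous fun δ : ℝ≥0 => (1 + δ) ^ m * (1 + 2 * δ) := by fun_prop
    have h := this.tendsto 0
    simp only [add_zero, one_pow, mul_zero, mul_one] at h
    exact h.mono_left nhdsWithin_le_nhds
  rw [ENNReal.coe_one, one_mul] at hlim
  exact ge_of_tendsto hlim (eventually_mem_nhdsWithin.mono fun δ hδ => main δ hδ)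

end GraphChart

end Capillary

/-! ### Flattening coordinates and charts of the boundary -/

namespace Capillary

namespace GraphChart

variable {m : ℕ} (G : GraphChart m)

/-- The isometry between the product decomposition and the ambient space. -/
noncomputable def iso : WithLp 2 (E m × ℝ) ≃ₗᵢ[ℝ] E (m + 1) :=
  LinearIsometry.toLinearIsometryEquiv
    { toFun := fun z => G.ι z.fst + z.snd • G.e
      map_add' := fun z w => by simp only [WithLp.add_fst, WithLp.add_snd, map_add, add_smul]; abel
      map_smul' := fun c z => by simp [smul_smul]
      norm_map' := fun z => by
        have h1 := G.norm_add_smul_sq z.fst z.snd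
        have h2 := WithLp.prod_norm_sq_eq_of_L2 z
        rw [Real.norm_eq_abs, sq_abs] at h2
        rw [← sq_eq_sq₀ (norm_nonneg _) (norm_nonneg _), h2]
        exact h1 }
    (by
      rw [(WithLp.linearEquiv 2 ℝ (E m × ℝ)).finrank_eq]
      simp)

/-- The flattening coordinates as a homeomorphism. -/
noncomputable def flatHomeo : E m × ℝ ≃ₜ E (m + 1) :=
  ({ toFun := fun z => (z.1, G.p z.1 + z.2)
     invFun := fun z => (z.1, z.2 - G.p z.1)
     left_inv := fun z => by simp
     right_inv := fun z => by simp
     continuous_toFun := by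
       have := G.lipschitz.continuous
       fun_prop
     continuous_invFun := by
       have := G.lipschitz.continuous
       fun_prop } : E m × ℝ ≃ₜ E m × ℝ).trans
  ((WithLp.homeomorphProd 2 (E m) ℝ).symm.trans G.iso.toHomeomorph)

theorem flatHomeo_apply (z : E m × ℝ) : G.flatHomeo z = G.flat z := rfl

theorem continuous_flat : Continuous G.flat := G.flatHomeo.continuous

/-- The flattening is a vertical shear, which preserves volume by Fubini, followed by a linear
isometry. -/
theorem measurePreserving_flat :
    MeasurePreserving G.flat ((volume : Measure (E m)).prod (volume : Measure ℝ)) volume := by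
  have h1 : MeasurePreserving (fun z : E m × ℝ => (z.1, G.p z.1 + z.2))
      ((volume : Measure (E m)).prod (volume : Measure ℝ)) (volume.prod volume) := by
    refine (MeasurePreserving.id volume).skew_product
      (g := fun y t => G.p y + t) ?_ (Eventually.of_forall fun y => map_add_left_eq_self _ _)
    have := G.lipschitz.continuous.measurable
    exact (this.comp measurable_fst).add measurable_snd
  exact G.iso.measurePreserving.comp ((WithLp.volume_preserving_toLp (E m) ℝ).comp h1)

theorem measurableEmbedding_flat : MeasurableEmbedding G.flat :=
  G.flatHomeo.measurableEmbedding

theorem flat_zero (y : E m) : G.flat (y, 0) = G.graph y := by simp [flat, graph]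

theorem flat_eq_graph_add (y : E m) (s : ℝ) : G.flat (y, s) = G.graph y + s • G.e := by
  simp only [flat, graph, add_smul, add_assoc]

theorem continuous_graph : Continuous G.graph := by
  have : G.graph = fun y => G.flat (y, 0) := by ext1 y; rw [flat_zero]
  rw [this]
  exact G.continuous_flat.comp (by fun_prop)

theorem dist_flat_graph (y : E m) (s : ℝ) : dist (G.flat (y, s)) (G.graph y) = |s| := by
  rw [flat_eq_graph_add, dist_eq_norm]
  simp [norm_smul, G.norm_e]

theorem dist_flat_sq (y y₀ : E m) (s : ℝ) : dist (G.flat (y, s)) (G.graph y₀) ^ 2 =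
    dist y y₀ ^ 2 + (G.p y - G.p y₀ + s) ^ 2 := by
  have : G.flat (y, s) - G.graph y₀ = G.ι (y - y₀) + (G.p y - G.p y₀ + s) • G.e := by
    simp only [flat, graph, map_sub, add_smul, sub_smul]; abel
  rw [dist_eq_norm, this, G.norm_add_smul_sq, dist_eq_norm]

/-- In the ball of radius `r` around `x₀`, the set `Ω` is the region above the graph. -/
def IsChartOf (Ω : Set (E (m + 1))) (x₀ : E (m + 1)) (r : ℝ) : Prop :=
  ∀ z, G.flat z ∈ Metric.ball x₀ r → (G.flat z ∈ Ω ↔ 0 < z.2)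

/-- The base of the cylinder over which the trace is taken. -/
def base (x₀ : E (m + 1)) (r : ℝ) : Set (E m) := {y | G.graph y ∈ Metric.ball x₀ (3 * r / 4)}

theorem isOpen_base (x₀ : E (m + 1)) (r : ℝ) : IsOpen (G.base x₀ r) :=
  Metric.isOpen_ball.preimage G.continuous_graph

theorem isBounded_base (x₀ : E (m + 1)) (r : ℝ) : Bornology.IsBounded (G.base x₀ r) := by
  refine Metric.isBounded_iff.2 ⟨2 * (3 * r / 4), fun y hy y' hy' => ?_⟩
  have h1 : dist y y' ≤ dist (G.graph y) (G.graph y') := by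
    have := G.dist_flat_sq y y' 0
    rw [flat_zero] at this
    exact abs_le_of_sq_le_sq' (by nlinarith [sq_nonneg (G.p y - G.p y' + 0)]) dist_nonneg |>.2
  have h2 := dist_triangle_right (G.graph y) (G.graph y') x₀
  have h3 : dist (G.graph y) x₀ < 3 * r / 4 := hy
  have h4 : dist (G.graph y') x₀ < 3 * r / 4 := hy'
  linarith

/-- The radius `3 * r / 4` of the base and the height `r / 4` add up to `r`, so the whole cylinder
stays in the ball where the chart is valid. -/
theorem flat_mem_ball {x₀ : E (m + 1)} {r : ℝ} {y : E m} (hy : y ∈ G.base x₀ r) {s : ℝ}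
    (hs : |s| < r / 4) : G.flat (y, s) ∈ Metric.ball x₀ r := by
  have h1 : dist (G.graph y) x₀ < 3 * r / 4 := hy
  have h2 := G.dist_flat_graph y s
  have h3 := dist_triangle (G.flat (y, s)) (G.graph y) x₀
  rw [Metric.mem_ball]; linarith

variable {G}

theorem IsChartOf.flat_mem {Ω : Set (E (m + 1))} {x₀ : E (m + 1)} {r : ℝ}
    (h : G.IsChartOf Ω x₀ r) {y : E m} (hy : y ∈ G.base x₀ r) {s : ℝ} (hs : s ∈ Set.Ioo 0 (r / 4)) :
    G.flat (y, s) ∈ Ω :=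
  (h _ (G.flat_mem_ball hy (by rw [abs_of_pos hs.1]; exact hs.2))).2 hs.1

theorem IsChartOf.graph_notMem {Ω : Set (E (m + 1))} {x₀ : E (m + 1)} {r : ℝ}
    (h : G.IsChartOf Ω x₀ r) {y : E m} (hy : G.graph y ∈ Metric.ball x₀ r) :
    G.graph y ∉ Ω := by
  rw [← flat_zero] at hy ⊢
  rw [h _ hy]
  simp

theorem IsChartOf.graph_mem_frontier {Ω : Set (E (m + 1))} {x₀ : E (m + 1)} {r : ℝ}
    (h : G.IsChartOf Ω x₀ r) {y : E m} (hy : G.graph y ∈ Metric.ball x₀ r) :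
    G.graph y ∈ frontier Ω := by
  refine ⟨?_, fun hi => h.graph_notMem hy (interior_subset hi)⟩
  refine mem_closure_of_tendsto (f := fun s : ℝ => G.flat (y, s)) (b := 𝓝[>] 0) ?_ ?_
  · have : Continuous fun s : ℝ => G.flat (y, s) := G.continuous_flat.comp (by fun_prop)
    have h2 := this.tendsto 0
    rw [flat_zero] at h2
    exact h2.mono_left nhdsWithin_le_nhds
  · have hc : Continuous fun s : ℝ => G.flat (y, s) := G.continuous_flat.comp (by fun_prop)
    have : ∀ᶠ s in 𝓝[>] (0 : ℝ), G.flat (y, s) ∈ Metric.ball x₀ r := by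
      refine nhdsWithin_le_nhds (hc.continuousAt.eventually_mem ?_)
      rw [flat_zero]
      exact Metric.isOpen_ball.mem_nhds hy
    filter_upwards [this, self_mem_nhdsWithin] with s hs hs0
    exact (h _ hs).2 hs0

/-- Boundary points in the chart lie on the graph. -/
theorem IsChartOf.exists_graph_eq {Ω : Set (E (m + 1))} (hΩ : IsOpen Ω) {x₀ : E (m + 1)} {r : ℝ}
    (h : G.IsChartOf Ω x₀ r) {x : E (m + 1)} (hx : x ∈ frontier Ω) (hxb : x ∈ Metric.ball x₀ r) :
    ∃ y, G.graph y = x := by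
  obtain ⟨z, rfl⟩ := G.flatHomeo.surjective x
  rw [flatHomeo_apply] at *
  have h1 : G.flat z ∉ Ω := by rw [hΩ.frontier_eq] at hx; exact hx.2
  have h2 : z.2 ≤ 0 := by rw [h _ hxb] at h1; exact not_lt.1 h1
  rcases h2.lt_or_eq with h3 | h3
  · exfalso
    have hO : IsOpen (Metric.ball x₀ r ∩ G.flatHomeo '' {z | z.2 < 0}) :=
      Metric.isOpen_ball.inter (G.flatHomeo.isOpenMap _ (isOpen_lt (by fun_prop) (by fun_prop)))
    obtain ⟨w, ⟨hw1, w', hw', rfl⟩, hw2⟩ := mem_closure_iff.1 hx.1 _ hO ⟨hxb, z, h3, rfl⟩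
    rw [flatHomeo_apply] at hw1 hw2
    have := (h _ hw1).1 hw2
    have hw'' : w'.2 < 0 := hw'
    linarith
  · exact ⟨z.1, by rw [← flat_zero, ← h3]⟩

end GraphChart

end Capillary

/-! ### Variation along vertical lines and the trace in a chart -/

namespace Capillary

/-- A sequence of bump functions with radii tending to zero. -/
noncomputable def bumpSeq (n j : ℕ) : ContDiffBump (0 : E n) :=
  ⟨1 / (2 * (j + 1)), 1 / (j + 1), by positivity, by
    rw [one_div, one_div, mul_inv]
    have : (0 : ℝ) < ((j : ℝ) + 1)⁻¹ := by positivity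
    linarith⟩

theorem bumpSeq_rOut (n j : ℕ) : (bumpSeq n j).rOut = 1 / ((j : ℝ) + 1) := rfl

theorem tendsto_bumpSeq_rOut (n : ℕ) : Tendsto (fun j => (bumpSeq n j).rOut) atTop (𝓝 0) :=
  tendsto_one_div_add_atTop_nhds_zero_nat

/-- Convergence at almost every point needs the inner and outer radii of the bumps to be comparable;
in `bumpSeq` their ratio is always `2`. -/
theorem ae_tendsto_mollify {n : ℕ} {f : E n → ℝ} (hf : LocallyIntegrable f) :
    ∀ᵐ x, Tendsto (fun j => mollify (bumpSeq n j) f x) atTop (𝓝 (f x)) := by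
  refine ContDiffBump.ae_convolution_tendsto_right_of_locallyIntegrable (K := 2)
    (tendsto_bumpSeq_rOut n) (Eventually.of_forall fun j => ?_) hf
  have h : (bumpSeq n j).rIn = 1 / (2 * ((j : ℝ) + 1)) := rfl
  rw [h, bumpSeq_rOut, one_div, one_div, mul_inv]
  apply le_of_eq; ring

/-- The compact exhaustion of `Ω` used with `bumpSeq`. -/
def exhaustion (n : ℕ) (Ω : Set (E n)) (j : ℕ) : Set (E n) :=
  {x | 3 * (bumpSeq n j).rOut ≤ Metric.infDist x Ωᶜ}

/-- The factor `3` in the exhaustion leaves room for the closed ball of radius `2 * rOut` required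
by `integral_sqrt_mollify_le`. -/
theorem closedBall_subset_of_mem_exhaustion {n : ℕ} {Ω : Set (E n)} {j : ℕ} {x : E n}
    (hx : x ∈ exhaustion n Ω j) : Metric.closedBall x (2 * (bumpSeq n j).rOut) ⊆ Ω := by
  intro y hy
  by_contra hyΩ
  have h1 : Metric.infDist x Ωᶜ ≤ dist x y := Metric.infDist_le_dist_of_mem hyΩ
  have h2 : dist x y ≤ 2 * (bumpSeq n j).rOut := by rw [dist_comm]; exact hy
  have h3 : 3 * (bumpSeq n j).rOut ≤ Metric.infDist x Ωᶜ := hx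
  linarith [(bumpSeq n j).rOut_pos]

theorem exhaustion_subset {n : ℕ} (Ω : Set (E n)) (j : ℕ) : exhaustion n Ω j ⊆ Ω := fun x hx =>
  closedBall_subset_of_mem_exhaustion hx
    (Metric.mem_closedBall_self (by linarith [(bumpSeq n j).rOut_pos]))

theorem isCompact_exhaustion {n : ℕ} {Ω : Set (E n)} (hb : Bornology.IsBounded Ω) (j : ℕ) :
    IsCompact (exhaustion n Ω j) :=
  Metric.isCompact_of_isClosed_isBounded
    (isClosed_le continuous_const (Metric.continuous_infDist_pt _)) (hb.subset (exhaustion_subset Ω j))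

theorem eventually_subset_exhaustion {n : ℕ} {Ω : Set (E n)} (hΩ : IsOpen Ω) (hne : Ωᶜ.Nonempty)
    {L : Set (E n)} (hL : IsCompact L) (hLΩ : L ⊆ Ω) : ∀ᶠ j in atTop, L ⊆ exhaustion n Ω j := by
  rcases L.eq_empty_or_nonempty with rfl | hLn
  · simp
  obtain ⟨x, hx, hmin⟩ := hL.exists_isMinOn hLn (Metric.continuous_infDist_pt Ωᶜ).continuousOn
  have hpos : 0 < Metric.infDist x Ωᶜ :=
    (hΩ.isClosed_compl.notMem_iff_infDist_pos hne).1 (by simpa using hLΩ hx)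
  have h1 : Tendsto (fun j => 3 * (bumpSeq n j).rOut) atTop (𝓝 0) := by
    simpa using (tendsto_bumpSeq_rOut n).const_mul 3
  filter_upwards [h1.eventually_lt_const hpos] with j hj y hy
  exact hj.le.trans (hmin hy)

theorem sum_lintegral_Icc_le {f : ℝ → ℝ≥0∞} {u : ℕ → ℝ} (hu : Monotone u) (N : ℕ) :
    ∑ i ∈ Finset.range N, ∫⁻ s in Set.Icc (u i) (u (i + 1)), f s ≤
      ∫⁻ s in Set.Icc (u 0) (u N), f s := by
  have : ∀ N, ∑ i ∈ Finset.range N, ∫⁻ s in Set.Ioc (u i) (u (i + 1)), f s ≤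
      ∫⁻ s in Set.Ioc (u 0) (u N), f s := by
    intro N
    induction N with
    | zero => simp
    | succ k ih =>
      rw [Finset.sum_range_succ, ← Set.Ioc_union_Ioc_eq_Ioc (hu (Nat.zero_le k)) (hu k.le_succ),
        lintegral_union measurableSet_Ioc (Set.Ioc_disjoint_Ioc_of_le le_rfl)]
      gcongr
  simpa only [restrict_Ioc_eq_restrict_Icc] using this N

namespace GraphChart

variable {m : ℕ} {G : GraphChart m} {Ω : Set (E (m + 1))} {x₀ : E (m + 1)} {r : ℝ}

theorem enorm_sub_le_lintegral_fderiv {V : E (m + 1) → ℝ} (hV : ContDiff ℝ 1 V) (y : E m)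
    {a b : ℝ} (hab : a ≤ b) :
    edist (V (G.flat (y, b))) (V (G.flat (y, a))) ≤
      ∫⁻ s in Set.Icc a b, ‖fderiv ℝ V (G.flat (y, s))‖ₑ := by
  have hline : ∀ s, HasDerivAt (fun s => G.flat (y, s)) G.e s := by
    intro s
    simp only [flat_eq_graph_add]
    simpa using ((hasDerivAt_id s).smul_const G.e).const_add (G.graph y)
  have hlc : ContDiff ℝ 1 fun s => G.flat (y, s) := by
    simp only [flat_eq_graph_add]
    exact contDiff_const.add (contDiff_id.smul contDiff_const)
  have h1 := enorm_sub_le_lintegral_deriv_of_contDiffOn_Icc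
    (f := fun s => V (G.flat (y, s))) (hV.comp hlc).contDiffOn hab
  rw [edist_eq_enorm_sub]
  refine h1.trans (lintegral_mono fun s => ?_)
  have h2 : HasDerivAt (fun s => V (G.flat (y, s))) (fderiv ℝ V (G.flat (y, s)) G.e) s :=
    (hV.differentiable one_ne_zero _).hasFDerivAt.comp_hasDerivAt s (hline s)
  rw [h2.deriv]
  refine enorm_le_iff_norm_le.2 (((fderiv ℝ V (G.flat (y, s))).le_opNorm _).trans_eq ?_)
  rw [G.norm_e, mul_one]

/-- The variation along vertical lines of a function of bounded variation is integrable. -/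
theorem exists_variation_bound (hΩ : IsOpen Ω) (hb : Bornology.IsBounded Ω)
    (hne : Ωᶜ.Nonempty) {v : E (m + 1) → ℝ} (hv : IntegrableOn v Ω) {c : ℝ}
    (hc : surfaceEnergy Ω v ≤ c) (hG : G.IsChartOf Ω x₀ r) :
    ∃ α : E m → ℝ≥0∞, Measurable α ∧ ∫⁻ y in G.base x₀ r, α y < ⊤ ∧
      ∀ᵐ y ∂(volume.restrict (G.base x₀ r)), ∃ S : Set ℝ, S ⊆ Set.Ioo 0 (r / 4) ∧
        (∀ᵐ s ∂(volume.restrict (Set.Ioo 0 (r / 4))), s ∈ S) ∧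
        eVariationOn (fun s => v (G.flat (y, s))) S ≤ α y := by
  set v' := Ω.indicator v
  have hv' : Integrable v' := hv.integrable_indicator hΩ.measurableSet
  set V : ℕ → E (m + 1) → ℝ := fun j => mollify (bumpSeq (m + 1) j) v' with hV
  have hVc : ∀ j, ContDiff ℝ 1 (V j) := fun j => contDiff_mollify _ hv'.locallyIntegrable 1
  set D : ℕ → E (m + 1) → ℝ≥0∞ := fun j =>
    (exhaustion (m + 1) Ω j).indicator fun x => ‖fderiv ℝ (V j) x‖ₑ with hD
  have hDm : ∀ j, Measurable (D j) := fun j =>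
    (((hVc j).continuous_fderiv one_ne_zero).enorm.measurable).indicator
      (isCompact_exhaustion hb j).measurableSet
  have hDint : ∀ j, ∫⁻ x, D j x ≤ ENNReal.ofReal c := by
    intro j
    have h1 := integral_sqrt_mollify_le hΩ.measurableSet hv hc (bumpSeq (m + 1) j)
      (isCompact_exhaustion hb j) fun x hx => closedBall_subset_of_mem_exhaustion hx
    rw [hD, lintegral_indicator (isCompact_exhaustion hb j).measurableSet]
    refine le_trans ?_ (ENNReal.ofReal_le_ofReal h1)
    rw [ofReal_integral_eq_lintegral_ofReal]
    · refine lintegral_mono fun x => ?_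
      rw [← ofReal_norm]
      refine ENNReal.ofReal_le_ofReal (Real.le_sqrt_of_sq_le ?_)
      exact le_add_of_nonneg_left (sq_nonneg _)
    · exact ((((hVc j).continuous.pow 2).add
        (((hVc j).continuous_fderiv one_ne_zero).norm.pow 2)).sqrt).continuousOn.integrableOn_compact
          (isCompact_exhaustion hb j)
    · exact Eventually.of_forall fun x => Real.sqrt_nonneg _
  set αj : ℕ → E m → ℝ≥0∞ := fun j y => ∫⁻ s in Set.Ioo 0 (r / 4), D j (G.flat (y, s)) with hαj
  have hDf : ∀ j, Measurable fun z : E m × ℝ => D j (G.flat z) := fun j =>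
    (hDm j).comp G.continuous_flat.measurable
  have hαm : ∀ j, Measurable (αj j) := fun j => (hDf j).lintegral_prod_right'
  have hαint : ∀ j, ∫⁻ y in G.base x₀ r, αj j y ≤ ENNReal.ofReal c := by
    intro j
    refine le_trans ?_ (hDint j)
    rw [← G.measurePreserving_flat.lintegral_comp (hDm j),
      lintegral_prod _ (hDf j).aemeasurable]
    refine (setLIntegral_le_lintegral _ _).trans (lintegral_mono fun y => ?_)
    exact setLIntegral_le_lintegral _ _
  -- The total variations of the mollifications have uniformly bounded integrals, so by Fatou their
  -- lower limit is integrable over the base.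
  refine ⟨fun y => liminf (fun j => αj j y) atTop, Measurable.liminf hαm, ?_, ?_⟩
  · refine (lintegral_liminf_le hαm).trans_lt (lt_of_le_of_lt (b := ENNReal.ofReal c) ?_ ENNReal.ofReal_lt_top)
    exact (liminf_le_liminf (Eventually.of_forall hαint)).trans_eq (liminf_const _)
  · have hae : ∀ᵐ z ∂((volume : Measure (E m)).prod (volume : Measure ℝ)),
        Tendsto (fun j => V j (G.flat z)) atTop (𝓝 (v' (G.flat z))) :=
      G.measurePreserving_flat.quasiMeasurePreserving.ae (ae_tendsto_mollify hv'.locallyIntegrable)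
    have hae' := Measure.ae_ae_of_ae_prod hae
    filter_upwards [ae_restrict_of_ae hae', ae_restrict_mem (G.isOpen_base x₀ r).measurableSet]
      with y hy hyb
    -- The set `S` consists of the heights at which the mollifications converge to `v`; by Fubini it
    -- has full measure for almost every `y`. Variation sums with nodes in `S` are limits of those
    -- of the mollifications, and for large `j` the segment between the extreme nodes lies in the
    -- exhaustion.
    refine ⟨Set.Ioo 0 (r / 4) ∩
      {s | Tendsto (fun j => V j (G.flat (y, s))) atTop (𝓝 (v' (G.flat (y, s))))},
      Set.inter_subset_left, ?_, ?_⟩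
    · filter_upwards [ae_restrict_of_ae hy, ae_restrict_mem measurableSet_Ioo] with s h1 h2
      exact ⟨h2, h1⟩
    · refine iSup_le fun ⟨N, u, hu, huS⟩ => ?_
      simp only
      have hvv : ∀ i, v (G.flat (y, u i)) = v' (G.flat (y, u i)) := fun i =>
        (Set.indicator_of_mem (hG.flat_mem hyb (huS i).1) v).symm
      simp only [hvv]
      have hlim : Tendsto (fun j => ∑ i ∈ Finset.range N,
          edist (V j (G.flat (y, u (i + 1)))) (V j (G.flat (y, u i)))) atTop
          (𝓝 (∑ i ∈ Finset.range N,
            edist (v' (G.flat (y, u (i + 1)))) (v' (G.flat (y, u i))))) :=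
        tendsto_finsetSum _ fun i _ => (huS (i + 1)).2.edist (huS i).2
      rw [← hlim.liminf_eq]
      refine liminf_le_liminf ?_
      have hLc : IsCompact ((fun s => G.flat (y, s)) '' Set.Icc (u 0) (u N)) :=
        isCompact_Icc.image (G.continuous_flat.comp (by fun_prop))
      have hLΩ : (fun s => G.flat (y, s)) '' Set.Icc (u 0) (u N) ⊆ Ω := by
        rintro _ ⟨s, hs, rfl⟩
        exact hG.flat_mem hyb ⟨(huS 0).1.1.trans_le hs.1, hs.2.trans_lt (huS N).1.2⟩
      filter_upwards [eventually_subset_exhaustion hΩ hne hLc hLΩ] with j hj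
      calc ∑ i ∈ Finset.range N, edist (V j (G.flat (y, u (i + 1)))) (V j (G.flat (y, u i)))
          ≤ ∑ i ∈ Finset.range N, ∫⁻ s in Set.Icc (u i) (u (i + 1)),
              ‖fderiv ℝ (V j) (G.flat (y, s))‖ₑ :=
            Finset.sum_le_sum fun i _ => enorm_sub_le_lintegral_fderiv (hVc j) y (hu i.le_succ)
        _ ≤ ∫⁻ s in Set.Icc (u 0) (u N), ‖fderiv ℝ (V j) (G.flat (y, s))‖ₑ :=
            sum_lintegral_Icc_le hu N
        _ = ∫⁻ s in Set.Icc (u 0) (u N), D j (G.flat (y, s)) :=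
            setLIntegral_congr_fun measurableSet_Icc fun s hs => by
              simp only [hD]
              rw [Set.indicator_of_mem (hj ⟨s, hs, rfl⟩)]
        _ ≤ αj j y := lintegral_mono_set fun s hs =>
            ⟨(huS 0).1.1.trans_le hs.1, hs.2.trans_lt (huS N).1.2⟩

/-- The trace in a chart: `T` is the essential limit along vertical lines, with an integrable
bound for the difference. -/
structure HasChartTrace (G : GraphChart m) (A : Set (E m)) (h₀ : ℝ) (v : E (m + 1) → ℝ)
    (T α : E m → ℝ) : Prop where
  integrable : IntegrableOn T A
  integrable_bound : IntegrableOn α A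
  bound : ∀ᵐ y ∂(volume.restrict A), ∀ᵐ s ∂(volume.restrict (Set.Ioo 0 h₀)),
    |v (G.flat (y, s)) - T y| ≤ α y
  tendsto : ∀ᵐ y ∂(volume.restrict A), ∀ ε > 0, ∃ δ > 0, ∀ᵐ s ∂(volume.restrict (Set.Ioo 0 δ)),
    |v (G.flat (y, s)) - T y| ≤ ε

/-- A function of bounded variation on `S` has a right limit at `0` along `S`, and differs from it
by at most its variation. As `S` has full measure, `0` is an accumulation point of it. -/
theorem exists_limit_of_variation {F : ℝ → ℝ} {S : Set ℝ} {h₀ : ℝ} (hh : 0 < h₀)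
    (hS : ∀ᵐ s ∂(volume.restrict (Set.Ioo 0 h₀)), s ∈ S)
    {α : ℝ≥0∞} (hα : α ≠ ⊤) (hF : eVariationOn F S ≤ α) :
    ∃ T : ℝ, (∀ᵐ s ∂(volume.restrict (Set.Ioo 0 h₀)), |F s - T| ≤ α.toReal) ∧
      ∀ ε > 0, ∃ δ > 0, ∀ᵐ s ∂(volume.restrict (Set.Ioo 0 δ)), |F s - T| ≤ ε := by
  have hbv : BoundedVariationOn F S := ne_top_of_le_ne_top hα hF
  obtain ⟨T, hT⟩ := hbv.exists_tendsto_right 0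
  have hS' : ∀ δ, δ ≤ h₀ → ∀ᵐ s ∂(volume.restrict (Set.Ioo 0 δ)), s ∈ S := fun δ hδ =>
    ae_restrict_of_ae_restrict_of_subset (Set.Ioo_subset_Ioo_right hδ) hS
  have hne : (𝓝[S ∩ Set.Ioi 0] (0 : ℝ)).NeBot := by
    rw [← mem_closure_iff_nhdsWithin_neBot, Metric.mem_closure_iff]
    intro ε hε
    have h1 := hS' (min ε h₀) (min_le_right _ _)
    have h2 : (volume.restrict (Set.Ioo (0 : ℝ) (min ε h₀))) ≠ 0 := by
      rw [Ne, Measure.restrict_eq_zero, Real.volume_Ioo]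
      simp [hε, hh]
    have : (ae (volume.restrict (Set.Ioo (0 : ℝ) (min ε h₀)))).NeBot := ae_neBot.2 h2
    obtain ⟨s, hs, hs'⟩ := (h1.and (ae_restrict_mem measurableSet_Ioo)).exists
    refine ⟨s, ⟨hs, hs'.1⟩, ?_⟩
    rw [Real.dist_eq, zero_sub, abs_neg, abs_of_pos hs'.1]
    exact hs'.2.trans_le (min_le_left _ _)
  refine ⟨T, ?_, fun ε hε => ?_⟩
  · filter_upwards [hS] with s hs
    have hlim : Tendsto (fun s' => |F s - F s'|) (𝓝[S ∩ Set.Ioi 0] 0) (𝓝 |F s - T|) :=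
      (tendsto_const_nhds.sub hT).abs
    refine le_of_tendsto hlim (eventually_mem_nhdsWithin.mono fun s' hs' => ?_)
    have h1 := (eVariationOn.edist_le F hs hs'.1).trans hF
    rw [edist_dist, Real.dist_eq] at h1
    exact (ENNReal.ofReal_le_iff_le_toReal hα).1 h1
  · have h1 := (Metric.tendsto_nhdsWithin_nhds.1 hT) ε hε
    obtain ⟨δ, hδ, h2⟩ := h1
    refine ⟨min δ h₀, by positivity, ?_⟩
    filter_upwards [hS' (min δ h₀) (min_le_right _ _), ae_restrict_mem measurableSet_Ioo]
      with s hs hs'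
    have := h2 (x := s) ⟨hs, hs'.1⟩ (by
      rw [Real.dist_eq, sub_zero, abs_of_pos hs'.1]
      exact hs'.2.trans_le (min_le_left _ _))
    rw [Real.dist_eq] at this
    exact this.le

theorem abs_average_sub_le {F : ℝ → ℝ} {T δ ε : ℝ} (hδ : 0 < δ)
    (hF : IntegrableOn F (Set.Ioo 0 δ))
    (h : ∀ᵐ s ∂(volume.restrict (Set.Ioo 0 δ)), |F s - T| ≤ ε) :
    |δ⁻¹ * (∫ s in Set.Ioo 0 δ, F s) - T| ≤ ε := by
  have h1 : δ⁻¹ * (∫ s in Set.Ioo 0 δ, F s) - T = δ⁻¹ * ∫ s in Set.Ioo 0 δ, (F s - T) := by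
    rw [integral_sub hF (integrableOn_const (by simp)), setIntegral_const]
    simp only [measureReal_def, Real.volume_Ioo, sub_zero, ENNReal.toReal_ofReal hδ.le, smul_eq_mul]
    field_simp
  rw [h1, abs_mul, abs_of_pos (inv_pos.2 hδ)]
  have h2 : |∫ s in Set.Ioo 0 δ, (F s - T)| ≤ ε * δ := by
    have := norm_integral_le_of_norm_le_const (μ := volume.restrict (Set.Ioo 0 δ))
      (f := fun s => F s - T) (C := ε) (by simpa using h)
    simpa [measureReal_def, hδ.le] using this
  rw [inv_mul_le_iff₀ hδ]
  linarith

/-- The limits `T y` are chosen pointwise, so measurability must be recovered: `T` is almost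
everywhere the limit of vertical means, which are measurable by Fubini. -/
theorem exists_hasChartTrace (hΩ : IsOpen Ω) (hb : Bornology.IsBounded Ω)
    (hne : Ωᶜ.Nonempty) {v : E (m + 1) → ℝ} (hv : IntegrableOn v Ω) {c : ℝ}
    (hc : surfaceEnergy Ω v ≤ c) (hr : 0 < r) (hG : G.IsChartOf Ω x₀ r) :
    ∃ T α, HasChartTrace G (G.base x₀ r) (r / 4) v T α := by
  obtain ⟨α, hαm, hαi, hα⟩ := exists_variation_bound hΩ hb hne hv hc hG
  have hh : 0 < r / 4 := by positivity
  have hαtop := ae_lt_top hαm hαi.ne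
  have key : ∀ y, ∃ T : ℝ, (∃ S : Set ℝ, S ⊆ Set.Ioo 0 (r / 4) ∧
        (∀ᵐ s ∂(volume.restrict (Set.Ioo 0 (r / 4))), s ∈ S) ∧
        eVariationOn (fun s => v (G.flat (y, s))) S ≤ α y) → α y < ⊤ →
      (∀ᵐ s ∂(volume.restrict (Set.Ioo 0 (r / 4))), |v (G.flat (y, s)) - T| ≤ (α y).toReal) ∧
      ∀ ε > 0, ∃ δ > 0, ∀ᵐ s ∂(volume.restrict (Set.Ioo 0 δ)), |v (G.flat (y, s)) - T| ≤ ε := by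
    intro y
    by_cases h : (∃ S : Set ℝ, S ⊆ Set.Ioo 0 (r / 4) ∧
        (∀ᵐ s ∂(volume.restrict (Set.Ioo 0 (r / 4))), s ∈ S) ∧
        eVariationOn (fun s => v (G.flat (y, s))) S ≤ α y) ∧ α y < ⊤
    · obtain ⟨⟨S, -, hS, hF⟩, htop⟩ := h
      obtain ⟨T, hT⟩ := exists_limit_of_variation hh hS htop.ne hF
      exact ⟨T, fun _ _ => hT⟩
    · exact ⟨0, fun h1 h2 => absurd ⟨h1, h2⟩ h⟩
  choose T hT using key
  have hbound : ∀ᵐ y ∂(volume.restrict (G.base x₀ r)),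
      ∀ᵐ s ∂(volume.restrict (Set.Ioo 0 (r / 4))), |v (G.flat (y, s)) - T y| ≤ (α y).toReal := by
    filter_upwards [hα, hαtop] with y h1 h2 using (hT y h1 h2).1
  have htend : ∀ᵐ y ∂(volume.restrict (G.base x₀ r)), ∀ ε > 0, ∃ δ > 0,
      ∀ᵐ s ∂(volume.restrict (Set.Ioo 0 δ)), |v (G.flat (y, s)) - T y| ≤ ε := by
    filter_upwards [hα, hαtop] with y h1 h2 using (hT y h1 h2).2
  set v' := Ω.indicator v
  have hv' : Integrable v' := hv.integrable_indicator hΩ.measurableSet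
  have hvi : Integrable (fun z : E m × ℝ => v' (G.flat z)) (volume.prod volume) :=
    G.measurePreserving_flat.integrable_comp_of_integrable hv'
  have hline := hvi.prod_right_ae
  have hvv : ∀ y ∈ G.base x₀ r, ∀ s ∈ Set.Ioo 0 (r / 4), v' (G.flat (y, s)) = v (G.flat (y, s)) :=
    fun y hy s hs => Set.indicator_of_mem (hG.flat_mem hy hs) v
  have hαint : IntegrableOn (fun y => (α y).toReal) (G.base x₀ r) :=
    integrable_toReal_of_lintegral_ne_top hαm.aemeasurable hαi.ne
  have havg : ∀ δ, Integrable fun y => δ⁻¹ * ∫ s in Set.Ioo 0 δ, v' (G.flat (y, s)) := by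
    intro δ
    have h1 : Integrable (fun z : E m × ℝ => v' (G.flat z))
        (volume.prod (volume.restrict (Set.Ioo 0 δ))) :=
      hvi.mono_measure (by
        have h := Measure.prod_restrict (μ := (volume : Measure (E m)))
          (ν := (volume : Measure ℝ)) Set.univ (Set.Ioo 0 δ)
        rw [Measure.restrict_univ] at h
        rw [h]
        exact Measure.restrict_le_self)
    exact h1.integral_prod_left.const_mul _
  have hTm : AEStronglyMeasurable T (volume.restrict (G.base x₀ r)) := by
    set h : ℕ → ℝ := fun k => 1 / ((k : ℝ) + 1) with hh'
    have hlim0 : Tendsto h atTop (𝓝 0) := tendsto_one_div_add_atTop_nhds_zero_nat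
    refine aestronglyMeasurable_of_tendsto_ae atTop
      (f := fun k y => (h k)⁻¹ * ∫ s in Set.Ioo 0 (h k), v' (G.flat (y, s)))
      (fun k => (havg (h k)).aestronglyMeasurable.restrict) ?_
    filter_upwards [htend, ae_restrict_of_ae hline,
      ae_restrict_mem (G.isOpen_base x₀ r).measurableSet] with y h1 h2 hy
    refine Metric.tendsto_atTop.2 fun ε hε => ?_
    obtain ⟨δ, hδ, h3⟩ := h1 (ε / 2) (by positivity)
    have h4 := hlim0.eventually_lt_const (show (0 : ℝ) < min δ (r / 4) by positivity)
    obtain ⟨N, hN⟩ := eventually_atTop.1 h4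
    refine ⟨N, fun k hk => ?_⟩
    have hkpos : 0 < h k := by simp only [hh']; positivity
    have hk1 : h k < δ := (hN k hk).trans_le (min_le_left _ _)
    have hk2 : h k < r / 4 := (hN k hk).trans_le (min_le_right _ _)
    rw [Real.dist_eq]
    refine (abs_average_sub_le hkpos h2.integrableOn (ε := ε / 2) ?_).trans_lt (by linarith)
    filter_upwards [ae_restrict_of_ae_restrict_of_subset (Set.Ioo_subset_Ioo_right hk1.le) h3,
      ae_restrict_mem measurableSet_Ioo] with s hs hs'
    rwa [hvv y hy s ⟨hs'.1, hs'.2.trans hk2⟩]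
  refine ⟨T, fun y => (α y).toReal, ⟨?_, hαint, hbound, htend⟩⟩
  have hbd : Integrable (fun y => (r / 4)⁻¹ * ∫ s in Set.Ioo 0 (r / 4), v' (G.flat (y, s))) :=
    havg (r / 4)
  -- The mean over the full height `r / 4` is integrable and differs from `T` by at most `α`.
  refine (hbd.norm.integrableOn.add hαint).mono' hTm ?_
  filter_upwards [hbound, ae_restrict_of_ae hline,
      ae_restrict_mem (G.isOpen_base x₀ r).measurableSet] with y h1 h2 hy
  have h3 := abs_average_sub_le hh h2.integrableOn (T := T y) (ε := (α y).toReal) (by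
    filter_upwards [h1, ae_restrict_mem measurableSet_Ioo] with s hs hs'
    rwa [hvv y hy s hs'])
  simp only [Pi.add_apply, Real.norm_eq_abs]
  have h4 := abs_sub_abs_le_abs_sub (T y) ((r / 4)⁻¹ * ∫ s in Set.Ioo 0 (r / 4), v' (G.flat (y, s)))
  rw [abs_sub_comm] at h4
  linarith

end GraphChart

end Capillary

/-! ### The trace as an approximate limit -/

namespace Capillary

/-- `τ` is the trace of `v` at `x` in the sense of approximate limits. -/
def HasTrace {n : ℕ} (Ω : Set (E n)) (v : E n → ℝ) (x : E n) (τ : ℝ) : Prop :=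
  ∀ ε > 0, ∀ᶠ ρ in 𝓝[>] (0 : ℝ), 0 < volume.real (Metric.ball x ρ ∩ Ω) ∧
    ∫ y in Metric.ball x ρ ∩ Ω, |v y - τ| ≤ ε * volume.real (Metric.ball x ρ ∩ Ω)

theorem HasTrace.trace_eq {n : ℕ} {Ω : Set (E n)} {v : E n → ℝ} (hv : IntegrableOn v Ω)
    {x : E n} {τ : ℝ} (h : HasTrace Ω v x τ) : trace Ω v x = τ := by
  refine Tendsto.limUnder_eq ?_
  rw [Metric.tendsto_nhds]
  intro ε hε
  filter_upwards [h (ε / 2) (by positivity)] with ρ ⟨h1, h2⟩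
  have hfin : volume (Metric.ball x ρ ∩ Ω) ≠ ⊤ :=
    ((measure_mono Set.inter_subset_left).trans_lt measure_ball_lt_top).ne
  have hvi : IntegrableOn v (Metric.ball x ρ ∩ Ω) := hv.mono_set Set.inter_subset_right
  rw [Real.dist_eq, setAverage_eq, smul_eq_mul]
  have e : (volume.real (Metric.ball x ρ ∩ Ω))⁻¹ * (∫ y in Metric.ball x ρ ∩ Ω, v y) - τ =
      (volume.real (Metric.ball x ρ ∩ Ω))⁻¹ * ∫ y in Metric.ball x ρ ∩ Ω, (v y - τ) := by
    rw [integral_sub hvi (integrableOn_const hfin), setIntegral_const, smul_eq_mul]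
    field_simp
  rw [e, abs_mul, abs_of_pos (inv_pos.2 h1), inv_mul_lt_iff₀ h1]
  have := (abs_integral_le_integral_abs (μ := volume.restrict (Metric.ball x ρ ∩ Ω))
    (f := fun y => v y - τ)).trans h2
  nlinarith

/-- The minimum is nonexpansive, so approximate limits in the mean pass through it. Convergence of
the means of `v` alone would not suffice, which is why `HasTrace` controls the mean of `|v - τ|`. -/
theorem HasTrace.min_continuous {n : ℕ} {Ω : Set (E n)} {v : E n → ℝ} (hv : IntegrableOn v Ω)
    {x : E n} {τ : ℝ} (h : HasTrace Ω v x τ) {ψ : E n → ℝ} (hψ : Continuous ψ) :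
    HasTrace Ω (fun y => min (v y) (ψ y)) x (min τ (ψ x)) := by
  intro ε hε
  have hc := Metric.continuousAt_iff.1 (hψ.continuousAt (x := x)) (ε / 2) (by positivity)
  obtain ⟨δ, hδ, hδ'⟩ := hc
  filter_upwards [h (ε / 2) (by positivity), Ioo_mem_nhdsGT hδ] with ρ ⟨h1, h2⟩ hρ
  refine ⟨h1, ?_⟩
  have hfin : volume (Metric.ball x ρ ∩ Ω) ≠ ⊤ :=
    ((measure_mono Set.inter_subset_left).trans_lt measure_ball_lt_top).ne
  have hvi : IntegrableOn v (Metric.ball x ρ ∩ Ω) := hv.mono_set Set.inter_subset_right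
  have i1 : IntegrableOn (fun y => |v y - τ|) (Metric.ball x ρ ∩ Ω) :=
    (hvi.sub (integrableOn_const hfin)).abs
  have i2 : IntegrableOn (fun _ => ε / 2) (Metric.ball x ρ ∩ Ω) (volume : Measure (E n)) :=
    integrableOn_const hfin
  calc ∫ y in Metric.ball x ρ ∩ Ω, |min (v y) (ψ y) - min τ (ψ x)|
      ≤ ∫ y in Metric.ball x ρ ∩ Ω, (|v y - τ| + ε / 2) := by
        refine integral_mono_of_nonneg (Eventually.of_forall fun y => abs_nonneg _)
          (i1.add i2) ?_
        refine ae_restrict_of_ae_restrict_of_subset Set.inter_subset_left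
          ((ae_restrict_iff' measurableSet_ball).2 (Eventually.of_forall fun y hy => ?_))
        have h3 : |ψ y - ψ x| ≤ ε / 2 := by
          have := hδ' (x := y) (lt_trans hy hρ.2)
          rw [Real.dist_eq] at this
          exact this.le
        have h4 := abs_min_sub_min_le_max (v y) (ψ y) τ (ψ x)
        exact h4.trans (max_le (by linarith) (by linarith [abs_nonneg (v y - τ)]))
    _ ≤ ε * volume.real (Metric.ball x ρ ∩ Ω) := by
        rw [integral_add i1 i2, setIntegral_const, smul_eq_mul]
        linarith

theorem exists_nat_one_div_near {h : ℝ} (h0 : 0 < h) {k : ℕ} (hk : h ≤ 1 / ((k : ℝ) + 1)) :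
    ∃ j ≥ k, h ≤ 1 / ((j : ℝ) + 1) ∧ 1 / ((j : ℝ) + 1) ≤ 2 * h := by
  have hk1 : ((k : ℝ) + 1) ≤ 1 / h := by
    rw [le_div_iff₀ h0]; rw [le_div_iff₀ (by positivity)] at hk; linarith
  have hfl : k + 1 ≤ ⌊1 / h⌋₊ := Nat.le_floor (by push_cast; exact hk1)
  obtain ⟨j, hj⟩ : ∃ j, ⌊1 / h⌋₊ = j + 1 := ⟨⌊1 / h⌋₊ - 1, by omega⟩
  have e1 : ((j : ℝ) + 1) ≤ 1 / h := by
    have := Nat.floor_le (show 0 ≤ 1 / h by positivity)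
    rw [hj] at this; push_cast at this; exact this
  have e2 : 1 / h < (j : ℝ) + 1 + 1 := by
    have := Nat.lt_floor_add_one (1 / h)
    rw [hj] at this; push_cast at this; exact this
  refine ⟨j, by omega, ?_, ?_⟩
  · rw [le_div_iff₀ (by positivity)]
    rw [le_div_iff₀ h0] at e1; linarith
  · rw [div_le_iff₀ (by positivity)]
    rw [div_lt_iff₀ h0] at e2
    nlinarith [(Nat.cast_nonneg j : (0 : ℝ) ≤ j)]

namespace GraphChart

variable {m : ℕ} {G : GraphChart m} {Ω : Set (E (m + 1))} {x₀ : E (m + 1)} {r : ℝ}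

theorem flat_mem_ball_graph {y y₀ : E m} {s ρ : ℝ} (hρ : 0 < ρ)
    (hy : dist y y₀ < ρ / (G.K + 2)) (hs : s ∈ Set.Ioo 0 (ρ / (G.K + 2))) :
    G.flat (y, s) ∈ Metric.ball (G.graph y₀) ρ := by
  have hK := G.K.coe_nonneg
  set κ := ρ / (G.K + 2) with hκ
  have hκ0 : 0 < κ := by positivity
  have hρκ : ρ = κ * (G.K + 2) := by rw [hκ]; field_simp
  have h1 := G.dist_flat_sq y y₀ s
  have h2 : |G.p y - G.p y₀| ≤ G.K * κ := by
    have := G.lipschitz.dist_le_mul y y₀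
    rw [Real.dist_eq] at this
    exact this.trans (mul_le_mul_of_nonneg_left hy.le hK)
  have h3 : |G.p y - G.p y₀ + s| ≤ (G.K + 1) * κ := by
    refine (abs_add_le _ _).trans ?_
    rw [abs_of_pos hs.1]
    linarith [hs.2]
  have h4 : (G.p y - G.p y₀ + s) ^ 2 ≤ ((G.K + 1) * κ) ^ 2 := sq_le_sq' (abs_le.1 h3).1 (abs_le.1 h3).2
  have h5 : dist y y₀ ^ 2 ≤ κ ^ 2 := by
    have := dist_nonneg (x := y) (y := y₀)
    nlinarith
  rw [Metric.mem_ball]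
  have h6 : dist (G.flat (y, s)) (G.graph y₀) ^ 2 < ρ ^ 2 := by
    rw [h1, hρκ]
    nlinarith [mul_pos hκ0 hκ0]
  exact lt_of_pow_lt_pow_left₀ 2 hρ.le h6

theorem mem_of_flat_mem_ball {y y₀ : E m} {s ρ : ℝ}
    (h : G.flat (y, s) ∈ Metric.ball (G.graph y₀) ρ) :
    y ∈ Metric.closedBall y₀ ρ ∧ s < (G.K + 1) * ρ := by
  rw [Metric.mem_ball] at h
  have h1 := G.dist_flat_sq y y₀ s
  have h0 := dist_nonneg (x := G.flat (y, s)) (y := G.graph y₀)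
  have h2 : dist y y₀ ≤ dist (G.flat (y, s)) (G.graph y₀) :=
    (abs_le_of_sq_le_sq' (by nlinarith [sq_nonneg (G.p y - G.p y₀ + s)]) h0).2
  have h3 : G.p y - G.p y₀ + s ≤ dist (G.flat (y, s)) (G.graph y₀) :=
    (abs_le_of_sq_le_sq' (by nlinarith [sq_nonneg (dist y y₀)]) h0).2
  have h4 := G.lipschitz.dist_le_mul y y₀
  rw [Real.dist_eq] at h4
  have h5 := neg_abs_le (G.p y - G.p y₀)
  refine ⟨h2.trans h.le, ?_⟩
  nlinarith [G.K.coe_nonneg]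

/-- The intersection contains a flattened cylinder whose radius and height are `ρ / (K + 2)`; the
denominator absorbs the slope `K` of the graph. The bound is phrased by the volume of a ball of the
base so that it matches Lebesgue differentiation there. -/
theorem IsChartOf.volume_ball_inter_ge (hG : G.IsChartOf Ω x₀ r) {y₀ : E m} {ρ : ℝ}
    (hρ : 0 < ρ) (hsub : Metric.ball (G.graph y₀) ρ ⊆ Metric.ball x₀ r) :
    (ρ / (G.K + 2)) * ((G.K + 2 : ℝ)⁻¹ ^ m * volume.real (Metric.closedBall y₀ ρ)) ≤
      volume.real (Metric.ball (G.graph y₀) ρ ∩ Ω) := by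
  have hK := G.K.coe_nonneg
  set κ := ρ / (G.K + 2) with hκ
  have hκ0 : 0 < κ := by positivity
  have hfin : volume (Metric.ball (G.graph y₀) ρ ∩ Ω) ≠ ⊤ :=
    ((measure_mono Set.inter_subset_left).trans_lt measure_ball_lt_top).ne
  have h1 : G.flat '' (Metric.ball y₀ κ ×ˢ Set.Ioo 0 κ) ⊆ Metric.ball (G.graph y₀) ρ ∩ Ω := by
    rintro _ ⟨⟨y, s⟩, ⟨hy, hs⟩, rfl⟩
    have h2 := flat_mem_ball_graph hρ hy hs
    exact ⟨h2, (hG _ (hsub h2)).2 hs.1⟩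
  have h2 : volume.real (G.flat '' (Metric.ball y₀ κ ×ˢ Set.Ioo 0 κ)) =
      volume.real (Metric.ball y₀ κ) * κ := by
    have hinj : Function.Injective G.flat := G.flatHomeo.injective
    rw [measureReal_def, ← G.measurePreserving_flat.measure_preimage_emb
      G.measurableEmbedding_flat, Set.preimage_image_eq _ hinj,
      Measure.prod_prod, ENNReal.toReal_mul, Real.volume_Ioo, sub_zero,
      ENNReal.toReal_ofReal hκ0.le, ← measureReal_def]
  have h3 : volume.real (Metric.ball y₀ κ) =
      (G.K + 2 : ℝ)⁻¹ ^ m * volume.real (Metric.closedBall y₀ ρ) := by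
    have e1 : κ = (G.K + 2 : ℝ)⁻¹ * ρ := by rw [hκ]; field_simp
    rw [measureReal_def, measureReal_def, Measure.addHaar_closedBall _ _ hρ.le,
      Measure.addHaar_ball_of_pos _ _ hκ0, ENNReal.toReal_mul, ENNReal.toReal_mul,
      ENNReal.toReal_ofReal (by positivity), ENNReal.toReal_ofReal (by positivity),
      finrank_euclideanSpace_fin, e1, mul_pow, mul_assoc]
  calc κ * ((G.K + 2 : ℝ)⁻¹ ^ m * volume.real (Metric.closedBall y₀ ρ))
      = volume.real (G.flat '' (Metric.ball y₀ κ ×ˢ Set.Ioo 0 κ)) := by rw [h2, h3, mul_comm]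
    _ ≤ _ := measureReal_mono h1 hfin

end GraphChart

end Capillary

namespace Capillary

/-- The supremum of the means of `f` over the intervals `(0, 1 / (j + 1))` with `j ≥ k`. -/
noncomputable def maxMean (k : ℕ) (f : ℝ → ℝ≥0∞) : ℝ≥0∞ :=
  ⨆ j : ℕ, (((k + j + 1 : ℕ) : ℝ≥0∞)) * ∫⁻ s in Set.Ioo 0 (1 / (((k + j : ℕ) : ℝ) + 1)), f s

/-- Any height `h` lies within a factor `2` below some `1 / (j + 1)`. A countable supremum, which
keeps measurability, thus controls all vertical means. -/
theorem lintegral_Ioo_le_maxMean {f : ℝ → ℝ≥0∞} {h : ℝ} (h0 : 0 < h) {k : ℕ}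
    (hk : h ≤ 1 / ((k : ℝ) + 1)) :
    ∫⁻ s in Set.Ioo 0 h, f s ≤ ENNReal.ofReal (2 * h) * maxMean k f := by
  obtain ⟨j', hj', h1, h2⟩ := exists_nat_one_div_near h0 hk
  obtain ⟨j, rfl⟩ := Nat.exists_eq_add_of_le hj'
  have e : (1 : ℝ≥0∞) ≤ ENNReal.ofReal (2 * h) * ((k + j + 1 : ℕ) : ℝ≥0∞) := by
    rw [← ENNReal.ofReal_natCast, ← ENNReal.ofReal_mul (by positivity), ENNReal.one_le_ofReal]
    rw [div_le_iff₀ (by positivity)] at h2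
    push_cast at h2 ⊢
    linarith
  calc ∫⁻ s in Set.Ioo 0 h, f s
      ≤ ∫⁻ s in Set.Ioo 0 (1 / (((k + j : ℕ) : ℝ) + 1)), f s :=
        lintegral_mono_set (Set.Ioo_subset_Ioo_right h1)
    _ ≤ (ENNReal.ofReal (2 * h) * ((k + j + 1 : ℕ) : ℝ≥0∞)) *
        ∫⁻ s in Set.Ioo 0 (1 / (((k + j : ℕ) : ℝ) + 1)), f s := le_mul_of_one_le_left' e
    _ ≤ _ := by
        rw [mul_assoc]
        refine mul_le_mul_right ?_ _
        exact le_iSup (fun j : ℕ => (((k + j + 1 : ℕ) : ℝ≥0∞)) *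
          ∫⁻ s in Set.Ioo 0 (1 / (((k + j : ℕ) : ℝ) + 1)), f s) j

theorem maxMean_le {f : ℝ → ℝ≥0∞} {k : ℕ} {δ : ℝ} (hk : 1 / ((k : ℝ) + 1) ≤ δ) {C : ℝ≥0∞}
    (h : ∀ᵐ s ∂(volume.restrict (Set.Ioo 0 δ)), f s ≤ C) : maxMean k f ≤ C := by
  refine iSup_le fun j => ?_
  have h1 : (1 : ℝ) / (((k + j : ℕ) : ℝ) + 1) ≤ δ := by
    refine le_trans ?_ hk
    have : (0 : ℝ) ≤ j := j.cast_nonneg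
    push_cast
    exact one_div_le_one_div_of_le (by positivity) (by linarith)
  have h2 : ∫⁻ s in Set.Ioo 0 (1 / (((k + j : ℕ) : ℝ) + 1)), f s ≤
      ∫⁻ s in Set.Ioo 0 (1 / (((k + j : ℕ) : ℝ) + 1)), C :=
    lintegral_mono_ae (ae_restrict_of_ae_restrict_of_subset (Set.Ioo_subset_Ioo_right h1) h)
  refine (mul_le_mul_right h2 _).trans_eq ?_
  rw [setLIntegral_const, Real.volume_Ioo, sub_zero, mul_comm C, ← mul_assoc,
    ← ENNReal.ofReal_natCast, ← ENNReal.ofReal_mul (by positivity)]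
  have : ((k + j + 1 : ℕ) : ℝ) * (1 / (((k + j : ℕ) : ℝ) + 1)) = 1 := by
    push_cast; field_simp
  rw [this, ENNReal.ofReal_one, one_mul]

theorem aemeasurable_maxMean {m : ℕ} {f : E m × ℝ → ℝ≥0∞} (hf : AEMeasurable f (volume.prod volume))
    (k : ℕ) : AEMeasurable fun y => maxMean k fun s => f (y, s) := by
  refine AEMeasurable.iSup fun j => AEMeasurable.const_mul ?_ _
  refine AEMeasurable.lintegral_prod_right' (f := f) (hf.mono_ac ?_)
  exact Measure.AbsolutelyContinuous.rfl.prod Measure.restrict_le_self.absolutelyContinuous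

theorem ae_eventually_lintegral_closedBall_le {m : ℕ} {f : E m → ℝ} (hf : LocallyIntegrable f) :
    ∀ᵐ y₀, ∀ η > 0, ∀ᶠ ρ in 𝓝[>] (0 : ℝ), ∫⁻ y in Metric.closedBall y₀ ρ, ‖f y - f y₀‖ₑ ≤
      ENNReal.ofReal η * volume (Metric.closedBall y₀ ρ) := by
  filter_upwards [(Besicovitch.vitaliFamily (volume : Measure (E m))).ae_tendsto_lintegral_enorm_sub_div
    hf] with y₀ h1 η hη
  have h2 := h1.comp (Besicovitch.tendsto_filterAt volume y₀)
  filter_upwards [h2.eventually_le_const (ENNReal.ofReal_pos.2 hη), self_mem_nhdsWithin]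
    with ρ h3 hρ
  have hρ' : 0 < ρ := hρ
  rwa [Function.comp_apply, ENNReal.div_le_iff (Metric.measure_closedBall_pos _ _ hρ').ne'
    measure_closedBall_lt_top.ne] at h3

namespace GraphChart

variable {m : ℕ} {G : GraphChart m} {Ω : Set (E (m + 1))} {x₀ : E (m + 1)} {r : ℝ}

/-- The trace in graph coordinates is the trace in the sense of approximate limits. -/
theorem HasChartTrace.hasTrace (hΩ : IsOpen Ω) {v : E (m + 1) → ℝ}
    (hv : IntegrableOn v Ω) (hr : 0 < r) (hG : G.IsChartOf Ω x₀ r) {T α : E m → ℝ}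
    (h : HasChartTrace G (G.base x₀ r) (r / 4) v T α) :
    ∀ᵐ y ∂(volume.restrict (G.base x₀ r)), HasTrace Ω v (G.graph y) (T y) := by
  set A := G.base x₀ r with hA
  have hAo : IsOpen A := G.isOpen_base x₀ r
  set v' := Ω.indicator v with hv'def
  set T' := A.indicator T with hT'def
  have hv' : Integrable v' := hv.integrable_indicator hΩ.measurableSet
  have hT' : Integrable T' := h.integrable.integrable_indicator hAo.measurableSet
  have hvi : Integrable (fun z : E m × ℝ => v' (G.flat z)) (volume.prod volume) :=
    G.measurePreserving_flat.integrable_comp_of_integrable hv'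
  set D : E m × ℝ → ℝ≥0∞ := fun z => ‖v' (G.flat z) - T' z.1‖ₑ with hD
  have hDm : AEMeasurable D (volume.prod volume) :=
    (hvi.aestronglyMeasurable.sub hT'.aestronglyMeasurable.comp_fst).enorm
  set V : ℕ → E m → ℝ≥0∞ := fun k y => maxMean k fun s => D (y, s) with hV
  have hVm : ∀ k, AEMeasurable (V k) := fun k => aemeasurable_maxMean hDm k
  have hDv : ∀ y ∈ A, ∀ s ∈ Set.Ioo 0 (r / 4), D (y, s) = ‖v (G.flat (y, s)) - T y‖ₑ :=
    fun y hy s hs => by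
      simp only [hD, hv'def, hT'def, Set.indicator_of_mem (hG.flat_mem hy hs),
        Set.indicator_of_mem hy]
  obtain ⟨k₀, hk₀⟩ := exists_nat_one_div_lt (show 0 < r / 4 by positivity)
  have hkle : ∀ k ≥ k₀, 1 / ((k : ℝ) + 1) ≤ r / 4 := fun k hk =>
    (one_div_le_one_div_of_le (by positivity) (by exact_mod_cast Nat.succ_le_succ hk)).trans hk₀.le
  have hVα : ∀ᵐ y ∂(volume.restrict A), ∀ k ≥ k₀, V k y ≤ ENNReal.ofReal (α y) := by
    filter_upwards [h.bound, ae_restrict_mem hAo.measurableSet] with y hy hyA k hk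
    refine maxMean_le (hkle k hk) ?_
    filter_upwards [hy, ae_restrict_mem measurableSet_Ioo] with s hs hs'
    rw [hDv y hyA s hs', ← ofReal_norm]
    exact ENNReal.ofReal_le_ofReal hs
  -- Convergence along a vertical line makes the maximal mean of the deviation small for large `k`,
  -- while `hVα` provides an integrable majorant.
  have hV0 : ∀ᵐ y ∂(volume.restrict A), ∀ ε > 0, ∃ k ≥ k₀, V k y ≤ ENNReal.ofReal ε := by
    filter_upwards [h.tendsto, ae_restrict_mem hAo.measurableSet] with y hy hyA ε hε
    obtain ⟨δ, hδ, h1⟩ := hy ε hε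
    obtain ⟨k, hk⟩ := exists_nat_one_div_lt (show 0 < min δ (r / 4) by positivity)
    refine ⟨max k k₀, le_max_right _ _, maxMean_le (δ := min δ (r / 4)) ?_ ?_⟩
    · refine le_trans ?_ hk.le
      exact one_div_le_one_div_of_le (by positivity) (by
        have : (k : ℝ) ≤ ((max k k₀ : ℕ) : ℝ) := by exact_mod_cast le_max_left _ _
        linarith)
    · filter_upwards [ae_restrict_of_ae_restrict_of_subset
        (Set.Ioo_subset_Ioo_right (min_le_left δ (r / 4))) h1, ae_restrict_mem measurableSet_Ioo]
        with s hs hs'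
      rw [hDv y hyA s ⟨hs'.1, hs'.2.trans_le (min_le_right _ _)⟩, ← ofReal_norm]
      exact ENNReal.ofReal_le_ofReal hs
  set W : ℕ → E m → ℝ := fun k => A.indicator fun y => (V k y).toReal with hW
  have hWi : ∀ k ≥ k₀, Integrable (W k) := by
    intro k hk
    refine IntegrableOn.integrable_indicator ?_ hAo.measurableSet
    refine Integrable.mono' h.integrable_bound.abs (hVm k).ennreal_toReal.aestronglyMeasurable.restrict
      ?_
    filter_upwards [hVα] with y hy
    rw [Real.norm_eq_abs, abs_of_nonneg ENNReal.toReal_nonneg]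
    refine (ENNReal.toReal_mono ENNReal.ofReal_ne_top (hy k hk)).trans ?_
    rw [ENNReal.toReal_ofReal']
    exact max_le (le_abs_self _) (abs_nonneg _)
  -- Convergence on the single line over `y₀` says nothing about neighbouring lines. Taking `y₀` to
  -- be a Lebesgue point of every maximal mean, and of the trace, carries the smallness over to
  -- small balls of the base in the mean.
  have hLW : ∀ᵐ y₀, ∀ k ≥ k₀, ∀ η > 0, ∀ᶠ ρ in 𝓝[>] (0 : ℝ),
      ∫⁻ y in Metric.closedBall y₀ ρ, ‖W k y - W k y₀‖ₑ ≤
        ENNReal.ofReal η * volume (Metric.closedBall y₀ ρ) := by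
    rw [ae_all_iff]
    intro k
    by_cases hk : k ≥ k₀
    · filter_upwards [ae_eventually_lintegral_closedBall_le (hWi k hk).locallyIntegrable]
        with y hy _ using hy
    · exact Eventually.of_forall fun y hy => absurd hy hk
  have hVfin : ∀ᵐ y, y ∈ A → ∀ k ≥ k₀, V k y = ‖W k y‖ₑ := by
    filter_upwards [(ae_restrict_iff' hAo.measurableSet).1 hVα] with y hy hyA k hk
    have h1 : V k y ≠ ⊤ := ((hy hyA k hk).trans_lt ENNReal.ofReal_lt_top).ne
    simp only [hW, Set.indicator_of_mem hyA]
    rw [Real.enorm_eq_ofReal ENNReal.toReal_nonneg, ENNReal.ofReal_toReal h1]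
  filter_upwards [hV0, ae_restrict_of_ae hLW, ae_restrict_of_ae hVfin, ae_restrict_of_ae
    (ae_eventually_lintegral_closedBall_le hT'.locallyIntegrable), ae_restrict_mem hAo.measurableSet]
    with y₀ h1 h2 h3 h4 hy₀ ε hε
  have hK := G.K.coe_nonneg
  set L : ℝ := G.K + 1 with hL
  have hL0 : 0 < L := by positivity
  set c₀ : ℝ := (G.K + 2 : ℝ)⁻¹ * (G.K + 2 : ℝ)⁻¹ ^ m with hc₀
  have hc0 : 0 < c₀ := by positivity
  -- The deviation integral will be at most `5 * L * ρ * η * μB`: four parts come from the maximal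
  -- mean, namely the factor `2` times its oscillation and its value at `y₀`, and one from the
  -- oscillation of `T`. The volume of the intersection is at least `ρ * c₀ * μB`.
  set η : ℝ := ε * c₀ / (5 * L) with hη
  have hη0 : 0 < η := by positivity
  obtain ⟨k, hk, hVk⟩ := h1 η hη0
  have hball : ∀ᶠ ρ in 𝓝[>] (0 : ℝ), Metric.closedBall y₀ ρ ⊆ A := by
    obtain ⟨δ, hδ, hδA⟩ := Metric.nhds_basis_closedBall.mem_iff.1 (hAo.mem_nhds hy₀)
    filter_upwards [Ioo_mem_nhdsGT hδ] with ρ hρ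
    exact (Metric.closedBall_subset_closedBall hρ.2.le).trans hδA
  have hsmall : 0 < min (1 / ((k : ℝ) + 1) / L) (r / 4) := by positivity
  filter_upwards [h2 k hk η hη0, h4 η hη0, hball, Ioo_mem_nhdsGT hsmall] with ρ h5 h6 h7 hρ
  have hρ0 : 0 < ρ := hρ.1
  have hρ1 : L * ρ ≤ 1 / ((k : ℝ) + 1) := by
    have := hρ.2.le.trans (min_le_left _ _)
    rw [le_div_iff₀ hL0] at this; linarith
  have hρ2 : ρ < r / 4 := hρ.2.trans_le (min_le_right _ _)
  have hsub : Metric.ball (G.graph y₀) ρ ⊆ Metric.ball x₀ r := by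
    refine Metric.ball_subset_ball' ?_
    have : dist (G.graph y₀) x₀ < 3 * r / 4 := hy₀
    linarith
  have hvol := hG.volume_ball_inter_ge hρ0 hsub
  set μB := volume.real (Metric.closedBall y₀ ρ) with hμB
  have hμB0 : 0 < μB :=
    ENNReal.toReal_pos (Metric.measure_closedBall_pos _ _ hρ0).ne' measure_closedBall_lt_top.ne
  have hvol' : ρ * c₀ * μB ≤ volume.real (Metric.ball (G.graph y₀) ρ ∩ Ω) := by
    refine le_trans (le_of_eq ?_) hvol
    rw [hc₀]; ring
  have hvol0 : 0 < volume.real (Metric.ball (G.graph y₀) ρ ∩ Ω) :=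
    lt_of_lt_of_le (by positivity) hvol'
  refine ⟨hvol0, ?_⟩
  set S := Metric.ball (G.graph y₀) ρ ∩ Ω with hS
  have hSm : MeasurableSet S := measurableSet_ball.inter hΩ.measurableSet
  have hfin : volume S ≠ ⊤ :=
    ((measure_mono Set.inter_subset_left).trans_lt measure_ball_lt_top).ne
  have hTy : T' y₀ = T y₀ := Set.indicator_of_mem hy₀ T
  have hcov : G.flat ⁻¹' S ⊆ Metric.closedBall y₀ ρ ×ˢ Set.Ioo 0 (L * ρ) := by
    rintro ⟨y, s⟩ hz
    have h8 := mem_of_flat_mem_ball hz.1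
    exact ⟨h8.1, (hG _ (hsub hz.1)).1 hz.2, h8.2⟩
  have key : ∫⁻ x in S, ‖v x - T y₀‖ₑ ≤ ENNReal.ofReal (5 * L * ρ * η * μB) := by
    calc ∫⁻ x in S, ‖v x - T y₀‖ₑ = ∫⁻ x in S, ‖v' x - T y₀‖ₑ :=
          setLIntegral_congr_fun hSm fun x hx => by
            simp only [hv'def, Set.indicator_of_mem hx.2]
      _ = ∫⁻ z in G.flat ⁻¹' S, ‖v' (G.flat z) - T y₀‖ₑ ∂(volume.prod volume) := by
          rw [G.measurePreserving_flat.setLIntegral_comp_preimage_emb G.measurableEmbedding_flat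
            (fun x => ‖v' x - T y₀‖ₑ)]
      _ ≤ ∫⁻ z in G.flat ⁻¹' S, (D z + ‖T' z.1 - T' y₀‖ₑ) ∂(volume.prod volume) := by
          refine lintegral_mono fun z => ?_
          rw [← hTy]
          have : v' (G.flat z) - T' y₀ = (v' (G.flat z) - T' z.1) + (T' z.1 - T' y₀) := by ring
          rw [this]
          exact enorm_add_le _ _
      _ ≤ ∫⁻ z in Metric.closedBall y₀ ρ ×ˢ Set.Ioo 0 (L * ρ), (D z + ‖T' z.1 - T' y₀‖ₑ)
            ∂(volume.prod volume) := lintegral_mono_set hcov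
      _ = ∫⁻ y in Metric.closedBall y₀ ρ, ∫⁻ s in Set.Ioo 0 (L * ρ),
            (D (y, s) + ‖T' y - T' y₀‖ₑ) := by
          rw [← Measure.prod_restrict, lintegral_prod]
          have m1 : AEMeasurable D ((volume.restrict (Metric.closedBall y₀ ρ)).prod
              (volume.restrict (Set.Ioo 0 (L * ρ)))) := by
            rw [Measure.prod_restrict]; exact hDm.restrict
          exact m1.add ((hT'.aestronglyMeasurable.restrict.comp_fst).sub
              aestronglyMeasurable_const).enorm
      _ ≤ ∫⁻ y in Metric.closedBall y₀ ρ, ENNReal.ofReal (L * ρ) *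
            (2 * (‖W k y - W k y₀‖ₑ + ENNReal.ofReal η) + ‖T' y - T' y₀‖ₑ) := by
          refine lintegral_mono_ae ?_
          filter_upwards [ae_restrict_of_ae hVfin, ae_restrict_mem measurableSet_closedBall]
            with y hy hyB
          rw [lintegral_add_right _ measurable_const, setLIntegral_const, Real.volume_Ioo, sub_zero,
            mul_add, mul_comm ‖T' y - T' y₀‖ₑ]
          gcongr
          refine (lintegral_Ioo_le_maxMean (by positivity) hρ1).trans ?_
          have e1 : maxMean k (fun s => D (y, s)) = ‖W k y‖ₑ := hy (h7 hyB) k hk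
          have e2 : ‖W k y₀‖ₑ ≤ ENNReal.ofReal η := by rw [← h3 hy₀ k hk]; exact hVk
          have e3 : W k y = (W k y - W k y₀) + W k y₀ := by ring
          have e4 : ‖W k y‖ₑ ≤ ‖W k y - W k y₀‖ₑ + ENNReal.ofReal η := by
            calc ‖W k y‖ₑ = ‖(W k y - W k y₀) + W k y₀‖ₑ := by rw [← e3]
              _ ≤ ‖W k y - W k y₀‖ₑ + ‖W k y₀‖ₑ := enorm_add_le _ _
              _ ≤ _ := by gcongr
          calc ENNReal.ofReal (2 * (L * ρ)) * maxMean k (fun s => D (y, s))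
              = ENNReal.ofReal (L * ρ) * (2 * ‖W k y‖ₑ) := by
                rw [e1, ENNReal.ofReal_mul zero_le_two, ENNReal.ofReal_ofNat]; ring
            _ ≤ _ := by gcongr
      _ ≤ ENNReal.ofReal (L * ρ) * (2 * (ENNReal.ofReal η * volume (Metric.closedBall y₀ ρ) +
            ENNReal.ofReal η * volume (Metric.closedBall y₀ ρ)) +
            ENNReal.ofReal η * volume (Metric.closedBall y₀ ρ)) := by
          rw [lintegral_const_mul' _ _ ENNReal.ofReal_ne_top]
          refine mul_le_mul_right ?_ _
          have m1 : AEMeasurable (fun y => ‖T' y - T' y₀‖ₑ)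
              (volume.restrict (Metric.closedBall y₀ ρ)) :=
            (hT'.aestronglyMeasurable.restrict.sub aestronglyMeasurable_const).enorm
          rw [lintegral_add_right' _ m1, lintegral_const_mul' _ _ (by simp),
            lintegral_add_right _ measurable_const, setLIntegral_const]
          gcongr
      _ = ENNReal.ofReal (5 * L * ρ * η * μB) := by
          have e1 : volume (Metric.closedBall y₀ ρ) = ENNReal.ofReal μB := by
            rw [hμB, measureReal_def, ENNReal.ofReal_toReal measure_closedBall_lt_top.ne]
          have e2 : 5 * L * ρ * η * μB = L * ρ * (2 * (η * μB + η * μB) + η * μB) := by ring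
          rw [e1, e2, ENNReal.ofReal_mul (by positivity : 0 ≤ L * ρ),
            ENNReal.ofReal_add (by positivity) (by positivity), ENNReal.ofReal_mul zero_le_two,
            ENNReal.ofReal_add (by positivity) (by positivity), ENNReal.ofReal_mul hη0.le,
            ENNReal.ofReal_ofNat]
  have hvS : AEStronglyMeasurable (fun x => v x - T y₀) (volume.restrict S) :=
    ((hv.mono_set Set.inter_subset_right).sub (integrableOn_const hfin)).aestronglyMeasurable
  have e1 : ∫ x in S, |v x - T y₀| = (∫⁻ x in S, ‖v x - T y₀‖ₑ).toReal :=
    integral_norm_eq_lintegral_enorm hvS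
  rw [e1]
  refine (ENNReal.toReal_mono ENNReal.ofReal_ne_top key).trans ?_
  rw [ENNReal.toReal_ofReal (by positivity)]
  have e2 : 5 * L * ρ * η * μB = ε * (ρ * c₀ * μB) := by rw [hη]; field_simp
  rw [e2]
  exact mul_le_mul_of_nonneg_left hvol' hε.le

end GraphChart

end Capillary

/-! ### Semiconcave functions and the calibrating field -/

namespace Capillary

variable {n : ℕ}

/-- `F - κ / 2 * ‖x‖ ^ 2` is concave. -/
def Semiconcave (κ : ℝ) (F : E n → ℝ) : Prop :=
  ∀ x y, ∀ a b : ℝ, 0 ≤ a → 0 ≤ b → a + b = 1 →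
    a * F x + b * F y ≤ F (a • x + b • y) + κ / 2 * (a * b) * ‖x - y‖ ^ 2

theorem convex_combination_norm_sq (x y c : E n) {a b : ℝ} (hab : a + b = 1) :
    a * ‖x - c‖ ^ 2 + b * ‖y - c‖ ^ 2 = ‖a • x + b • y - c‖ ^ 2 + a * b * ‖x - y‖ ^ 2 := by
  have e1 : a • x + b • y - c = a • (x - c) + b • (y - c) := by
    rw [smul_sub, smul_sub, ← sub_eq_zero]
    have : c = (a + b) • c := by rw [hab, one_smul]
    nth_rw 1 [this]
    rw [add_smul]; abel
  have e2 : x - y = (x - c) - (y - c) := by abel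
  rw [e1, e2, norm_add_sq_real, norm_sub_sq_real (x - c), norm_smul, norm_smul, inner_smul_left,
    inner_smul_right, mul_pow, mul_pow, Real.norm_eq_abs, Real.norm_eq_abs, sq_abs, sq_abs]
  simp only [conj_trivial]
  obtain rfl : b = 1 - a := by linarith
  ring

/-- For a fixed `c` the function `‖x - c‖²` satisfies the condition with equality. Taking `c`
nearest to the convex combination gives the inequality, since `c` is only a competitor at `x` and
`y`. -/
theorem semiconcave_infDist_sq {C : Set (E n)} (hC : IsClosed C) (hne : C.Nonempty) :
    Semiconcave 2 fun x => Metric.infDist x C ^ 2 := by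
  intro x y a b ha hb hab
  obtain ⟨c, hc, hd⟩ := hC.exists_infDist_eq_dist hne (a • x + b • y)
  have h : ∀ z, Metric.infDist z C ^ 2 ≤ ‖z - c‖ ^ 2 := fun z => by
    have := Metric.infDist_le_dist_of_mem (x := z) hc
    rw [dist_eq_norm] at this
    exact pow_le_pow_left₀ Metric.infDist_nonneg this 2
  have h3 := convex_combination_norm_sq x y c hab
  simp only
  rw [hd, dist_eq_norm]
  have h1 := mul_le_mul_of_nonneg_left (h x) ha
  have h2 := mul_le_mul_of_nonneg_left (h y) hb
  linarith

theorem Semiconcave.const_mul {κ l : ℝ} {F : E n → ℝ} (h : Semiconcave κ F) (hl : 0 ≤ l) :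
    Semiconcave (l * κ) fun x => l * F x := by
  intro x y a b ha hb hab
  have := mul_le_mul_of_nonneg_left (h x y a b ha hb hab) hl
  simp only
  linarith

/-- The condition is invariant under translations and stable under averages, with the same constant.
-/
theorem Semiconcave.mollify {κ : ℝ} {F : E n → ℝ} (h : Semiconcave κ F)
    (hF : LocallyIntegrable F) (φ : ContDiffBump (0 : E n)) : Semiconcave κ (mollify φ F) := by
  intro x y a b ha hb hab
  have i := fun z => integrable_normed_smul φ hF z
  have e : κ / 2 * (a * b) * ‖x - y‖ ^ 2 =
      ∫ t, φ.normed volume t • (κ / 2 * (a * b) * ‖x - y‖ ^ 2) := by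
    simp only [smul_eq_mul]
    rw [integral_mul_const, φ.integral_normed, one_mul]
  have ic : Integrable fun t => φ.normed volume t • (κ / 2 * (a * b) * ‖x - y‖ ^ 2) := by
    simp only [smul_eq_mul]
    exact (φ.integrable_normed).mul_const _
  rw [mollify_apply, mollify_apply, mollify_apply, e, ← integral_const_mul, ← integral_const_mul,
    ← integral_add ((i x).const_mul a) ((i y).const_mul b), ← integral_add (i _) ic]
  refine integral_mono (((i x).const_mul a).add ((i y).const_mul b)) ((i _).add ic) fun t => ?_
  have h1 := h (x - t) (y - t) a b ha hb hab
  have e1 : a • (x - t) + b • (y - t) = a • x + b • y - t := by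
    rw [smul_sub, smul_sub]
    have : t = (a + b) • t := by rw [hab, one_smul]
    nth_rw 3 [this]
    rw [add_smul]; abel
  rw [e1, sub_sub_sub_cancel_right] at h1
  have h2 := mul_le_mul_of_nonneg_left h1 (φ.nonneg_normed (μ := volume) t)
  simp only [smul_eq_mul]
  linarith

theorem Semiconcave.le_add_fderiv {κ : ℝ} {F : E n → ℝ} (h : Semiconcave κ F)
    (x y : E n) (hF : DifferentiableAt ℝ F x) :
    F (x + y) ≤ F x + fderiv ℝ F x y + κ / 2 * ‖y‖ ^ 2 := by
  have h1 : Tendsto (fun t : ℝ => t⁻¹ * (F (x + t • y) - F x) + κ / 2 * (1 - t) * ‖y‖ ^ 2)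
      (𝓝[>] 0) (𝓝 (fderiv ℝ F x y + κ / 2 * (1 - 0) * ‖y‖ ^ 2)) := by
    refine Tendsto.add ?_ ?_
    · have h2 := (hF.hasFDerivAt.hasLineDerivAt y).tendsto_slope_zero_right
      simpa only [smul_eq_mul] using h2
    · have : Continuous fun t : ℝ => κ / 2 * (1 - t) * ‖y‖ ^ 2 := by fun_prop
      exact (this.tendsto 0).mono_left nhdsWithin_le_nhds
  have h3 : ∀ᶠ t in 𝓝[>] (0 : ℝ), F (x + y) - F x ≤
      t⁻¹ * (F (x + t • y) - F x) + κ / 2 * (1 - t) * ‖y‖ ^ 2 := by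
    filter_upwards [Ioo_mem_nhdsGT (zero_lt_one' ℝ)] with t ht
    have h4 := h x (x + y) (1 - t) t (by linarith [ht.2]) ht.1.le (by ring)
    have e1 : (1 - t) • x + t • (x + y) = x + t • y := by module
    rw [e1, sub_add_cancel_left, norm_neg] at h4
    have h5 : t * (F (x + y) - F x) ≤ (F (x + t • y) - F x) + κ / 2 * ((1 - t) * t) * ‖y‖ ^ 2 := by
      linarith
    have ht0 : t ≠ 0 := ht.1.ne'
    have h6 := mul_le_mul_of_nonneg_left h5 (inv_pos.2 ht.1).le
    have e2 : t⁻¹ * (t * (F (x + y) - F x)) = F (x + y) - F x := by field_simp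
    have e3 : t⁻¹ * ((F (x + t • y) - F x) + κ / 2 * ((1 - t) * t) * ‖y‖ ^ 2) =
        t⁻¹ * (F (x + t • y) - F x) + κ / 2 * (1 - t) * ‖y‖ ^ 2 := by field_simp
    linarith
  have := ge_of_tendsto h1 h3
  linarith

/-- Adding the first-order inequalities from `x` to `x + t • y` and back cancels the values of `F`
and bounds the difference quotient of the gradient. -/
theorem Semiconcave.inner_fderiv_grad_le {κ : ℝ} {F : E n → ℝ} (h : Semiconcave κ F)
    (hF : ContDiff ℝ 2 F) (x y : E n) : inner ℝ y (fderiv ℝ (grad F) x y) ≤ κ * ‖y‖ ^ 2 := by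
  have hFd : Differentiable ℝ F := hF.differentiable (by norm_num)
  have hG : DifferentiableAt ℝ (grad F) x :=
    ((contDiff_grad hF).differentiable one_ne_zero).differentiableAt
  have h1 : Tendsto (fun t : ℝ => inner ℝ y (t⁻¹ • (grad F (x + t • y) - grad F x)))
      (𝓝[>] 0) (𝓝 (inner ℝ y (fderiv ℝ (grad F) x y))) :=
    Tendsto.inner tendsto_const_nhds (hG.hasFDerivAt.hasLineDerivAt y).tendsto_slope_zero_right
  refine le_of_tendsto h1 ?_
  filter_upwards [self_mem_nhdsWithin] with t ht
  have ht' : 0 < t := ht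
  have h2 := h.le_add_fderiv x (t • y) (hFd x)
  have h3 := h.le_add_fderiv (x + t • y) (-(t • y)) (hFd _)
  rw [add_neg_cancel_right, norm_neg, map_neg] at h3
  rw [norm_smul, Real.norm_eq_abs, mul_pow, sq_abs] at h2 h3
  rw [← inner_grad, inner_smul_right, real_inner_comm] at h2 h3
  rw [inner_smul_right, inner_sub_right]
  have h4 : t * (inner ℝ y (grad F (x + t • y)) - inner ℝ y (grad F x)) ≤ t * (t * (κ * ‖y‖ ^ 2)) := by
    linarith
  have h5 := le_of_mul_le_mul_left h4 ht'
  rwa [inv_mul_le_iff₀ ht']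

/-- The horizontal part of the unit normal to the graph of `φ`. -/
noncomputable def unitField (φ : E n → ℝ) (x : E n) : E n := (√(1 + ‖grad φ x‖ ^ 2))⁻¹ • grad φ x

theorem sqrt_one_add_sq_pos (t : ℝ) : 0 < √(1 + t ^ 2) := Real.sqrt_pos.2 (by positivity)

theorem contDiff_sqrt_one_add_norm_grad {φ : E n → ℝ} (hφ : ContDiff ℝ 2 φ) :
    ContDiff ℝ 1 fun x => √(1 + ‖grad φ x‖ ^ 2) :=
  (contDiff_const.add ((contDiff_grad hφ).norm_sq ℝ)).sqrt fun x => by positivity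

theorem contDiff_unitField {φ : E n → ℝ} (hφ : ContDiff ℝ 2 φ) : ContDiff ℝ 1 (unitField φ) :=
  ((contDiff_sqrt_one_add_norm_grad hφ).inv fun _ => (sqrt_one_add_sq_pos _).ne').smul
    (contDiff_grad hφ)

theorem norm_unitField_sq_add (φ : E n → ℝ) (x : E n) :
    ‖unitField φ x‖ ^ 2 + (√(1 + ‖grad φ x‖ ^ 2))⁻¹ ^ 2 = 1 := by
  have h := sqrt_one_add_sq_pos ‖grad φ x‖
  have h2 : √(1 + ‖grad φ x‖ ^ 2) ^ 2 = 1 + ‖grad φ x‖ ^ 2 := Real.sq_sqrt (by positivity)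
  rw [unitField, norm_smul, mul_pow, Real.norm_eq_abs, sq_abs, inv_pow, h2]
  field_simp
  ring

theorem norm_unitField_le (φ : E n → ℝ) (x : E n) : ‖unitField φ x‖ ≤ 1 := by
  have := norm_unitField_sq_add φ x
  nlinarith [norm_nonneg (unitField φ x), sq_nonneg (√(1 + ‖grad φ x‖ ^ 2))⁻¹]

/-- After dividing by `k * exp φ`, the right side is `√(1 + ‖∇φ‖²)`, the norm of `(∇φ, 1)`, and the
left side is the product of `(-∇φ, 1)` with a vector `(p, q)` in the unit ball. -/
theorem unitField_calibration {φ : E n → ℝ} (hφ : ContDiff ℝ 2 φ) {k : ℝ} (hk : 0 ≤ k)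
    (x p : E n) {q : ℝ} (hpq : ‖p‖ ^ 2 + q ^ 2 ≤ 1) :
    k * Real.exp (φ x) * q - fderiv ℝ (fun x => k * Real.exp (φ x)) x p ≤
      k * Real.exp (φ x) * (√(1 + ‖grad φ x‖ ^ 2))⁻¹ +
        fderiv ℝ (fun x => k * Real.exp (φ x)) x (unitField φ x) := by
  have hd : DifferentiableAt ℝ φ x := (hφ.differentiable (by norm_num)) x
  have e : ∀ y, fderiv ℝ (fun x => k * Real.exp (φ x)) x y =
      k * Real.exp (φ x) * inner ℝ (grad φ x) y := fun y => by
    rw [fderiv_const_mul hd.exp, fderiv_exp hd, inner_grad]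
    simp [mul_assoc]
  rw [e, e, ← mul_sub, ← mul_add]
  refine mul_le_mul_of_nonneg_left ?_ (by positivity)
  set g := grad φ x
  have hW := sqrt_one_add_sq_pos ‖g‖
  have hW2 : √(1 + ‖g‖ ^ 2) ^ 2 = 1 + ‖g‖ ^ 2 := Real.sq_sqrt (by positivity)
  set W := √(1 + ‖g‖ ^ 2)
  have e1 : W⁻¹ + inner ℝ g (unitField φ x) = W := by
    have : unitField φ x = W⁻¹ • g := rfl
    rw [this, inner_smul_right, real_inner_self_eq_norm_sq]
    field_simp
    linarith
  rw [e1]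
  have h1 := neg_le_of_abs_le (abs_real_inner_le_norm g p)
  refine le_trans (b := q + ‖g‖ * ‖p‖) (by linarith) ?_
  refine abs_le_of_sq_le_sq' ?_ hW.le |>.2
  rw [hW2]
  nlinarith [sq_nonneg (‖p‖ - ‖g‖ * q), norm_nonneg g, norm_nonneg p]

theorem fderiv_unitField {φ : E n → ℝ} (hφ : ContDiff ℝ 2 φ) (x y : E n) :
    fderiv ℝ (unitField φ) x y = (√(1 + ‖grad φ x‖ ^ 2))⁻¹ • fderiv ℝ (grad φ) x y -
      ((√(1 + ‖grad φ x‖ ^ 2))⁻¹ ^ 3 * inner ℝ (grad φ x) (fderiv ℝ (grad φ) x y)) • grad φ x := by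
  have hG : HasFDerivAt (grad φ) (fderiv ℝ (grad φ) x) x :=
    ((contDiff_grad hφ).differentiable one_ne_zero x).hasFDerivAt
  have hW := sqrt_one_add_sq_pos ‖grad φ x‖
  have hq := (hG.norm_sq).const_add 1
  have hs := hq.sqrt (by positivity)
  have hi := (hasDerivAt_inv hW.ne').comp_hasFDerivAt x hs
  have h := (hi.smul hG).fderiv
  have e : unitField φ = (Inv.inv ∘ fun x => √(1 + ‖grad φ x‖ ^ 2)) • grad φ := rfl
  rw [e, h]
  simp only [add_apply, smul_apply,
    ContinuousLinearMap.smulRight_apply, Function.comp_apply, ContinuousLinearMap.comp_apply,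
    smul_eq_mul, innerSL_apply_apply, sub_eq_add_neg, ← neg_smul]
  congr 2
  simp only [nsmul_eq_mul]
  field_simp
  try norm_num

/-- With `H` the Hessian, `g` the gradient and `W = √(1 + ‖g‖²)`, the divergence is `W⁻¹ tr (P H
P)`, where `P = I - s g ⊗ g` is the inverse square root of `I + g ⊗ g`. The columns of `P` have
length at most `1`, so each diagonal term is at most `κ`. No lower bound for `H` and no bound for
`g` is needed. -/
theorem divg_unitField_le {φ : E n → ℝ} (hφ : ContDiff ℝ 2 φ) {κ : ℝ} (hκ : 0 ≤ κ)
    (h : Semiconcave κ φ) (x : E n) : divg (unitField φ) x ≤ κ * n := by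
  set H := fderiv ℝ (grad φ) x with hH
  set g := grad φ x with hg
  have hW := sqrt_one_add_sq_pos ‖g‖
  have hW2 : √(1 + ‖g‖ ^ 2) ^ 2 = 1 + ‖g‖ ^ 2 := Real.sq_sqrt (by positivity)
  set W := √(1 + ‖g‖ ^ 2) with hWdef
  have hW1 : 1 ≤ W := by nlinarith [sq_nonneg ‖g‖]
  -- With this `s`, the operator `P` has eigenvalue `1 / W` on `g` and `1` on its orthogonal
  -- complement, so that `P² = I - W⁻² g ⊗ g`.
  set s : ℝ := (W * (W + 1))⁻¹ with hs
  set b : Fin n → E n := fun i => EuclideanSpace.single i 1 with hb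
  have hgb : g = ∑ i, g i • b i := by
    have := (EuclideanSpace.basisFun (Fin n) ℝ).sum_repr g
    simpa [hb] using this.symm
  have hin : ∀ (y : E n) i, inner ℝ (b i) y = y i := fun y i => by
    simp [hb, EuclideanSpace.inner_single_left]
  have key : ∀ i, inner ℝ (b i - (s * g i) • g) (H (b i - (s * g i) • g)) =
      (H (b i)) i - s * (g i * inner ℝ g (H (b i))) - s * (g i * (H g) i) +
        s ^ 2 * (g i) ^ 2 * inner ℝ g (H g) := by
    intro i
    rw [map_sub, map_smul, inner_sub_left, inner_sub_right, inner_sub_right, inner_smul_left,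
      inner_smul_left, inner_smul_right, inner_smul_right, hin, hin]
    simp only [conj_trivial]
    ring
  have hsum1 : ∑ i, g i * inner ℝ g (H (b i)) = inner ℝ g (H g) := by
    conv_rhs => rw [hgb]
    rw [map_sum, ← hgb, inner_sum]
    refine Finset.sum_congr rfl fun i _ => ?_
    rw [map_smul, inner_smul_right]
  have hsum2 : ∑ i, g i * (H g) i = inner ℝ g (H g) := by
    rw [PiLp.inner_apply]
    refine Finset.sum_congr rfl fun i _ => ?_
    simp [mul_comm]
  have hsum3 : ∑ i, (g i) ^ 2 = ‖g‖ ^ 2 := (EuclideanSpace.real_norm_sq_eq g).symm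
  have htot : ∑ i, inner ℝ (b i - (s * g i) • g) (H (b i - (s * g i) • g)) =
      ∑ i, (H (b i)) i - W⁻¹ ^ 2 * inner ℝ g (H g) := by
    simp only [key]
    rw [Finset.sum_add_distrib, Finset.sum_sub_distrib, Finset.sum_sub_distrib, ← Finset.mul_sum,
      ← Finset.mul_sum, hsum1, hsum2, ← Finset.sum_mul, ← Finset.mul_sum, hsum3]
    have e : ‖g‖ ^ 2 = (W - 1) * (W + 1) := by linarith
    have e2 : s + s - s ^ 2 * ‖g‖ ^ 2 = W⁻¹ ^ 2 := by
      rw [e, hs]; field_simp; ring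
    rw [← e2]; ring
  have hle : ∀ i, inner ℝ (b i - (s * g i) • g) (H (b i - (s * g i) • g)) ≤ κ := by
    intro i
    refine (h.inner_fderiv_grad_le hφ x _).trans ?_
    refine (mul_le_mul_of_nonneg_left ?_ hκ).trans_eq (mul_one κ)
    have e1 : ‖b i‖ = 1 := by simp [hb]
    rw [norm_sub_sq_real, inner_smul_right, hin, norm_smul, e1, mul_pow, Real.norm_eq_abs, sq_abs]
    have e : ‖g‖ ^ 2 = (W - 1) * (W + 1) := by linarith
    have e2 : s ^ 2 * ‖g‖ ^ 2 ≤ 2 * s := by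
      rw [e, hs]
      have : (W * (W + 1))⁻¹ ^ 2 * ((W - 1) * (W + 1)) = (W * (W + 1))⁻¹ * ((W - 1) / W) := by
        field_simp
      rw [this, mul_comm]
      refine mul_le_mul_of_nonneg_right ?_ (by positivity)
      rw [div_le_iff₀ hW]; linarith
    nlinarith [sq_nonneg (g i)]
  have hdiv : divg (unitField φ) x = W⁻¹ * ∑ i, inner ℝ (b i - (s * g i) • g)
      (H (b i - (s * g i) • g)) := by
    rw [htot, divg]
    have e3 : ∀ i, fderiv ℝ (unitField φ) x (EuclideanSpace.single i 1) i =
        W⁻¹ * (H (b i)) i - W⁻¹ ^ 3 * (g i * inner ℝ g (H (b i))) := by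
      intro i
      rw [fderiv_unitField hφ]
      simp [hWdef, hg, hH, hb]
      ring
    simp only [e3]
    rw [Finset.sum_sub_distrib, ← Finset.mul_sum, ← Finset.mul_sum, hsum1]
    ring
  rw [hdiv]
  have h1 : ∑ i, inner ℝ (b i - (s * g i) • g) (H (b i - (s * g i) • g)) ≤ κ * n := by
    refine (Finset.sum_le_sum fun i _ => hle i).trans_eq ?_
    simp [mul_comm]
  have h2 : W⁻¹ ≤ 1 := inv_le_one_of_one_le₀ hW1
  have h3 : 0 ≤ W⁻¹ := by positivity
  have h4 : 0 ≤ κ * n := by positivity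
  nlinarith

end Capillary

/-! ### The squared distance to the centres of interior balls -/

namespace Capillary

variable {n : ℕ}

/-- The centres of the balls of radius `R` that are contained in `Ω`. -/
def centers (Ω : Set (E n)) (R : ℝ) : Set (E n) := {c | Metric.ball c R ⊆ Ω}

theorem isClosed_centers (Ω : Set (E n)) (R : ℝ) : IsClosed (centers Ω R) := by
  refine isClosed_of_closure_subset fun c hc x hx => ?_
  obtain ⟨c', hc', hd⟩ := Metric.mem_closure_iff.1 hc (R - dist x c) (by
    have : dist x c < R := hx
    linarith)
  refine hc' ?_
  have := dist_triangle x c c'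
  rw [Metric.mem_ball]
  linarith

/-- A centre at distance less than `R` would put the boundary point inside an open ball contained in
`Ω`. -/
theorem InteriorSphereCondition.infDist_eq {Ω : Set (E n)} {R : ℝ} (h : InteriorSphereCondition Ω R)
    (hΩ : IsOpen Ω) {x : E n} (hx : x ∈ frontier Ω) : Metric.infDist x (centers Ω R) = R := by
  obtain ⟨c, hc, hd⟩ := h x hx
  refine le_antisymm ((Metric.infDist_le_dist_of_mem hc).trans hd.le) ?_
  refine (Metric.le_infDist ⟨c, hc⟩).2 fun c' hc' => ?_
  by_contra hlt
  have : x ∈ Ω := hc' (not_le.1 hlt)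
  rw [hΩ.frontier_eq] at hx
  exact hx.2 this

/-- The squared distance to the set of centres. -/
noncomputable def sqDist (Ω : Set (E n)) (R : ℝ) (x : E n) : ℝ := Metric.infDist x (centers Ω R) ^ 2

theorem continuous_sqDist (Ω : Set (E n)) (R : ℝ) : Continuous (sqDist Ω R) :=
  (Metric.continuous_infDist_pt _).pow 2

theorem sqDist_le_add (Ω : Set (E n)) (R : ℝ) (x h : E n) :
    sqDist Ω R x ≤ sqDist Ω R (x - h) + 2 * Metric.infDist x (centers Ω R) * ‖h‖ := by
  have h1 := Metric.infDist_le_infDist_add_dist (s := centers Ω R) (x := x) (y := x - h)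
  rw [dist_eq_norm, sub_sub_cancel] at h1
  have h2 := Metric.infDist_nonneg (x := x) (s := centers Ω R)
  have h3 := Metric.infDist_nonneg (x := x - h) (s := centers Ω R)
  simp only [sqDist]
  rcases le_or_gt (Metric.infDist x (centers Ω R)) (Metric.infDist (x - h) (centers Ω R)) with h4 | h4
  · nlinarith [norm_nonneg h]
  · nlinarith [norm_nonneg h]

theorem mollify_comp_sub (φ : ContDiffBump (0 : E n)) (f : E n → ℝ) (x h : E n) :
    mollify φ (fun y => f (y - h)) x = mollify φ f (x - h) := by
  simp only [mollify_apply, sub_right_comm]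

/-- The mollified squared distance. -/
noncomputable def smoothSqDist (Ω : Set (E n)) (R : ℝ) (j : ℕ) : E n → ℝ :=
  mollify (bumpSeq n j) (sqDist Ω R)

theorem contDiff_smoothSqDist (Ω : Set (E n)) (R : ℝ) (j : ℕ) :
    ContDiff ℝ 2 (smoothSqDist Ω R j) :=
  contDiff_mollify _ (continuous_sqDist Ω R).locallyIntegrable 2

theorem semiconcave_smoothSqDist {Ω : Set (E n)} {R : ℝ} (hne : (centers Ω R).Nonempty) (j : ℕ) :
    Semiconcave 2 (smoothSqDist Ω R j) :=
  (semiconcave_infDist_sq (isClosed_centers Ω R) hne).mollify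
    (continuous_sqDist Ω R).locallyIntegrable _

theorem smoothSqDist_nonneg (Ω : Set (E n)) (R : ℝ) (j : ℕ) (x : E n) :
    0 ≤ smoothSqDist Ω R j x := by
  rw [smoothSqDist, mollify_apply]
  exact integral_nonneg fun t => mul_nonneg ((bumpSeq n j).nonneg_normed t) (sq_nonneg _)

theorem tendsto_smoothSqDist (Ω : Set (E n)) (R : ℝ) (x : E n) :
    Tendsto (fun j => smoothSqDist Ω R j x) atTop (𝓝 (sqDist Ω R x)) :=
  ContDiffBump.convolution_tendsto_right_of_continuous (tendsto_bumpSeq_rOut n)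
    (continuous_sqDist Ω R) x

theorem bumpSeq_rOut_le_one (j : ℕ) : (bumpSeq n j).rOut ≤ 1 := by
  have : (bumpSeq n j).rOut = 1 / ((j : ℝ) + 1) := rfl
  rw [this, div_le_one (by positivity)]
  linarith [(Nat.cast_nonneg j : (0 : ℝ) ≤ j)]

theorem exists_smoothSqDist_le {Ω : Set (E n)} {R : ℝ} (hb : Bornology.IsBounded Ω)
    (hne : (centers Ω R).Nonempty) : ∃ M, ∀ j, ∀ x ∈ Ω, smoothSqDist Ω R j x ≤ M := by
  obtain ⟨c, hc⟩ := hne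
  obtain ⟨ρ, hρ⟩ := hb.subset_closedBall c
  refine ⟨(ρ + 1) ^ 2, fun j x hx => ?_⟩
  rw [← mollify_const (bumpSeq n j) ((ρ + 1) ^ 2) x]
  refine mollify_mono _ (continuous_sqDist Ω R).locallyIntegrable
    continuous_const.locallyIntegrable fun y hy => ?_
  have h1 : dist x c ≤ ρ := hρ hx
  have h2 : dist y x < (bumpSeq n j).rOut := hy
  have h3 := bumpSeq_rOut_le_one (n := n) j
  have h4 := dist_triangle y x c
  exact pow_le_pow_left₀ Metric.infDist_nonneg
    ((Metric.infDist_le_dist_of_mem hc).trans (by linarith)) 2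

/-- Along a step against the gradient, semiconcavity forces a decrease of order `t * ‖g‖²`, whereas
the Lipschitz bound for the distance allows only `2 * (d + ε) * t * ‖g‖`. The radius `ε` enters
because mollification sees nearby points. -/
theorem norm_grad_smoothSqDist_le {Ω : Set (E n)} {R : ℝ}
    (hne : (centers Ω R).Nonempty) (j : ℕ) (x : E n) :
    ‖grad (smoothSqDist Ω R j) x‖ ≤ 2 * (Metric.infDist x (centers Ω R) + (bumpSeq n j).rOut) := by
  set F := smoothSqDist Ω R j with hF
  set d := Metric.infDist x (centers Ω R)
  set ε := (bumpSeq n j).rOut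
  have hFd : DifferentiableAt ℝ F x := (contDiff_smoothSqDist Ω R j).differentiable (by norm_num) x
  have hLI := (continuous_sqDist Ω R).locallyIntegrable (μ := (volume : Measure (E n)))
  set g := grad F x with hg
  have step : ∀ t : ℝ, 0 < t → ‖g‖ * (t * ‖g‖) ≤ 2 * (d + ε) * (t * ‖g‖) + (t * ‖g‖) ^ 2 := by
    intro t ht
    have h1 := (semiconcave_smoothSqDist hne j).le_add_fderiv x (-(t • g)) hFd
    rw [← inner_grad, inner_neg_right, inner_smul_right, real_inner_self_eq_norm_sq, norm_neg,
      norm_smul, Real.norm_eq_abs, abs_of_pos ht, ← sub_eq_add_neg] at h1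
    have h2 : F x ≤ F (x - t • g) + 2 * (d + ε) * (t * ‖g‖) := by
      rw [hF, smoothSqDist, ← mollify_comp_sub, ← mollify_const (bumpSeq n j)
        (2 * (d + ε) * (t * ‖g‖)) x, ← mollify_add]
      · refine mollify_mono _ hLI ?_ fun y hy => ?_
        · have : Continuous fun y => sqDist Ω R (y - t • g) + 2 * (d + ε) * (t * ‖g‖) := by
            have := continuous_sqDist Ω R
            fun_prop
          exact this.locallyIntegrable
        · refine (sqDist_le_add Ω R y (t • g)).trans ?_
          rw [norm_smul, Real.norm_eq_abs, abs_of_pos ht]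
          have h3 : Metric.infDist y (centers Ω R) ≤ d + ε :=
            Metric.infDist_le_infDist_add_dist.trans (add_le_add_right (le_of_lt hy) _)
          have : 0 ≤ t * ‖g‖ := by positivity
          nlinarith
      · have : Continuous fun y => sqDist Ω R (y - t • g) := by
          have := continuous_sqDist Ω R
          fun_prop
        exact this.locallyIntegrable
      · exact continuous_const.locallyIntegrable
    have h3 : F (x - t • g) ≤ F x + -(t * ‖g‖ ^ 2) + 2 / 2 * (t * ‖g‖) ^ 2 := h1
    nlinarith
  rcases (norm_nonneg g).eq_or_lt with h0 | h0
  · rw [← h0]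
    have := Metric.infDist_nonneg (x := x) (s := centers Ω R)
    have := (bumpSeq n j).rOut_pos
    positivity
  · refine le_of_forall_pos_le_add fun δ hδ => ?_
    have h1 := step (δ / ‖g‖) (by positivity)
    rw [div_mul_cancel₀ _ h0.ne'] at h1
    nlinarith

namespace GraphChart

variable {m : ℕ} {G : GraphChart m} {Ω : Set (E (m + 1))} {x₀ : E (m + 1)} {r R : ℝ}

/-- The inward normal to the graph, whose norm is the area density. -/
noncomputable def conormal (G : GraphChart m) (y : E m) : E (m + 1) := G.e - G.ι (grad G.p y)

theorem inner_conormal (y a : E m) (s : ℝ) :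
    inner ℝ (G.ι a + s • G.e) (G.conormal y) = s - fderiv ℝ G.p y a := by
  have h := G.inner_add_smul a (-grad G.p y) s 1
  rw [map_neg, one_smul, inner_neg_right, mul_one, real_inner_comm (grad G.p y), inner_grad] at h
  rw [conormal, sub_eq_neg_add, h]
  ring

theorem norm_conormal (y : E m) : ‖G.conormal y‖ = G.jac y := by
  have h := G.norm_add_smul_sq (-grad G.p y) 1
  rw [map_neg, one_smul, norm_neg, norm_grad] at h
  rw [conormal, sub_eq_neg_add, jac, ← Real.sqrt_sq (norm_nonneg _), h]
  ring_nf

/-- An interior ball touching the boundary at a point where the graph is differentiable is centred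
on the inward normal. -/
theorem IsChartOf.center_eq (hG : G.IsChartOf Ω x₀ r) {y : E m}
    (hy : G.graph y ∈ Metric.ball x₀ r) (hp : DifferentiableAt ℝ G.p y) (hR : 0 < R)
    {c : E (m + 1)} (hc : Metric.ball c R ⊆ Ω) (hd : dist (G.graph y) c = R) :
    G.jac y • (c - G.graph y) = R • G.conormal y := by
  set q := G.conormal y
  set w := c - G.graph y with hw
  have hq : ‖q‖ = G.jac y := G.norm_conormal y
  have hq1 := G.one_le_jac y
  have hwR : ‖w‖ = R := by rw [hw, ← dist_eq_norm, dist_comm, hd]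
  -- A direction with positive product with `w` enters the ball, hence `Ω`, hence points above the
  -- tangent plane of the graph.
  have claim : ∀ τ : E (m + 1), 0 < (inner ℝ τ w : ℝ) → 0 ≤ (inner ℝ τ q : ℝ) := by
    intro τ hτ
    obtain ⟨z, rfl⟩ := G.iso.surjective τ
    obtain ⟨a, s⟩ := z
    change 0 < inner ℝ (G.ι a + s • G.e) w at hτ
    change 0 ≤ inner ℝ (G.ι a + s • G.e) q
    set τ := G.ι a + s • G.e with hτdef
    rw [hτdef, G.inner_conormal]
    have hlim := (hp.hasFDerivAt.hasLineDerivAt a).tendsto_slope_zero_right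
    have hcont : Continuous fun t : ℝ => G.graph y + t • τ := by fun_prop
    have hnear : ∀ᶠ t in 𝓝[>] (0 : ℝ), G.graph y + t • τ ∈ Metric.ball x₀ r := by
      refine nhdsWithin_le_nhds (hcont.continuousAt.eventually_mem ?_)
      simpa using Metric.isOpen_ball.mem_nhds hy
    have hsmall : ∀ᶠ t in 𝓝[>] (0 : ℝ), t * ‖τ‖ ^ 2 < 2 * inner ℝ τ w := by
      have : Continuous fun t : ℝ => t * ‖τ‖ ^ 2 := by fun_prop
      refine nhdsWithin_le_nhds (this.continuousAt.eventually_lt continuousAt_const ?_)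
      simpa using hτ
    have hev : ∀ᶠ t in 𝓝[>] (0 : ℝ), t⁻¹ • (G.p (y + t • a) - G.p y) ≤ s := by
      filter_upwards [hnear, hsmall, self_mem_nhdsWithin] with t h1 h2 ht
      have ht0 : 0 < t := ht
      have e : G.graph y + t • τ = G.flat (y + t • a, G.p y + t * s - G.p (y + t • a)) := by
        simp only [graph, flat, hτdef, map_add, map_smul]
        module
      have hball : G.graph y + t • τ ∈ Metric.ball c R := by
        rw [Metric.mem_ball, dist_eq_norm]
        have e2 : G.graph y + t • τ - c = t • τ - w := by rw [hw]; abel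
        rw [e2]
        refine lt_of_pow_lt_pow_left₀ 2 hR.le ?_
        rw [norm_sub_sq_real, hwR, norm_smul, mul_pow, Real.norm_eq_abs, sq_abs, inner_smul_left,
          conj_trivial]
        nlinarith
      have h3 := hc hball
      rw [e] at h1 h3
      have h4 := (hG _ h1).1 h3
      simp only at h4
      rw [smul_eq_mul, inv_mul_le_iff₀ ht0]
      linarith
    linarith [le_of_tendsto hlim hev]
  by_contra hne
  -- If the two vectors differed, their difference would be a direction entering the ball but
  -- pointing strictly below the tangent plane.
  have hτ : ‖G.jac y • w - R • q‖ ^ 2 = 2 * R * ‖q‖ * (R * ‖q‖ - inner ℝ w q) := by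
    rw [norm_sub_sq_real, norm_smul, norm_smul, inner_smul_left, inner_smul_right, hwR, ← hq,
      Real.norm_eq_abs, Real.norm_eq_abs, abs_of_pos hR, abs_of_nonneg (norm_nonneg q)]
    simp only [conj_trivial]
    ring
  have hpos : 0 < ‖G.jac y • w - R • q‖ ^ 2 := by
    have := norm_pos_iff.2 (sub_ne_zero.2 hne)
    positivity
  have hq0 : 0 < ‖q‖ := by rw [hq]; linarith
  have h1 : 0 < R * ‖q‖ - inner ℝ w q := by
    rw [hτ] at hpos
    exact pos_of_mul_pos_right hpos (by positivity)
  have h2 : 0 < (inner ℝ (G.jac y • w - R • q) w : ℝ) := by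
    rw [inner_sub_left, inner_smul_left, inner_smul_left, real_inner_self_eq_norm_sq, hwR,
      real_inner_comm, ← hq]
    simp only [conj_trivial]
    nlinarith
  have h3 := claim _ h2
  rw [inner_sub_left, inner_smul_left, inner_smul_left, real_inner_self_eq_norm_sq, ← hq] at h3
  simp only [conj_trivial] at h3
  nlinarith

/-- By compactness, the centres within distance `R + 1` that violate the estimate have a minimal
distance from the boundary point; it exceeds `R`, since a centre at distance exactly `R` lies on the
normal. -/
theorem IsChartOf.exists_inner_center_ge (hG : G.IsChartOf Ω x₀ r) {y : E m}
    (hy : G.graph y ∈ Metric.ball x₀ r) (hp : DifferentiableAt ℝ G.p y) (hR : 0 < R)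
    {η : ℝ} (hη : 0 < η) : ∃ δ > 0, ∀ c ∈ centers Ω R, dist (G.graph y) c ≤ R + δ →
      R * G.jac y - η < inner ℝ (c - G.graph y) (G.conormal y) := by
  set x := G.graph y with hx
  set S := centers Ω R ∩ Metric.closedBall x (R + 1) ∩
    {c | (inner ℝ (c - x) (G.conormal y) : ℝ) ≤ R * G.jac y - η} with hS
  have hScpt : IsCompact S := by
    refine ((isCompact_closedBall x (R + 1)).inter_left (isClosed_centers Ω R)).inter_right ?_
    exact isClosed_le (by fun_prop) continuous_const
  have hxΩ : x ∉ Ω := hG.graph_notMem hy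
  rcases S.eq_empty_or_nonempty with h0 | h0
  · refine ⟨1, one_pos, fun c hc hd => ?_⟩
    by_contra hcon
    have : c ∈ S := ⟨⟨hc, by rwa [Metric.mem_closedBall, dist_comm]⟩, not_lt.1 hcon⟩
    rw [h0] at this
    exact this
  · obtain ⟨c₁, hc₁, hmin⟩ := hScpt.exists_isMinOn h0
      (f := fun c => dist x c) (by fun_prop)
    have h1 : R ≤ dist x c₁ := by
      by_contra hlt
      exact hxΩ (hc₁.1.1 (not_le.1 hlt))
    have h2 : R < dist x c₁ := by
      refine lt_of_le_of_ne h1 fun heq => ?_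
      have h3 := hG.center_eq hy hp hR hc₁.1.1 heq.symm
      have h4 : (inner ℝ (c₁ - x) (G.conormal y) : ℝ) ≤ R * G.jac y - η := hc₁.2
      have h5 : G.jac y * inner ℝ (c₁ - x) (G.conormal y) = R * G.jac y ^ 2 := by
        have : (inner ℝ (G.jac y • (c₁ - x)) (G.conormal y) : ℝ) =
          inner ℝ (R • G.conormal y) (G.conormal y) := by rw [h3]
        rw [inner_smul_left, inner_smul_left, real_inner_self_eq_norm_sq, G.norm_conormal] at this
        simpa using this
      have := G.one_le_jac y
      nlinarith
    refine ⟨min 1 ((dist x c₁ - R) / 2), lt_min one_pos (by linarith), fun c hc hd => ?_⟩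
    by_contra hcon
    have hcS : c ∈ S := ⟨⟨hc, by
      rw [Metric.mem_closedBall, dist_comm]
      exact hd.trans (by linarith [min_le_left (1 : ℝ) ((dist x c₁ - R) / 2)])⟩, not_lt.1 hcon⟩
    have h3 : dist x c₁ ≤ dist x c := hmin hcS
    linarith [min_le_right (1 : ℝ) ((dist x c₁ - R) / 2)]

/-- Semiconcavity bounds the normal derivative from above by a difference quotient taken with an
outward step. This passes to the limit of the mollifications and is then evaluated with a nearest
centre. The norm bound gives the matching lower bound by Cauchy-Schwarz, and the limit of the norms
follows by squeezing. -/
theorem IsChartOf.tendsto_inner_grad_smoothSqDist (hG : G.IsChartOf Ω x₀ r) (hΩ : IsOpen Ω)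
    (hsph : InteriorSphereCondition Ω R) {y : E m}
    (hy : G.graph y ∈ Metric.ball x₀ r) (hp : DifferentiableAt ℝ G.p y) (hR : 0 < R) :
    Tendsto (fun j => inner ℝ (grad (smoothSqDist Ω R j) (G.graph y)) (G.conormal y)) atTop
      (𝓝 (-(2 * R * G.jac y))) ∧
    Tendsto (fun j => ‖grad (smoothSqDist Ω R j) (G.graph y)‖) atTop (𝓝 (2 * R)) := by
  set x := G.graph y with hx
  set q := G.conormal y with hq
  have hJ1 := G.one_le_jac y
  have hqJ : ‖q‖ = G.jac y := G.norm_conormal y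
  have hxf : x ∈ frontier Ω := hG.graph_mem_frontier hy
  have hne : (centers Ω R).Nonempty := by
    obtain ⟨c, hc, -⟩ := hsph x hxf
    exact ⟨c, hc⟩
  have hd : Metric.infDist x (centers Ω R) = R := hsph.infDist_eq hΩ hxf
  have hDx : sqDist Ω R x = R ^ 2 := by rw [sqDist, hd]
  have upper : ∀ η > 0, ∀ᶠ j in atTop,
      inner ℝ (grad (smoothSqDist Ω R j) x) q < -(2 * R * G.jac y) + η := by
    intro η hη
    obtain ⟨δ, hδ, hc⟩ := hG.exists_inner_center_ge hy hp hR (η := η / 4) (by positivity)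
    -- The first condition keeps a centre nearest to `x - t • q` within `R + δ` of `x`, moving there
    -- and back costing `2 * t * ‖q‖`. The second makes the quadratic error of semiconcavity small.
    obtain ⟨t, ht0, ht1, ht2⟩ : ∃ t : ℝ, 0 < t ∧ t * ‖q‖ * 2 ≤ δ ∧ t * ‖q‖ ^ 2 < η / 4 := by
      refine ⟨min (δ / (2 * ‖q‖)) (η / (8 * ‖q‖ ^ 2)), ?_, ?_, ?_⟩
      · have : 0 < ‖q‖ := by rw [hqJ]; linarith
        positivity
      · have h0 : 0 < ‖q‖ := by rw [hqJ]; linarith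
        have := min_le_left (δ / (2 * ‖q‖)) (η / (8 * ‖q‖ ^ 2))
        rw [le_div_iff₀ (by positivity)] at this
        linarith
      · have h0 : 0 < ‖q‖ := by rw [hqJ]; linarith
        have := min_le_right (δ / (2 * ‖q‖)) (η / (8 * ‖q‖ ^ 2))
        rw [le_div_iff₀ (by positivity)] at this
        linarith
    have hlow : R ^ 2 + 2 * t * (R * G.jac y - η / 4) ≤ sqDist Ω R (x - t • q) := by
      obtain ⟨c, hcC, hcd⟩ := (isClosed_centers Ω R).exists_infDist_eq_dist hne (x - t • q)
      have e1 : dist x (x - t • q) = t * ‖q‖ := by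
        rw [dist_eq_norm, sub_sub_cancel, norm_smul, Real.norm_eq_abs, abs_of_pos ht0]
      have h1 : Metric.infDist (x - t • q) (centers Ω R) ≤ R + t * ‖q‖ := by
        have h := Metric.infDist_le_infDist_add_dist (s := centers Ω R) (x := x - t • q) (y := x)
        rwa [hd, dist_comm, e1] at h
      have h2 : dist x c ≤ R + δ := by
        have := dist_triangle x (x - t • q) c
        rw [e1, ← hcd] at this
        linarith
      have h3 := hc c hcC h2
      have h4 : R ≤ dist x c := by exact hd.ge.trans (Metric.infDist_le_dist_of_mem hcC)
      rw [sqDist, hcd, dist_eq_norm]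
      have e2 : x - t • q - c = (x - c) - t • q := by abel
      rw [e2, norm_sub_sq_real, inner_smul_right, ← dist_eq_norm]
      have e3 : (inner ℝ (x - c) q : ℝ) = -inner ℝ (c - x) q := by
        rw [← inner_neg_left, neg_sub]
      rw [e3]
      nlinarith [sq_nonneg ‖t • q‖]
    have hlim : Tendsto (fun j => t * ‖q‖ ^ 2 - (smoothSqDist Ω R j (x - t • q) -
        smoothSqDist Ω R j x) / t) atTop
        (𝓝 (t * ‖q‖ ^ 2 - (sqDist Ω R (x - t • q) - sqDist Ω R x) / t)) :=
      tendsto_const_nhds.sub (((tendsto_smoothSqDist Ω R _).sub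
        (tendsto_smoothSqDist Ω R _)).div_const t)
    have hlt : t * ‖q‖ ^ 2 - (sqDist Ω R (x - t • q) - sqDist Ω R x) / t <
        -(2 * R * G.jac y) + η := by
      have : 2 * (R * G.jac y - η / 4) ≤ (sqDist Ω R (x - t • q) - sqDist Ω R x) / t := by
        rw [le_div_iff₀ ht0, hDx]; linarith
      linarith
    filter_upwards [hlim.eventually_lt_const hlt] with j hj
    refine lt_of_le_of_lt ?_ hj
    have h1 := (semiconcave_smoothSqDist hne j).le_add_fderiv x (-(t • q))
      ((contDiff_smoothSqDist Ω R j).differentiable (by norm_num) x)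
    rw [← inner_grad, inner_neg_right, inner_smul_right, norm_neg, norm_smul, Real.norm_eq_abs,
      abs_of_pos ht0, ← sub_eq_add_neg] at h1
    have h2 : (smoothSqDist Ω R j (x - t • q) - smoothSqDist Ω R j x) / t ≤
        t * ‖q‖ ^ 2 - inner ℝ (grad (smoothSqDist Ω R j) x) q := by
      rw [div_le_iff₀ ht0]
      nlinarith
    linarith
  have hε := tendsto_bumpSeq_rOut (m + 1)
  have hgle : ∀ j, ‖grad (smoothSqDist Ω R j) x‖ ≤ 2 * (R + (bumpSeq (m + 1) j).rOut) := fun j => by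
    have := norm_grad_smoothSqDist_le hne j x
    rwa [hd] at this
  have hlim1 : Tendsto (fun j => 2 * (R + (bumpSeq (m + 1) j).rOut)) atTop (𝓝 (2 * R)) := by
    simpa using (hε.const_add R).const_mul 2
  have lower : ∀ j, -(2 * (R + (bumpSeq (m + 1) j).rOut)) * G.jac y ≤
      inner ℝ (grad (smoothSqDist Ω R j) x) q := fun j => by
    have h1 := neg_le_of_abs_le (abs_real_inner_le_norm (grad (smoothSqDist Ω R j) x) q)
    rw [hqJ] at h1
    nlinarith [hgle j]
  have T1 : Tendsto (fun j => inner ℝ (grad (smoothSqDist Ω R j) x) q) atTop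
      (𝓝 (-(2 * R * G.jac y))) := by
    refine tendsto_order.2 ⟨fun b hb => ?_, fun b hb => ?_⟩
    · have h1 : Tendsto (fun j => -(2 * (R + (bumpSeq (m + 1) j).rOut)) * G.jac y) atTop
          (𝓝 (-(2 * R * G.jac y))) := by
        simpa using hlim1.neg.mul_const (G.jac y)
      filter_upwards [h1.eventually_const_lt hb] with j hj using hj.trans_le (lower j)
    · filter_upwards [upper (b + 2 * R * G.jac y) (by linarith)] with j hj
      linarith
  refine ⟨T1, ?_⟩
  refine tendsto_of_tendsto_of_tendsto_of_le_of_le (g := fun j =>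
    -(inner ℝ (grad (smoothSqDist Ω R j) x) q) / G.jac y) ?_ hlim1 (fun j => ?_) hgle
  · have := T1.neg.div_const (G.jac y)
    rw [neg_neg, mul_div_assoc, div_self (by positivity), mul_one] at this
    exact this
  · rw [div_le_iff₀ (by positivity), ← hqJ]
    exact neg_le.1 (neg_le_of_abs_le (abs_real_inner_le_norm _ q))

end GraphChart

end Capillary

/-! ### Atlas of the boundary and cutoff functions -/

namespace Capillary

namespace GraphChart

variable {m : ℕ} (G : GraphChart m)

/-- The projection to the hyperplane. -/
noncomputable def proj : E (m + 1) →L[ℝ] E m := G.ι.toContinuousLinearMap.adjoint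

/-- The height above the graph. -/
noncomputable def height (x : E (m + 1)) : ℝ := inner ℝ G.e x - G.p (G.proj x)

theorem inner_proj (x : E (m + 1)) (y : E m) : inner ℝ (G.proj x) y = (inner ℝ x (G.ι y) : ℝ) :=
  ContinuousLinearMap.adjoint_inner_left _ y x

theorem proj_flat (z : E m × ℝ) : G.proj (G.flat z) = z.1 := by
  refine ext_inner_right ℝ fun y => ?_
  rw [inner_proj, flat, inner_add_left, inner_smul_left, G.inner_e, LinearIsometry.inner_map_map,
    mul_zero, add_zero]

theorem inner_e_flat (z : E m × ℝ) : inner ℝ G.e (G.flat z) = G.p z.1 + z.2 := by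
  rw [flat, inner_add_right, inner_smul_right, G.inner_e, real_inner_self_eq_norm_sq, G.norm_e]
  ring

theorem height_flat (z : E m × ℝ) : G.height (G.flat z) = z.2 := by
  rw [height, inner_e_flat, proj_flat, add_sub_cancel_left]

theorem flat_proj_height (x : E (m + 1)) : G.flat (G.proj x, G.height x) = x := by
  obtain ⟨z, rfl⟩ := G.flatHomeo.surjective x
  rw [flatHomeo_apply, proj_flat, height_flat]

theorem norm_proj_le (x : E (m + 1)) : ‖G.proj x‖ ≤ ‖x‖ := by
  have h := G.inner_proj x (G.proj x)
  rw [real_inner_self_eq_norm_sq] at h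
  have h2 := real_inner_le_norm x (G.ι (G.proj x))
  rw [LinearIsometry.norm_map] at h2
  by_contra hcon
  nlinarith [norm_nonneg x]

theorem lipschitz_height : LipschitzWith (1 + G.K) G.height := by
  refine LipschitzWith.of_dist_le_mul fun x y => ?_
  have h1 := G.lipschitz.dist_le_mul (G.proj x) (G.proj y)
  have h2 := G.norm_proj_le (x - y)
  have h3 := abs_real_inner_le_norm G.e (x - y)
  rw [G.norm_e, one_mul, inner_sub_right] at h3
  rw [map_sub, ← dist_eq_norm, ← dist_eq_norm] at h2
  have e : G.height x - G.height y = (inner ℝ G.e x - inner ℝ G.e y) -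
    (G.p (G.proj x) - G.p (G.proj y)) := by simp only [height]; ring
  rw [Real.dist_eq] at h1
  rw [Real.dist_eq, e]
  refine (abs_sub _ _).trans ?_
  rw [← dist_eq_norm] at h3
  push_cast
  nlinarith [G.K.coe_nonneg]

theorem hasFDerivAt_height {x : E (m + 1)} (hp : DifferentiableAt ℝ G.p (G.proj x)) :
    HasFDerivAt G.height (innerSL ℝ (G.conormal (G.proj x))) x := by
  have h1 : HasFDerivAt (fun x => (inner ℝ G.e x : ℝ)) (innerSL ℝ G.e) x :=
    (innerSL ℝ G.e).hasFDerivAt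
  have h2 := hp.hasFDerivAt.comp x G.proj.hasFDerivAt
  refine (h1.sub h2).congr_fderiv ?_
  ext w
  simp only [sub_apply, innerSL_apply_apply, ContinuousLinearMap.comp_apply, conormal,
    inner_sub_left]
  rw [← inner_grad, real_inner_comm (G.proj w), inner_proj, real_inner_comm w (G.ι _)]

theorem ae_differentiableAt_proj : ∀ᵐ x, DifferentiableAt ℝ G.p (G.proj x) := by
  rw [← G.measurePreserving_flat.map_eq, G.measurableEmbedding_flat.ae_map_iff]
  simp only [proj_flat]
  exact Measure.quasiMeasurePreserving_fst.ae (G.lipschitz.ae_differentiableAt (μ := volume))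

theorem measurable_conormal : Measurable G.conormal := by
  have h : Measurable fun y => grad G.p y :=
    (InnerProductSpace.toDual ℝ (E m)).symm.continuous.measurable.comp (measurable_fderiv ℝ G.p)
  exact measurable_const.sub (G.ι.continuous.measurable.comp h)

theorem jac_le (y : E m) : G.jac y ≤ 1 + G.K := by
  have h : ‖fderiv ℝ G.p y‖ ≤ G.K := norm_fderiv_le_of_lipschitz ℝ G.lipschitz
  refine Real.sqrt_le_iff.2 ⟨by positivity, ?_⟩
  nlinarith [norm_nonneg (fderiv ℝ G.p y), G.K.coe_nonneg]

end GraphChart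

theorem HasLipschitzBoundary.exists_chart {m : ℕ} {Ω : Set (E (m + 1))}
    (h : HasLipschitzBoundary Ω) {x₀ : E (m + 1)} (hx₀ : x₀ ∈ frontier Ω) :
    ∃ (G : GraphChart m) (r : ℝ), 0 < r ∧ G.IsChartOf Ω x₀ r := by
  obtain ⟨e, ψ, K, r, he, hψ, hr, hΩ⟩ := h x₀ hx₀
  have he0 : e ≠ 0 := by rintro rfl; simp at he
  have : Fact (Module.finrank ℝ (E (m + 1)) = m + 1) := ⟨finrank_euclideanSpace_fin⟩
  set b := OrthonormalBasis.fromOrthogonalSpanSingleton (𝕜 := ℝ) m he0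
  set ι : E m →ₗᵢ[ℝ] E (m + 1) := (Submodule.subtypeₗᵢ _).comp b.repr.symm.toLinearIsometry with hι
  have hin : ∀ y, inner ℝ e (ι y) = (0 : ℝ) := fun y =>
    Submodule.mem_orthogonal_singleton_iff_inner_right.1 (b.repr.symm y).2
  have hlip : LipschitzWith (K * 1) (ψ ∘ ι) := hψ.comp ι.lipschitz
  refine ⟨⟨ι, e, ψ ∘ ι, K * 1, he, hin, hlip⟩, r, hr, fun z hz => ?_⟩
  set G : GraphChart m := ⟨ι, e, ψ ∘ ι, K * 1, he, hin, hlip⟩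
  have h1 : inner ℝ e (G.flat z) = ψ (ι z.1) + z.2 := G.inner_e_flat z
  have h2 : G.flat z - (inner ℝ e (G.flat z) : ℝ) • e = ι z.1 := by
    rw [h1]; exact add_sub_cancel_right _ _
  rw [hΩ _ hz, h2, h1]
  exact lt_add_iff_pos_right _

/-- Finitely many graph charts that cover the boundary of `Ω`, with a partition of unity on the
closure of `Ω`. -/
structure BoundaryAtlas {m : ℕ} (Ω : Set (E (m + 1))) (I : Type) [Fintype I] where
  /-- The charts. -/
  chart : I → GraphChart m
  /-- The centres of the balls. -/
  center : I → E (m + 1)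
  /-- The radii of the balls. -/
  radius : I → ℝ
  /-- The interior weight. -/
  weight₀ : E (m + 1) → ℝ
  /-- The weights at the boundary. -/
  weight : I → E (m + 1) → ℝ
  radius_pos : ∀ i, 0 < radius i
  isChart : ∀ i, (chart i).IsChartOf Ω (center i) (radius i)
  contDiff₀ : ContDiff ℝ 1 weight₀
  contDiff : ∀ i, ContDiff ℝ 1 (weight i)
  hasCompactSupport₀ : HasCompactSupport weight₀
  tsupport_subset₀ : tsupport weight₀ ⊆ Ω
  tsupport_subset : ∀ i, tsupport (weight i) ⊆ Metric.ball (center i) (radius i / 2)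
  nonneg₀ : ∀ x, 0 ≤ weight₀ x
  nonneg : ∀ i x, 0 ≤ weight i x
  sum_le : ∀ x, weight₀ x + ∑ i, weight i x ≤ 1
  sum_eq : ∀ x ∈ closure Ω, weight₀ x + ∑ i, weight i x = 1

/-- Compactness of the boundary yields finitely many balls of half the chart radius, and `Ω` itself
serves as the remaining set of the cover of its closure. -/
theorem HasLipschitzBoundary.exists_boundaryAtlas {m : ℕ} {Ω : Set (E (m + 1))}
    (h : HasLipschitzBoundary Ω) (hΩ : IsOpen Ω) (hb : Bornology.IsBounded Ω) :
    ∃ N : ℕ, Nonempty (BoundaryAtlas Ω (Fin N)) := by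
  have hchart : ∀ x : frontier Ω, ∃ (G : GraphChart m) (r : ℝ), 0 < r ∧ G.IsChartOf Ω x r :=
    fun x => h.exists_chart x.2
  choose G r hr hG using hchart
  have hcpt : IsCompact (frontier Ω) :=
    Metric.isCompact_of_isClosed_isBounded isClosed_frontier (hb.closure.subset frontier_subset_closure)
  obtain ⟨t, ht⟩ := hcpt.elim_finite_subcover (fun x : frontier Ω => Metric.ball (x : E (m + 1)) (r x / 2))
    (fun x => Metric.isOpen_ball) fun x hx =>
      Set.mem_iUnion.2 ⟨⟨x, hx⟩, Metric.mem_ball_self (half_pos (hr _))⟩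
  obtain ⟨eq⟩ : Nonempty (Fin t.card ≃ t) := ⟨t.equivFin.symm⟩
  set U : Option (Fin t.card) → Set (E (m + 1)) := fun o => o.elim Ω fun i =>
    Metric.ball ((eq i : frontier Ω) : E (m + 1)) (r (eq i) / 2) with hU
  have hUo : ∀ o, IsOpen (U o) := by
    rintro (_ | i)
    · exact hΩ
    · exact Metric.isOpen_ball
  have hcov : closure Ω ⊆ ⋃ o, U o := by
    intro x hx
    by_cases hxΩ : x ∈ Ω
    · exact Set.mem_iUnion.2 ⟨none, hxΩ⟩
    · have hxf : x ∈ frontier Ω := by rw [hΩ.frontier_eq]; exact ⟨hx, hxΩ⟩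
      obtain ⟨y, hy, hxy⟩ := Set.mem_iUnion₂.1 (ht hxf)
      refine Set.mem_iUnion.2 ⟨some (eq.symm ⟨y, hy⟩), ?_⟩
      simpa [hU] using hxy
  obtain ⟨f, hf⟩ := SmoothPartitionOfUnity.exists_isSubordinate
    (modelWithCornersSelf ℝ (E (m + 1))) (isClosed_closure (s := Ω)) U hUo hcov
  have hsum : ∀ x, ∑ᶠ o, f o x = f none x + ∑ i, f (some i) x := fun x => by
    rw [finsum_eq_sum_of_fintype, Fintype.sum_option]
  have hsm : ∀ o, ContDiff ℝ 1 (f o) := fun o =>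
    ((f o).contMDiff.contDiff).of_le (by exact_mod_cast le_top)
  refine ⟨t.card, ⟨⟨fun i => G (eq i), fun i => ((eq i : frontier Ω) : E (m + 1)), fun i => r (eq i),
    f none, fun i => f (some i), fun i => hr _, fun i => hG _, hsm _, fun i => hsm _, ?_, hf none,
    fun i => hf (some i), f.nonneg none, fun i => f.nonneg (some i),
    fun x => (hsum x).symm.trans_le (f.sum_le_one x),
    fun x hx => (hsum x).symm.trans (f.sum_eq_one hx)⟩⟩⟩
  exact Metric.isCompact_of_isClosed_isBounded (isClosed_tsupport _) (hb.subset (hf none))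

/-- A smooth step from `0` at `h` to `1` at `2 * h`. -/
noncomputable def step (h s : ℝ) : ℝ := Real.smoothTransition (s / h - 1)

theorem contDiff_step (h : ℝ) : ContDiff ℝ 1 (step h) :=
  Real.smoothTransition.contDiff.comp (by fun_prop)

theorem step_mem_Icc (h s : ℝ) : step h s ∈ Set.Icc (0 : ℝ) 1 :=
  ⟨Real.smoothTransition.nonneg _, Real.smoothTransition.le_one _⟩

theorem step_eq_zero {h s : ℝ} (hh : 0 < h) (hs : s ≤ h) : step h s = 0 :=
  Real.smoothTransition.zero_of_nonpos (by rw [sub_nonpos, div_le_one hh]; exact hs)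

theorem step_eq_one {h s : ℝ} (hh : 0 < h) (hs : 2 * h ≤ s) : step h s = 1 :=
  Real.smoothTransition.one_of_one_le (by
    rw [le_sub_iff_add_le, le_div_iff₀ hh]; linarith)

theorem deriv_step_nonneg {h : ℝ} (hh : 0 < h) (s : ℝ) : 0 ≤ deriv (step h) s := by
  refine Monotone.deriv_nonneg fun a b hab => ?_
  exact Real.smoothTransition.monotone (by gcongr)

theorem continuous_deriv_step (h : ℝ) : Continuous (deriv (step h)) :=
  (contDiff_step h).continuous_deriv le_rfl

theorem deriv_step_eq_zero_left {h s : ℝ} (hh : 0 < h) (hs : s < h) : deriv (step h) s = 0 := by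
  have : step h =ᶠ[𝓝 s] fun _ => 0 := by
    filter_upwards [Iio_mem_nhds hs] with t ht using step_eq_zero hh (le_of_lt ht)
  rw [this.deriv_eq, deriv_const]

theorem deriv_step_eq_zero_right {h s : ℝ} (hh : 0 < h) (hs : 2 * h < s) :
    deriv (step h) s = 0 := by
  have : step h =ᶠ[𝓝 s] fun _ => 1 := by
    filter_upwards [Ioi_mem_nhds hs] with t ht using step_eq_one hh (le_of_lt ht)
  rw [this.deriv_eq, deriv_const]

theorem integral_deriv_step {h δ : ℝ} (hh : 0 < h) (hδ : 2 * h ≤ δ) :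
    ∫ s in Set.Ioo 0 δ, deriv (step h) s = 1 := by
  have h0 : (0 : ℝ) ≤ δ := by linarith
  rw [← integral_Ioc_eq_integral_Ioo, ← intervalIntegral.integral_of_le h0,
    intervalIntegral.integral_deriv_eq_sub]
  · rw [step_eq_one hh hδ, step_eq_zero hh hh.le, sub_zero]
  · intro x _
    exact ((contDiff_step h).differentiable one_ne_zero) x
  · exact (continuous_deriv_step h).intervalIntegrable _ _

theorem exists_deriv_step_le {h : ℝ} (hh : 0 < h) : ∃ M : ℝ≥0, ∀ s, deriv (step h) s ≤ M := by
  have hc : HasCompactSupport (deriv (step h)) := by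
    refine HasCompactSupport.of_support_subset_isCompact (isCompact_Icc (a := h) (b := 2 * h)) ?_
    intro s hs
    refine ⟨?_, ?_⟩
    · by_contra hcon; exact hs (deriv_step_eq_zero_left hh (not_le.1 hcon))
    · by_contra hcon; exact hs (deriv_step_eq_zero_right hh (not_le.1 hcon))
  obtain ⟨M, hM⟩ := (continuous_deriv_step h).bounded_above_of_compact_support hc
  refine ⟨M.toNNReal, fun s => ((le_abs_self _).trans (hM s)).trans (Real.le_coe_toNNReal M)⟩

theorem exists_lipschitz_step {h : ℝ} (hh : 0 < h) : ∃ M : ℝ≥0, LipschitzWith M (step h) := by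
  obtain ⟨M, hM⟩ := exists_deriv_step_le hh
  refine ⟨M, lipschitzWith_of_nnnorm_deriv_le ((contDiff_step h).differentiable one_ne_zero)
    fun s => ?_⟩
  rw [← NNReal.coe_le_coe, coe_nnnorm, Real.norm_eq_abs, abs_of_nonneg (deriv_step_nonneg hh s)]
  exact hM s

theorem LipschitzWith.mul_of_mem_Icc {X : Type*} [PseudoMetricSpace X] {f g : X → ℝ} {A B : ℝ≥0}
    (hf : LipschitzWith A f) (hg : LipschitzWith B g) (hf1 : ∀ x, f x ∈ Set.Icc (0 : ℝ) 1)
    (hg1 : ∀ x, g x ∈ Set.Icc (0 : ℝ) 1) : LipschitzWith (A + B) fun x => f x * g x := by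
  refine LipschitzWith.of_dist_le_mul fun x y => ?_
  have h1 := hf.dist_le_mul x y
  have h2 := hg.dist_le_mul x y
  rw [Real.dist_eq] at h1 h2 ⊢
  have e : f x * g x - f y * g y = (f x - f y) * g x + f y * (g x - g y) := by ring
  rw [e]
  refine (abs_add_le _ _).trans ?_
  rw [abs_mul, abs_mul, abs_of_nonneg (hg1 x).1, abs_of_nonneg (hf1 y).1]
  push_cast
  have := mul_le_mul_of_nonneg_left (hg1 x).2 (abs_nonneg (f x - f y))
  have := mul_le_mul_of_nonneg_right (hf1 y).2 (abs_nonneg (g x - g y))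
  linarith

namespace BoundaryAtlas

variable {m : ℕ} {Ω : Set (E (m + 1))} {I : Type} [Fintype I] (A : BoundaryAtlas Ω I)

/-- A cutoff that vanishes near the boundary and tends to `1` in `Ω` as `h → 0`. -/
noncomputable def cutoff (h : ℝ) (x : E (m + 1)) : ℝ :=
  A.weight₀ x + ∑ i, A.weight i x * step h ((A.chart i).height x)

theorem weight_le_one (i : I) (x : E (m + 1)) : A.weight i x ≤ 1 := by
  have h1 := A.sum_le x
  have h2 := Finset.single_le_sum (f := fun i => A.weight i x) (fun i _ => A.nonneg i x)
    (Finset.mem_univ i)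
  have h3 := A.nonneg₀ x
  linarith

theorem hasCompactSupport (i : I) : HasCompactSupport (A.weight i) :=
  Metric.isCompact_of_isClosed_isBounded (isClosed_tsupport _)
    (Metric.isBounded_ball.subset (A.tsupport_subset i))

theorem cutoff_mem_Icc (h : ℝ) (x : E (m + 1)) : A.cutoff h x ∈ Set.Icc (0 : ℝ) 1 := by
  refine ⟨add_nonneg (A.nonneg₀ x) (Finset.sum_nonneg fun i _ =>
    mul_nonneg (A.nonneg i x) (step_mem_Icc h _).1), le_trans ?_ (A.sum_le x)⟩
  refine add_le_add_right (Finset.sum_le_sum fun i _ => ?_) _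
  exact mul_le_of_le_one_right (A.nonneg i x) (step_mem_Icc h _).2

theorem exists_lipschitz_cutoff {h : ℝ} (hh : 0 < h) : ∃ C : ℝ≥0, LipschitzWith C (A.cutoff h) := by
  obtain ⟨M, hM⟩ := exists_lipschitz_step hh
  obtain ⟨C₀, hC₀⟩ := A.contDiff₀.lipschitzWith_of_hasCompactSupport A.hasCompactSupport₀ one_ne_zero
  have h1 : ∀ i, ∃ C : ℝ≥0, LipschitzWith C fun x => A.weight i x * step h ((A.chart i).height x) := by
    intro i
    obtain ⟨C, hC⟩ := (A.contDiff i).lipschitzWith_of_hasCompactSupport (A.hasCompactSupport i)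
      one_ne_zero
    exact ⟨_, LipschitzWith.mul_of_mem_Icc hC (hM.comp (A.chart i).lipschitz_height)
      (fun x => ⟨A.nonneg i x, A.weight_le_one i x⟩) fun x => step_mem_Icc h _⟩
  choose C hC using h1
  refine ⟨C₀ + ∑ i, C i, hC₀.add ?_⟩
  have : ∀ s : Finset I, LipschitzWith (∑ i ∈ s, C i)
      fun x => ∑ i ∈ s, A.weight i x * step h ((A.chart i).height x) := by
    intro s
    classical
    induction s using Finset.induction_on with
    | empty => simpa only [Finset.sum_empty] using LipschitzWith.const (0 : ℝ)
    | insert i s his ih =>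
      simp only [Finset.sum_insert his]
      exact (hC i).add ih
  exact this _

theorem height_pos {i : I} {x : E (m + 1)} (hx : x ∈ Metric.ball (A.center i) (A.radius i)) :
    x ∈ Ω ↔ 0 < (A.chart i).height x := by
  have h := A.isChart i ((A.chart i).proj x, (A.chart i).height x)
  rw [GraphChart.flat_proj_height] at h
  exact h hx

theorem mem_ball_of_mem_tsupport {i : I} {x : E (m + 1)} (hx : x ∈ tsupport (A.weight i)) :
    x ∈ Metric.ball (A.center i) (A.radius i) :=
  Metric.ball_subset_ball (by linarith [A.radius_pos i]) (A.tsupport_subset i hx)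

theorem tsupport_cutoff_subset {h : ℝ} (hh : 0 < h) :
    IsCompact (tsupport (A.cutoff h)) ∧ tsupport (A.cutoff h) ⊆ Ω := by
  set S := tsupport A.weight₀ ∪ ⋃ i, tsupport (A.weight i) ∩ {x | h ≤ (A.chart i).height x} with hS
  have hScpt : IsCompact S := by
    refine IsCompact.union A.hasCompactSupport₀ (isCompact_iUnion fun i => ?_)
    exact (A.hasCompactSupport i).inter_right
      (isClosed_le continuous_const (A.chart i).lipschitz_height.continuous)
  have hsub : Function.support (A.cutoff h) ⊆ S := by
    intro x hx
    by_contra hcon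
    refine hx ?_
    have h0 : A.weight₀ x = 0 := image_eq_zero_of_notMem_tsupport fun h => hcon (Or.inl h)
    rw [cutoff, h0, zero_add]
    refine Finset.sum_eq_zero fun i _ => ?_
    by_cases hw : x ∈ tsupport (A.weight i)
    · have : (A.chart i).height x < h := by
        by_contra hlt
        exact hcon (Or.inr (Set.mem_iUnion.2 ⟨i, hw, not_lt.1 hlt⟩))
      rw [step_eq_zero hh this.le, mul_zero]
    · rw [image_eq_zero_of_notMem_tsupport hw, zero_mul]
  have hts : tsupport (A.cutoff h) ⊆ S := closure_minimal hsub hScpt.isClosed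
  refine ⟨hScpt.of_isClosed_subset (isClosed_tsupport _) hts, hts.trans ?_⟩
  rintro x (hx | hx)
  · exact A.tsupport_subset₀ hx
  · obtain ⟨i, hxi, hxh⟩ := Set.mem_iUnion.1 hx
    exact (A.height_pos (A.mem_ball_of_mem_tsupport hxi)).2 (hh.trans_le hxh)

theorem eventually_cutoff_eq_one {K : Set (E (m + 1))} (hK : IsCompact K) (hKΩ : K ⊆ Ω) :
    ∀ᶠ h in 𝓝[>] (0 : ℝ), ∀ x ∈ K, A.cutoff h x = 1 := by
  have h1 : ∀ i, ∀ᶠ h in 𝓝[>] (0 : ℝ), ∀ x ∈ K ∩ tsupport (A.weight i),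
      2 * h ≤ (A.chart i).height x := by
    intro i
    rcases (K ∩ tsupport (A.weight i)).eq_empty_or_nonempty with h0 | h0
    · rw [h0]; exact Eventually.of_forall fun h x hx => hx.elim
    · obtain ⟨x₁, hx₁, hmin⟩ := (hK.inter_right (isClosed_tsupport (A.weight i))).exists_isMinOn h0
        (A.chart i).lipschitz_height.continuous.continuousOn
      have hpos : 0 < (A.chart i).height x₁ :=
        (A.height_pos (A.mem_ball_of_mem_tsupport hx₁.2)).1 (hKΩ hx₁.1)
      filter_upwards [Ioo_mem_nhdsGT (half_pos hpos)] with h hh x hx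
      have : (A.chart i).height x₁ ≤ (A.chart i).height x := hmin hx
      linarith [hh.2]
  filter_upwards [eventually_all.2 h1, self_mem_nhdsWithin] with h hh h0 x hx
  rw [← A.sum_eq x (subset_closure (hKΩ hx)), cutoff]
  congr 1
  refine Finset.sum_congr rfl fun i _ => ?_
  by_cases hw : x ∈ tsupport (A.weight i)
  · rw [step_eq_one h0 (hh i x ⟨hx, hw⟩), mul_one]
  · rw [image_eq_zero_of_notMem_tsupport hw, zero_mul]

theorem fderiv_cutoff_apply (h : ℝ) {x : E (m + 1)}
    (hp : ∀ i, DifferentiableAt ℝ (A.chart i).p ((A.chart i).proj x)) (w : E (m + 1)) :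
    fderiv ℝ (A.cutoff h) x w = (fderiv ℝ A.weight₀ x w +
      ∑ i, fderiv ℝ (A.weight i) x w * step h ((A.chart i).height x)) +
      ∑ i, A.weight i x * deriv (step h) ((A.chart i).height x) *
        inner ℝ ((A.chart i).conormal ((A.chart i).proj x)) w := by
  have h0 : HasFDerivAt A.weight₀ (fderiv ℝ A.weight₀ x) x :=
    (A.contDiff₀.differentiable one_ne_zero x).hasFDerivAt
  have h1 : ∀ i, HasFDerivAt (fun x => A.weight i x * step h ((A.chart i).height x))
      (A.weight i x • (deriv (step h) ((A.chart i).height x) •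
        innerSL ℝ ((A.chart i).conormal ((A.chart i).proj x))) +
        step h ((A.chart i).height x) • fderiv ℝ (A.weight i) x) x := fun i => by
    have h2 : HasFDerivAt (A.weight i) (fderiv ℝ (A.weight i) x) x :=
      ((A.contDiff i).differentiable one_ne_zero x).hasFDerivAt
    have h3 : HasDerivAt (step h) (deriv (step h) ((A.chart i).height x)) ((A.chart i).height x) :=
      ((contDiff_step h).differentiable one_ne_zero _).hasDerivAt
    exact h2.mul (h3.comp_hasFDerivAt x ((A.chart i).hasFDerivAt_height (hp i)))
  have h4 := (h0.add (HasFDerivAt.fun_sum (u := Finset.univ) fun i _ => h1 i)).fderiv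
  have e : A.cutoff h = A.weight₀ + fun x => ∑ i, A.weight i x * step h ((A.chart i).height x) := rfl
  rw [e, h4]
  simp only [add_apply, sum_apply, smul_apply, smul_eq_mul,
    innerSL_apply_apply, Finset.sum_add_distrib]
  rw [add_assoc]
  congr 1
  rw [add_comm]
  congr 1
  · exact Finset.sum_congr rfl fun i _ => mul_comm _ _
  · exact Finset.sum_congr rfl fun i _ => by ring

end BoundaryAtlas

end Capillary

/-! ### Boundary integrals as limits of integrals with the gradient of the cutoff -/

namespace Capillary

namespace GraphChart

variable {m : ℕ} {G : GraphChart m}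

/-- The function `deriv (step h)` is nonnegative with integral `1` and lives on heights between `h`
and `2 * h`, so it acts as an approximate identity at height `0`. The bound in `HasChartTrace`
dominates the vertical integrals uniformly in `h`. -/
theorem HasChartTrace.tendsto_integral_deriv_step {A : Set (E m)} {h₀ : ℝ} (hh₀ : 0 < h₀)
    {F : E (m + 1) → ℝ} {τ α : E m → ℝ} (hF : HasChartTrace G A h₀ F τ α)
    (hFi : IntegrableOn (fun z => F (G.flat z)) (A ×ˢ Set.Ioo 0 h₀) (volume.prod volume))
    {b : E m × ℝ → ℝ} {B : ℝ} (hb : Measurable b) (hB : ∀ z, |b z| ≤ B)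
    (hbc : ∀ y, ContinuousAt (fun s => b (y, s)) 0) :
    Tendsto (fun h => ∫ z in A ×ˢ Set.Ioo 0 h₀, F (G.flat z) * (b z * deriv (step h) z.2)
      ∂(volume.prod volume)) (𝓝[>] 0) (𝓝 (∫ y in A, τ y * b (y, 0))) := by
  have hB0 : 0 ≤ B := (abs_nonneg _).trans (hB 0)
  have hk : ∀ h > 0, ∃ M : ℝ≥0, ∀ s, |deriv (step h) s| ≤ M := fun h hh => by
    obtain ⟨M, hM⟩ := exists_deriv_step_le hh
    exact ⟨M, fun s => by rw [abs_of_nonneg (deriv_step_nonneg hh s)]; exact hM s⟩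
  have hprod : ∀ h > 0, IntegrableOn (fun z => F (G.flat z) * (b z * deriv (step h) z.2))
      (A ×ˢ Set.Ioo 0 h₀) (volume.prod volume) := by
    intro h hh
    obtain ⟨M, hM⟩ := hk h hh
    refine Integrable.mul_bdd (c := B * M) hFi ?_ (Eventually.of_forall fun z => ?_)
    · exact (hb.mul ((continuous_deriv_step h).measurable.comp measurable_snd)).aestronglyMeasurable
    · rw [norm_mul, Real.norm_eq_abs, Real.norm_eq_abs]
      exact mul_le_mul (hB z) (hM _) (abs_nonneg _) hB0
  have hline : ∀ᵐ y ∂(volume.restrict A),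
      IntegrableOn (fun s => F (G.flat (y, s))) (Set.Ioo 0 h₀) := by
    have h1 := hFi
    rw [IntegrableOn, ← Measure.prod_restrict] at h1
    exact h1.prod_right_ae
  have hki : ∀ h, IntegrableOn (deriv (step h)) (Set.Ioo 0 h₀) := fun h =>
    ((continuous_deriv_step h).integrableOn_Icc (a := 0) (b := h₀)).mono_set Set.Ioo_subset_Icc_self
  have hsmall : ∀ᶠ h in 𝓝[>] (0 : ℝ), 0 < h ∧ 2 * h < h₀ := by
    filter_upwards [Ioo_mem_nhdsGT (half_pos hh₀)] with h hh
    exact ⟨hh.1, by linarith [hh.2]⟩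
  have hone : ∀ h, 0 < h → 2 * h < h₀ → ∀ c : ℝ, ∫ s in Set.Ioo 0 h₀, c * deriv (step h) s = c :=
    fun h h1 h2 c => by rw [integral_const_mul, integral_deriv_step h1 h2.le, mul_one]
  have hEq : (fun h => ∫ y in A, ∫ s in Set.Ioo 0 h₀,
      F (G.flat (y, s)) * (b (y, s) * deriv (step h) s)) =ᶠ[𝓝[>] 0] fun h =>
      ∫ z in A ×ˢ Set.Ioo 0 h₀, F (G.flat z) * (b z * deriv (step h) z.2) ∂(volume.prod volume) := by
    filter_upwards [self_mem_nhdsWithin] with h hh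
    exact (setIntegral_prod _ (hprod h hh)).symm
  refine Tendsto.congr' hEq ?_
  refine tendsto_integral_filter_of_dominated_convergence (fun y => (|τ y| + |α y|) * B) ?_ ?_ ?_ ?_
  · filter_upwards [self_mem_nhdsWithin] with h hh
    have h1 := hprod h hh
    rw [IntegrableOn, ← Measure.prod_restrict] at h1
    exact h1.integral_prod_left.aestronglyMeasurable
  · filter_upwards [hsmall] with h hh
    filter_upwards [hF.bound] with y hy
    rw [← hone h hh.1 hh.2 ((|τ y| + |α y|) * B)]
    refine norm_integral_le_of_norm_le ((hki h).const_mul _) ?_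
    filter_upwards [hy] with s hs
    have h1 := deriv_step_nonneg hh.1 s
    rw [norm_mul, norm_mul, Real.norm_eq_abs, Real.norm_eq_abs, Real.norm_eq_abs, abs_of_nonneg h1,
      ← mul_assoc]
    refine mul_le_mul_of_nonneg_right (mul_le_mul ?_ (hB _) (abs_nonneg _) (by positivity)) h1
    have h2 := abs_sub_abs_le_abs_sub (F (G.flat (y, s))) (τ y)
    linarith [le_abs_self (α y)]
  · exact (hF.integrable.abs.add hF.integrable_bound.abs).mul_const B
  · filter_upwards [hF.tendsto, hline] with y hy hyi
    rw [Metric.tendsto_nhds]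
    intro ε hε
    obtain ⟨δ₁, hδ₁, h1⟩ := hy (ε / (4 * (B + 1))) (by positivity)
    obtain ⟨δ₂, hδ₂, h2⟩ := Metric.continuousAt_iff.1 (hbc y) (ε / (4 * (|τ y| + 1))) (by positivity)
    have hδ : 0 < min δ₁ δ₂ / 2 := by positivity
    filter_upwards [hsmall, Ioo_mem_nhdsGT hδ] with h hh hhδ
    have hi : IntegrableOn (fun s => F (G.flat (y, s)) * (b (y, s) * deriv (step h) s))
        (Set.Ioo 0 h₀) := by
      obtain ⟨M, hM⟩ := hk h hh.1
      refine Integrable.mul_bdd (c := B * M) hyi ?_ (Eventually.of_forall fun s => ?_)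
      · exact ((hb.comp measurable_prodMk_left).mul
          (continuous_deriv_step h).measurable).aestronglyMeasurable
      · rw [norm_mul, Real.norm_eq_abs, Real.norm_eq_abs]
        exact mul_le_mul (hB _) (hM _) (abs_nonneg _) hB0
    rw [Real.dist_eq, ← hone h hh.1 hh.2 (τ y * b (y, 0)),
      ← integral_sub hi ((hki h).const_mul _)]
    refine lt_of_le_of_lt ?_ (half_lt_self hε)
    rw [← hone h hh.1 hh.2 (ε / 2), ← Real.norm_eq_abs]
    refine norm_integral_le_of_norm_le ((hki h).const_mul _) ?_
    have h3 := (ae_restrict_iff' measurableSet_Ioo).1 h1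
    filter_upwards [ae_restrict_of_ae h3, ae_restrict_mem measurableSet_Ioo] with s hs hs0
    have hk0 := deriv_step_nonneg hh.1 s
    rw [← mul_assoc, ← sub_mul, Real.norm_eq_abs, abs_mul, abs_of_nonneg hk0]
    rcases le_or_gt s (2 * h) with h4 | h4
    · refine mul_le_mul_of_nonneg_right ?_ hk0
      have hm1 := min_le_left δ₁ δ₂
      have hm2 := min_le_right δ₁ δ₂
      have h5 := hs ⟨hs0.1, by linarith [hhδ.2]⟩
      have h6 : dist (b (y, s)) (b (y, 0)) < ε / (4 * (|τ y| + 1)) := h2 (by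
        rw [Real.dist_eq, sub_zero, abs_of_pos hs0.1]; linarith [hhδ.2])
      rw [Real.dist_eq] at h6
      have e : F (G.flat (y, s)) * b (y, s) - τ y * b (y, 0) =
          (F (G.flat (y, s)) - τ y) * b (y, s) + τ y * (b (y, s) - b (y, 0)) := by ring
      rw [e]
      refine (abs_add_le _ _).trans ?_
      rw [abs_mul, abs_mul]
      have h7 : |F (G.flat (y, s)) - τ y| * |b (y, s)| ≤ ε / (4 * (B + 1)) * (B + 1) :=
        mul_le_mul h5 ((hB _).trans (by linarith)) (abs_nonneg _) (by positivity)
      have h8 : |τ y| * |b (y, s) - b (y, 0)| ≤ (|τ y| + 1) * (ε / (4 * (|τ y| + 1))) :=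
        mul_le_mul (by linarith) h6.le (abs_nonneg _) (by positivity)
      have e1 : ε / (4 * (B + 1)) * (B + 1) = ε / 4 := by field_simp
      have e2 : (|τ y| + 1) * (ε / (4 * (|τ y| + 1))) = ε / 4 := by field_simp
      linarith
    · rw [deriv_step_eq_zero_right hh.1 h4, mul_zero, mul_zero]

end GraphChart

namespace BoundaryAtlas

variable {m : ℕ} {Ω : Set (E (m + 1))} {I : Type} [Fintype I] (A : BoundaryAtlas Ω I)

/-- Weights are supported in balls of radius `r / 2`; dropping vertically by less than `r / 4` stays
within `3 * r / 4`, the radius defining the base. -/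
theorem exists_proj_mem_base {i : I} {x : E (m + 1)} (hx : x ∈ Ω) (hw : A.weight i x ≠ 0)
    (hs : (A.chart i).height x < A.radius i / 4) :
    ((A.chart i).proj x, (A.chart i).height x) ∈
      (A.chart i).base (A.center i) (A.radius i) ×ˢ Set.Ioo 0 (A.radius i / 4) := by
  have hxt := subset_tsupport _ hw
  have h1 := (A.height_pos (A.mem_ball_of_mem_tsupport hxt)).1 hx
  have h2 : dist x (A.center i) < A.radius i / 2 := A.tsupport_subset i hxt
  refine ⟨?_, h1, hs⟩
  have h3 := (A.chart i).dist_flat_graph ((A.chart i).proj x) ((A.chart i).height x)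
  rw [GraphChart.flat_proj_height, abs_of_pos h1] at h3
  have h4 := dist_triangle_left ((A.chart i).graph ((A.chart i).proj x)) (A.center i) x
  change dist ((A.chart i).graph ((A.chart i).proj x)) (A.center i) < 3 * A.radius i / 4
  linarith

theorem flat_image_subset (i : I) : (A.chart i).flat ''
    ((A.chart i).base (A.center i) (A.radius i) ×ˢ Set.Ioo 0 (A.radius i / 4)) ⊆ Ω := by
  rintro _ ⟨⟨y, s⟩, ⟨hy, hs⟩, rfl⟩
  exact (A.isChart i).flat_mem hy hs

theorem integrableOn_comp_flat {F : E (m + 1) → ℝ} (hF : IntegrableOn F Ω) (i : I) :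
    IntegrableOn (fun z => F ((A.chart i).flat z))
      ((A.chart i).base (A.center i) (A.radius i) ×ˢ Set.Ioo 0 (A.radius i / 4))
      (volume.prod volume) :=
  ((A.chart i).measurePreserving_flat.integrableOn_image
    (A.chart i).measurableEmbedding_flat).1 (hF.mono_set (A.flat_image_subset i))

theorem measurable_inner_conormal (i : I) {Z : E (m + 1) → E (m + 1)} (hZ : Continuous Z) :
    Measurable fun x => (inner ℝ ((A.chart i).conormal ((A.chart i).proj x)) (Z x) : ℝ) :=
  ((A.chart i).measurable_conormal.comp (A.chart i).proj.continuous.measurable).inner hZ.measurable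

theorem abs_inner_conormal_le (i : I) {z : E (m + 1)} (hz : ‖z‖ ≤ 1) (y : E m) :
    |(inner ℝ ((A.chart i).conormal y) z : ℝ)| ≤ 1 + (A.chart i).K := by
  refine (abs_real_inner_le_norm _ _).trans ?_
  rw [GraphChart.norm_conormal]
  exact (mul_le_of_le_one_right (by linarith [(A.chart i).one_le_jac y]) hz).trans
    ((A.chart i).jac_le y)

theorem setIntegral_weight_deriv_step (i : I) (hΩ : IsOpen Ω) (F : E (m + 1) → ℝ)
    (Z : E (m + 1) → E (m + 1)) {h : ℝ} (h0 : 0 < h) (hh : h < A.radius i / 8) :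
    ∫ x in Ω, F x * (A.weight i x * deriv (step h) ((A.chart i).height x) *
        inner ℝ ((A.chart i).conormal ((A.chart i).proj x)) (Z x)) =
      ∫ z in (A.chart i).base (A.center i) (A.radius i) ×ˢ Set.Ioo 0 (A.radius i / 4),
        F ((A.chart i).flat z) * (A.weight i ((A.chart i).flat z) *
          inner ℝ ((A.chart i).conormal z.1) (Z ((A.chart i).flat z)) * deriv (step h) z.2)
        ∂(volume.prod volume) := by
  have e1 := setIntegral_eq_of_subset_of_forall_sdiff_eq_zero (μ := volume) hΩ.measurableSet
    (A.flat_image_subset i) (f := fun x => F x * (A.weight i x * deriv (step h)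
      ((A.chart i).height x) * inner ℝ ((A.chart i).conormal ((A.chart i).proj x)) (Z x)))
    fun x hx => ?_
  · rw [e1, (A.chart i).measurePreserving_flat.setIntegral_image_emb
      (A.chart i).measurableEmbedding_flat]
    refine setIntegral_congr_fun (((A.chart i).isOpen_base _ _).measurableSet.prod
      measurableSet_Ioo) fun z _ => ?_
    simp only [GraphChart.height_flat, GraphChart.proj_flat]
    ring
  · by_cases hw : A.weight i x = 0
    · rw [hw, zero_mul, zero_mul, mul_zero]
    · by_cases hk : 2 * h < (A.chart i).height x
      · rw [deriv_step_eq_zero_right h0 hk, mul_zero, zero_mul, mul_zero]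
      · refine absurd ⟨_, A.exists_proj_mem_base hx.1 hw ?_,
          (A.chart i).flat_proj_height x⟩ hx.2
        linarith [not_lt.1 hk]

theorem tendsto_integral_weight_deriv_step (i : I) (hΩ : IsOpen Ω) {F : E (m + 1) → ℝ}
    (hF : IntegrableOn F Ω) {τ α : E m → ℝ}
    (hτ : (A.chart i).HasChartTrace ((A.chart i).base (A.center i) (A.radius i))
      (A.radius i / 4) F τ α)
    {Z : E (m + 1) → E (m + 1)} (hZ : Continuous Z) (hZ1 : ∀ x, ‖Z x‖ ≤ 1) :
    Tendsto (fun h => ∫ x in Ω, F x * (A.weight i x * deriv (step h) ((A.chart i).height x) *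
        inner ℝ ((A.chart i).conormal ((A.chart i).proj x)) (Z x))) (𝓝[>] 0)
      (𝓝 (∫ y in (A.chart i).base (A.center i) (A.radius i), τ y *
        (A.weight i ((A.chart i).graph y) *
          inner ℝ ((A.chart i).conormal y) (Z ((A.chart i).graph y))))) := by
  have hr := A.radius_pos i
  have hcf := (A.chart i).continuous_flat
  have hwc := (A.contDiff i).continuous
  have hbm : Measurable fun z : E m × ℝ => A.weight i ((A.chart i).flat z) *
      inner ℝ ((A.chart i).conormal z.1) (Z ((A.chart i).flat z)) :=
    Measurable.mul (hwc.comp hcf).measurable (Measurable.inner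
      ((A.chart i).measurable_conormal.comp measurable_fst) (hZ.comp hcf).measurable)
  have hbc : ∀ y, ContinuousAt (fun s => A.weight i ((A.chart i).flat (y, s)) *
      inner ℝ ((A.chart i).conormal y) (Z ((A.chart i).flat (y, s)))) 0 := by
    intro y
    have h1 : Continuous fun s : ℝ => (A.chart i).flat (y, s) := hcf.comp (by fun_prop)
    have h2 : Continuous fun s : ℝ => A.weight i ((A.chart i).flat (y, s)) := hwc.comp h1
    have h3 : Continuous fun s : ℝ => Z ((A.chart i).flat (y, s)) := hZ.comp h1
    exact (h2.mul (Continuous.inner continuous_const h3)).continuousAt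
  have hbB : ∀ z : E m × ℝ, |A.weight i ((A.chart i).flat z) *
      inner ℝ ((A.chart i).conormal z.1) (Z ((A.chart i).flat z))| ≤ 1 + (A.chart i).K := by
    intro z
    rw [abs_mul, abs_of_nonneg (A.nonneg i _)]
    exact (mul_le_of_le_one_left (abs_nonneg _) (A.weight_le_one i _)).trans
      (A.abs_inner_conormal_le i (hZ1 _) z.1)
  have hlim := hτ.tendsto_integral_deriv_step (by positivity) (A.integrableOn_comp_flat hF i) hbm
    hbB hbc
  simp only [GraphChart.flat_zero] at hlim
  refine hlim.congr' ?_
  filter_upwards [Ioo_mem_nhdsGT (show 0 < A.radius i / 8 by positivity)] with h hh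
  exact (A.setIntegral_weight_deriv_step i hΩ F Z hh.1 hh.2).symm

theorem sum_fderiv_eq_zero (hΩ : IsOpen Ω) {x : E (m + 1)} (hx : x ∈ Ω) (w : E (m + 1)) :
    fderiv ℝ A.weight₀ x w + ∑ i, fderiv ℝ (A.weight i) x w = 0 := by
  have h0 : HasFDerivAt A.weight₀ (fderiv ℝ A.weight₀ x) x :=
    (A.contDiff₀.differentiable one_ne_zero x).hasFDerivAt
  have h1 : ∀ i, HasFDerivAt (A.weight i) (fderiv ℝ (A.weight i) x) x := fun i =>
    ((A.contDiff i).differentiable one_ne_zero x).hasFDerivAt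
  have h2 := h0.add (HasFDerivAt.fun_sum (u := Finset.univ) fun i _ => h1 i)
  have h3 : (A.weight₀ + fun x => ∑ i, A.weight i x) =ᶠ[𝓝 x] fun _ => 1 := by
    filter_upwards [hΩ.mem_nhds hx] with y hy using A.sum_eq y (subset_closure hy)
  have h4 := h2.unique ((hasFDerivAt_const (1 : ℝ) x).congr_of_eventuallyEq h3)
  have h5 := congrArg (fun L : E (m + 1) →L[ℝ] ℝ => L w) h4
  simpa [add_apply, sum_apply] using h5

/-- The derivative of the cutoff has two parts. Where the derivative falls on the weights, the limit
is the derivative of the partition of unity, which is zero in `Ω`. Where it falls on the steps, the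
integral concentrates on the boundary. -/
theorem tendsto_integral_fderiv_cutoff (hΩ : IsOpen Ω) {F : E (m + 1) → ℝ}
    (hF : IntegrableOn F Ω) {τ α : I → E m → ℝ}
    (hτ : ∀ i, (A.chart i).HasChartTrace ((A.chart i).base (A.center i) (A.radius i))
      (A.radius i / 4) F (τ i) (α i))
    {Z : E (m + 1) → E (m + 1)} (hZ : Continuous Z) (hZ1 : ∀ x, ‖Z x‖ ≤ 1) :
    Tendsto (fun h => ∫ x in Ω, F x * fderiv ℝ (A.cutoff h) x (Z x)) (𝓝[>] 0)
      (𝓝 (∑ i, ∫ y in (A.chart i).base (A.center i) (A.radius i), τ i y *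
        (A.weight i ((A.chart i).graph y) *
          inner ℝ ((A.chart i).conormal y) (Z ((A.chart i).graph y))))) := by
  have hbd : ∀ f : E (m + 1) → ℝ, ContDiff ℝ 1 f → HasCompactSupport f →
      ∃ C, 0 ≤ C ∧ ∀ x, |fderiv ℝ f x (Z x)| ≤ C := by
    intro f hf hfc
    obtain ⟨C, hC⟩ := (hf.continuous_fderiv one_ne_zero).bounded_above_of_compact_support
      (hfc.fderiv ℝ)
    refine ⟨C, (norm_nonneg _).trans (hC 0), fun x => ?_⟩
    refine ((fderiv ℝ f x).le_opNorm (Z x)).trans ?_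
    exact (mul_le_of_le_one_right (norm_nonneg _) (hZ1 x)).trans (hC x)
  obtain ⟨C₀, hC₀, hb₀⟩ := hbd _ A.contDiff₀ A.hasCompactSupport₀
  choose C hC hb using fun i => hbd _ (A.contDiff i) (A.hasCompactSupport i)
  have hfc : ∀ f : E (m + 1) → ℝ, ContDiff ℝ 1 f → Continuous fun x => fderiv ℝ f x (Z x) :=
    fun f hf => (hf.continuous_fderiv one_ne_zero).clm_apply hZ
  set P : ℝ → E (m + 1) → ℝ := fun h x => fderiv ℝ A.weight₀ x (Z x) +
    ∑ i, fderiv ℝ (A.weight i) x (Z x) * step h ((A.chart i).height x) with hP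
  have hPc : ∀ h, Continuous (P h) := fun h => by
    refine (hfc _ A.contDiff₀).add (continuous_finsetSum _ fun i _ => ?_)
    exact (hfc _ (A.contDiff i)).mul
      ((contDiff_step h).continuous.comp (A.chart i).lipschitz_height.continuous)
  have hPb : ∀ h x, |P h x| ≤ C₀ + ∑ i, C i := fun h x => by
    refine (abs_add_le _ _).trans (add_le_add (hb₀ x) ?_)
    refine (Finset.abs_sum_le_sum_abs _ _).trans (Finset.sum_le_sum fun i _ => ?_)
    rw [abs_mul, abs_of_nonneg (step_mem_Icc h _).1]
    exact (mul_le_of_le_one_right (abs_nonneg _) (step_mem_Icc h _).2).trans (hb i x)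
  set Q : I → ℝ → E (m + 1) → ℝ := fun i h x => A.weight i x *
    deriv (step h) ((A.chart i).height x) *
      inner ℝ ((A.chart i).conormal ((A.chart i).proj x)) (Z x) with hQ
  have iP : ∀ h, IntegrableOn (fun x => F x * P h x) Ω := fun h =>
    Integrable.mul_bdd hF (hPc h).aestronglyMeasurable (Eventually.of_forall (hPb h))
  have iQ : ∀ i, ∀ h > 0, IntegrableOn (fun x => F x * Q i h x) Ω := fun i h hh => by
    obtain ⟨M, hM⟩ := exists_deriv_step_le hh
    refine Integrable.mul_bdd (c := M * (1 + (A.chart i).K)) hF ?_ (Eventually.of_forall fun x => ?_)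
    · refine Measurable.aestronglyMeasurable (Measurable.mul ?_ (A.measurable_inner_conormal i hZ))
      exact ((A.contDiff i).continuous.mul ((continuous_deriv_step h).comp
        (A.chart i).lipschitz_height.continuous)).measurable
    · rw [norm_mul, norm_mul, Real.norm_eq_abs, Real.norm_eq_abs, Real.norm_eq_abs,
        abs_of_nonneg (A.nonneg i x), abs_of_nonneg (deriv_step_nonneg hh _)]
      refine mul_le_mul ?_ (A.abs_inner_conormal_le i (hZ1 x) _) (abs_nonneg _) M.coe_nonneg
      exact (mul_le_of_le_one_left (deriv_step_nonneg hh _) (A.weight_le_one i x)).trans (hM _)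
  have hdec : (fun h => (∫ x in Ω, F x * P h x) + ∑ i, ∫ x in Ω, F x * Q i h x) =ᶠ[𝓝[>] 0]
      fun h => ∫ x in Ω, F x * fderiv ℝ (A.cutoff h) x (Z x) := by
    filter_upwards [self_mem_nhdsWithin] with h hh
    rw [← integral_finsetSum _ fun i _ => iQ i h hh,
      ← integral_add (iP h) (integrable_finsetSum _ fun i _ => iQ i h hh)]
    refine integral_congr_ae ?_
    have hae : ∀ᵐ x, ∀ i, DifferentiableAt ℝ (A.chart i).p ((A.chart i).proj x) :=
      ae_all_iff.2 fun i => (A.chart i).ae_differentiableAt_proj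
    filter_upwards [ae_restrict_of_ae hae] with x hx
    rw [A.fderiv_cutoff_apply h hx, ← Finset.mul_sum, ← mul_add]
  refine Tendsto.congr' hdec ?_
  rw [← zero_add (∑ i, _)]
  refine Tendsto.add ?_ (tendsto_finsetSum _ fun i _ =>
    A.tendsto_integral_weight_deriv_step i hΩ hF (hτ i) hZ hZ1)
  suffices h0 : Tendsto (fun h => ∫ x in Ω, F x * P h x) (𝓝[>] 0) (𝓝 (∫ x in Ω, F x * 0)) by
    simpa only [mul_zero, integral_zero] using h0
  refine tendsto_integral_filter_of_dominated_convergence (fun x => |F x| * (C₀ + ∑ i, C i))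
    (Eventually.of_forall fun h => (iP h).aestronglyMeasurable) ?_ (hF.abs.mul_const _) ?_
  · refine Eventually.of_forall fun h => Eventually.of_forall fun x => ?_
    rw [norm_mul, Real.norm_eq_abs, Real.norm_eq_abs]
    exact mul_le_mul_of_nonneg_left (hPb h x) (abs_nonneg _)
  · filter_upwards [ae_restrict_mem hΩ.measurableSet] with x hx
    refine tendsto_const_nhds.congr' ?_
    have h1 : ∀ i, ∀ᶠ h in 𝓝[>] (0 : ℝ), fderiv ℝ (A.weight i) x (Z x) *
        step h ((A.chart i).height x) = fderiv ℝ (A.weight i) x (Z x) := by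
      intro i
      by_cases hw : x ∈ tsupport (A.weight i)
      · have hpos := (A.height_pos (A.mem_ball_of_mem_tsupport hw)).1 hx
        filter_upwards [Ioo_mem_nhdsGT (half_pos hpos)] with h hh
        rw [step_eq_one hh.1 (by linarith [hh.2]), mul_one]
      · refine Eventually.of_forall fun h => ?_
        have : fderiv ℝ (A.weight i) x = 0 :=
          image_eq_zero_of_notMem_tsupport fun h => hw (tsupport_fderiv_subset ℝ h)
        rw [this, zero_apply, zero_mul]
    filter_upwards [eventually_all.2 h1] with h hh
    simp only [hP, hh]
    rw [A.sum_fderiv_eq_zero hΩ hx]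

end BoundaryAtlas

end Capillary

/-! ### Surface energy of the truncation -/

namespace Capillary

theorem abs_excess_sub_le (a b c d : ℝ) : |max (a - b) 0 - max (c - d) 0| ≤ |a - c| + |b - d| := by
  refine (abs_max_sub_max_le_abs _ _ _).trans ?_
  have : a - b - (c - d) = (a - c) - (b - d) := by ring
  rw [this]
  exact abs_sub _ _

namespace GraphChart

variable {m : ℕ} {G : GraphChart m} {Ω : Set (E (m + 1))} {x₀ : E (m + 1)} {r : ℝ}

theorem HasChartTrace.excess {v : E (m + 1) → ℝ} {T α : E m → ℝ} (hr : 0 < r)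
    (h : HasChartTrace G (G.base x₀ r) (r / 4) v T α) {ψ : E (m + 1) → ℝ} (hψ : Continuous ψ) :
    ∃ α', HasChartTrace G (G.base x₀ r) (r / 4) (fun x => max (v x - ψ x) 0)
      (fun y => max (T y - ψ (G.graph y)) 0) α' := by
  obtain ⟨M, hM⟩ := (isCompact_closedBall x₀ r).exists_bound_of_continuousOn hψ.continuousOn
  have hAm : MeasurableSet (G.base x₀ r) := (G.isOpen_base x₀ r).measurableSet
  have hfin : volume (G.base x₀ r) ≠ ⊤ := (G.isBounded_base x₀ r).measure_lt_top.ne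
  have hψM : ∀ y ∈ G.base x₀ r, ∀ s, |s| < r / 4 → |ψ (G.flat (y, s))| ≤ M := fun y hy s hs =>
    hM _ (Metric.ball_subset_closedBall (G.flat_mem_ball hy hs))
  have hψM0 : ∀ y ∈ G.base x₀ r, |ψ (G.graph y)| ≤ M := fun y hy => by
    have := hψM y hy 0 (by simpa using hr)
    rwa [flat_zero] at this
  refine ⟨fun y => α y + 2 * M, ?_, ?_, ?_, ?_⟩
  · refine Integrable.sup (h.integrable.sub ?_) (integrable_zero _ _ _)
    refine Measure.integrableOn_of_bounded (M := M) hfin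
      (hψ.comp G.continuous_graph).aestronglyMeasurable ?_
    filter_upwards [ae_restrict_mem hAm] with y hy using hψM0 y hy
  · exact h.integrable_bound.add (integrableOn_const hfin)
  · filter_upwards [h.bound, ae_restrict_mem hAm] with y hy hyA
    filter_upwards [hy, ae_restrict_mem measurableSet_Ioo] with s hs hs0
    refine (abs_excess_sub_le _ _ _ _).trans ?_
    have h1 := hψM y hyA s (by rw [abs_of_pos hs0.1]; exact hs0.2)
    have h2 := hψM0 y hyA
    have h3 := abs_sub (ψ (G.flat (y, s))) (ψ (G.graph y))
    linarith
  · filter_upwards [h.tendsto] with y hy ε hε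
    obtain ⟨δ₁, hδ₁, h1⟩ := hy (ε / 2) (by positivity)
    have hc : Continuous fun s : ℝ => ψ (G.flat (y, s)) :=
      hψ.comp (G.continuous_flat.comp (by fun_prop))
    obtain ⟨δ₂, hδ₂, h2⟩ := Metric.continuousAt_iff.1 (hc.continuousAt (x := 0)) (ε / 2)
      (by positivity)
    refine ⟨min δ₁ δ₂, by positivity, ?_⟩
    filter_upwards [ae_restrict_of_ae_restrict_of_subset
      (Set.Ioo_subset_Ioo_right (min_le_left δ₁ δ₂)) h1, ae_restrict_mem measurableSet_Ioo]
      with s hs hs0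
    refine (abs_excess_sub_le _ _ _ _).trans ?_
    have h3 := h2 (x := s) (by
      rw [Real.dist_eq, sub_zero, abs_of_pos hs0.1]; exact hs0.2.trans_le (min_le_right _ _))
    rw [Real.dist_eq] at h3
    simp only [flat_zero] at h3
    linarith

end GraphChart

theorem integrableOn_of_continuous {n : ℕ} {Ω : Set (E n)} (hb : Bornology.IsBounded Ω)
    {ψ : E n → ℝ} (hψ : Continuous ψ) : IntegrableOn ψ Ω :=
  (hψ.continuousOn.integrableOn_compact (Metric.isCompact_of_isClosed_isBounded isClosed_closure
    hb.closure)).mono_set subset_closure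

theorem integrableOn_min {n : ℕ} {Ω : Set (E n)} (hb : Bornology.IsBounded Ω) {v : E n → ℝ}
    (hv : IntegrableOn v Ω) {ψ : E n → ℝ} (hψ : Continuous ψ) :
    IntegrableOn (fun x => min (v x) (ψ x)) Ω :=
  Integrable.inf hv (integrableOn_of_continuous hb hψ)

theorem integrableOn_excess {n : ℕ} {Ω : Set (E n)} (hb : Bornology.IsBounded Ω) {v : E n → ℝ}
    (hv : IntegrableOn v Ω) {ψ : E n → ℝ} (hψ : Continuous ψ) :
    IntegrableOn (fun x => max (v x - ψ x) 0) Ω :=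
  Integrable.sup (hv.sub (integrableOn_of_continuous hb hψ)) (integrable_zero _ _ _)

theorem IsTestField.exists_bound {n : ℕ} {Ω : Set (E n)} {g : E n → E n} {g₀ : E n → ℝ}
    (h : IsTestField Ω g g₀) : Continuous (fun x => g₀ x + divg g x) ∧
      ∃ C, ∀ x, ‖g₀ x + divg g x‖ ≤ C := by
  have hc : Continuous fun x => g₀ x + divg g x :=
    h.contDiff₀.continuous.add (continuous_divg h.contDiff)
  exact ⟨hc, hc.bounded_above_of_compact_support
    (h.hasCompactSupport₀.add (hasCompactSupport_divg h.hasCompactSupport))⟩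

/-- The energy of the truncation of `v` by the barrier. -/
theorem BoundaryAtlas.surfaceEnergy_min_le {m : ℕ} {Ω : Set (E (m + 1))} {I : Type} [Fintype I]
    (A : BoundaryAtlas Ω I) (hΩ : IsOpen Ω) (hb : Bornology.IsBounded Ω) {v : E (m + 1) → ℝ}
    (hv : IntegrableOn v Ω) {c : ℝ} (hc : surfaceEnergy Ω v ≤ c) {T α : I → E m → ℝ}
    (hT : ∀ i, (A.chart i).HasChartTrace ((A.chart i).base (A.center i) (A.radius i))
      (A.radius i / 4) v (T i) (α i))
    {ψ : E (m + 1) → ℝ} (hψ : ContDiff ℝ 1 ψ) {Z : E (m + 1) → E (m + 1)} (hZ : ContDiff ℝ 1 Z)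
    {z₀ : E (m + 1) → ℝ} (hz₀ : ∀ x, 0 ≤ z₀ x) (hz : ∀ x, ‖Z x‖ ^ 2 + z₀ x ^ 2 ≤ 1)
    (hcal : ∀ x p q, ‖p‖ ^ 2 + q ^ 2 ≤ 1 →
      ψ x * q - fderiv ℝ ψ x p ≤ ψ x * z₀ x + fderiv ℝ ψ x (Z x))
    {C : ℝ} (hC : 0 ≤ C) (hdiv : ∀ x, divg Z x ≤ C) :
    surfaceEnergy Ω (fun x => min (v x) (ψ x)) ≤
      ((c + C * (∫ x in Ω, max (v x - ψ x) 0) +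
        ∑ i, ∫ y in (A.chart i).base (A.center i) (A.radius i),
          max (T i y - ψ ((A.chart i).graph y)) 0 * (A.weight i ((A.chart i).graph y) *
            inner ℝ ((A.chart i).conormal y) (Z ((A.chart i).graph y))) : ℝ) : EReal) := by
  refine iSup_le fun g => iSup_le fun g₀ => iSup_le fun ht => EReal.coe_le_coe_iff.2 ?_
  have hZ1 : ∀ x, ‖Z x‖ ≤ 1 := fun x => by nlinarith [hz x, norm_nonneg (Z x), sq_nonneg (z₀ x)]
  set f : E (m + 1) → ℝ := fun x => max (v x - ψ x) 0 with hf
  have hfi : IntegrableOn f Ω := integrableOn_excess hb hv hψ.continuous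
  have hwi := integrableOn_min hb hv hψ.continuous
  choose α' hα' using fun i => (hT i).excess (A.radius_pos i) hψ.continuous
  have hlim := A.tendsto_integral_fderiv_cutoff hΩ hfi hα' hZ.continuous hZ1
  set K := tsupport g ∪ tsupport g₀ with hK
  have hKc : IsCompact K := IsCompact.union ht.hasCompactSupport ht.hasCompactSupport₀
  have hKΩ : K ⊆ Ω := Set.union_subset ht.tsupport_subset ht.tsupport_subset₀
  -- For a fixed test field the calibration inequality holds with every cutoff equal to `1` on its
  -- support; letting `h → 0` produces the boundary term.
  refine le_of_tendsto_of_tendsto tendsto_const_nhds (hlim.const_add (c + C * ∫ x in Ω, f x)) ?_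
  filter_upwards [A.eventually_cutoff_eq_one hKc hKΩ, self_mem_nhdsWithin] with h h1 hh
  obtain ⟨L, hL⟩ := A.exists_lipschitz_cutoff hh
  obtain ⟨hχc, hχΩ⟩ := A.tsupport_cutoff_subset hh
  set χ := A.cutoff h with hχ
  have key := calibration_le hΩ hv hc ht hL hχc hχΩ (A.cutoff_mem_Icc h) h1 hψ hZ hz₀ hz hcal
  have e1 := setIntegral_eq_of_subset_of_forall_sdiff_eq_zero (μ := volume) hΩ.measurableSet
    hχΩ (f := fun x => min (v x) (ψ x) * (g₀ x + divg g x) -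
        f x * (χ x * divg Z x + fderiv ℝ χ x (Z x))) fun x hx => by
      have hxK : x ∉ K := fun hxK => hx.2 (subset_tsupport _ (by
        rw [Function.mem_support, h1 x hxK]; exact one_ne_zero))
      have h2 : g₀ x = 0 := image_eq_zero_of_notMem_tsupport fun h => hxK (Or.inr h)
      have h3 : divg g x = 0 := divg_eq_zero_of_notMem fun h => hxK (Or.inl h)
      have h4 : χ x = 0 := image_eq_zero_of_notMem_tsupport hx.2
      have h5 : fderiv ℝ χ x = 0 :=
        image_eq_zero_of_notMem_tsupport fun h => hx.2 (tsupport_fderiv_subset ℝ h)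
      rw [h2, h3, h4, h5]; simp
  rw [← e1] at key
  obtain ⟨hgc, Cg, hCg⟩ := ht.exists_bound
  have i1 : IntegrableOn (fun x => min (v x) (ψ x) * (g₀ x + divg g x)) Ω :=
    Integrable.mul_bdd hwi hgc.aestronglyMeasurable (Eventually.of_forall hCg)
  have hdc : Continuous fun x => χ x * divg Z x := hL.continuous.mul (continuous_divg hZ)
  obtain ⟨Cd, hCd⟩ := hdc.bounded_above_of_compact_support (HasCompactSupport.mul_right hχc)
  have i2 : IntegrableOn (fun x => f x * (χ x * divg Z x)) Ω :=
    Integrable.mul_bdd hfi hdc.aestronglyMeasurable (Eventually.of_forall hCd)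
  have i3 : IntegrableOn (fun x => f x * fderiv ℝ χ x (Z x)) Ω := by
    refine Integrable.mul_bdd (c := L) hfi
      (measurable_fderiv_apply hZ.continuous).aestronglyMeasurable (Eventually.of_forall fun x => ?_)
    refine ((fderiv ℝ χ x).le_opNorm (Z x)).trans ?_
    exact (mul_le_of_le_one_right (norm_nonneg _) (hZ1 x)).trans
      (norm_fderiv_le_of_lipschitz ℝ hL)
  have e2 : ∫ x in Ω, (min (v x) (ψ x) * (g₀ x + divg g x) -
      f x * (χ x * divg Z x + fderiv ℝ χ x (Z x))) =
      (∫ x in Ω, min (v x) (ψ x) * (g₀ x + divg g x)) -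
        ((∫ x in Ω, f x * (χ x * divg Z x)) + ∫ x in Ω, f x * fderiv ℝ χ x (Z x)) := by
    have i4 : IntegrableOn (fun x => f x * (χ x * divg Z x) + f x * fderiv ℝ χ x (Z x)) Ω :=
      i2.add i3
    rw [← integral_add i2 i3, ← integral_sub i1 i4]
    simp only [mul_add]
  rw [e2] at key
  have h6 : ∫ x in Ω, f x * (χ x * divg Z x) ≤ C * ∫ x in Ω, f x := by
    rw [← integral_const_mul]
    refine integral_mono i2 (hfi.const_mul C) fun x => ?_
    have h7 : 0 ≤ f x := le_max_right _ _
    have h8 := A.cutoff_mem_Icc h x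
    have h9 : χ x * divg Z x ≤ C := by
      refine (mul_le_mul_of_nonneg_left (hdiv x) h8.1).trans ?_
      exact mul_le_of_le_one_left hC h8.2
    simp only
    rw [mul_comm C]
    exact mul_le_mul_of_nonneg_left h9 h7
  linarith

end Capillary

/-! ### Surface measure in charts -/

namespace Capillary

namespace GraphChart

variable {m : ℕ} {G : GraphChart m} {Ω : Set (E (m + 1))} {x₀ : E (m + 1)} {r : ℝ}

theorem proj_graph (y : E m) : G.proj (G.graph y) = y := by
  rw [← flat_zero, proj_flat]

theorem measurableEmbedding_graph : MeasurableEmbedding G.graph :=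
  G.continuous_graph.measurableEmbedding (Function.LeftInverse.injective G.proj_graph)

/-- The area measure of the graph, in the parametrisation by the base. -/
noncomputable def areaMeasure (G : GraphChart m) (S : Set (E m)) : Measure (E m) :=
  (volume.restrict S).withDensity fun y => ENNReal.ofReal (G.jac y)

/-- One inequality of the area formula suffices: it transfers null sets and integrability to the
boundary, and integrals of nonnegative functions are only needed from above. -/
theorem IsChartOf.surfaceMeasure_restrict_le (hG : G.IsChartOf Ω x₀ r) (hΩ : IsOpen Ω)
    (hr : 0 < r) : (surfaceMeasure Ω).restrict (Metric.ball x₀ (3 * r / 4)) ≤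
      (G.areaMeasure (G.base x₀ r)).map G.graph := by
  refine Measure.le_iff.2 fun S hS => ?_
  have hAm : MeasurableSet (G.base x₀ r) := (G.isOpen_base x₀ r).measurableSet
  have hgS : MeasurableSet (G.graph ⁻¹' S) := G.continuous_graph.measurable hS
  rw [Measure.restrict_apply hS, surfaceMeasure,
    Measure.restrict_apply (hS.inter measurableSet_ball),
    Measure.map_apply G.continuous_graph.measurable hS, areaMeasure, withDensity_apply _ hgS,
    Measure.restrict_restrict hgS]
  refine (measure_mono ?_).trans (G.measure_graph_image_le (hgS.inter hAm))
  rintro x ⟨⟨hxS, hxb⟩, hxf⟩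
  obtain ⟨y, rfl⟩ := hG.exists_graph_eq hΩ hxf (Metric.ball_subset_ball (by linarith) hxb)
  exact ⟨y, ⟨hxS, hxb⟩, rfl⟩

theorem IsChartOf.ae_surfaceMeasure (hG : G.IsChartOf Ω x₀ r) (hΩ : IsOpen Ω) (hr : 0 < r)
    {P : E (m + 1) → Prop} (h : ∀ᵐ y ∂(volume.restrict (G.base x₀ r)), P (G.graph y)) :
    ∀ᵐ x ∂((surfaceMeasure Ω).restrict (Metric.ball x₀ (3 * r / 4))), P x := by
  refine (hG.surfaceMeasure_restrict_le hΩ hr).absolutelyContinuous.ae_le ?_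
  refine (G.measurableEmbedding_graph.ae_map_iff).2 ?_
  exact (withDensity_absolutelyContinuous _ _).ae_le h

theorem integrable_areaMeasure_iff {S : Set (E m)} {f : E m → ℝ} :
    Integrable f (G.areaMeasure S) ↔ IntegrableOn (fun y => G.jac y * f y) S := by
  rw [areaMeasure, integrable_withDensity_iff_integrable_smul' G.measurable_jac.ennreal_ofReal
    (Eventually.of_forall fun _ => ENNReal.ofReal_lt_top)]
  simp only [smul_eq_mul, ENNReal.toReal_ofReal (zero_le_one.trans (G.one_le_jac _)), IntegrableOn]

theorem integrableOn_jac_mul {S : Set (E m)} {f : E m → ℝ} (hf : IntegrableOn f S) :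
    IntegrableOn (fun y => G.jac y * f y) S := by
  refine Integrable.bdd_mul (c := 1 + G.K) hf G.measurable_jac.aestronglyMeasurable
    (Eventually.of_forall fun y => ?_)
  rw [Real.norm_eq_abs, abs_of_nonneg (zero_le_one.trans (G.one_le_jac y))]
  exact G.jac_le y

theorem IsChartOf.integrableOn_ball (hG : G.IsChartOf Ω x₀ r) (hΩ : IsOpen Ω) (hr : 0 < r)
    {f : E (m + 1) → ℝ} (hf : IntegrableOn (fun y => f (G.graph y)) (G.base x₀ r)) :
    IntegrableOn f (Metric.ball x₀ (3 * r / 4)) (surfaceMeasure Ω) := by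
  refine Integrable.mono_measure ?_ (hG.surfaceMeasure_restrict_le hΩ hr)
  rw [G.measurableEmbedding_graph.integrable_map_iff, integrable_areaMeasure_iff]
  exact integrableOn_jac_mul hf

theorem IsChartOf.setIntegral_ball_le (hG : G.IsChartOf Ω x₀ r) (hΩ : IsOpen Ω) (hr : 0 < r)
    {f : E (m + 1) → ℝ} (hf0 : ∀ x, 0 ≤ f x)
    (hf : IntegrableOn (fun y => f (G.graph y)) (G.base x₀ r)) :
    ∫ x in Metric.ball x₀ (3 * r / 4), f x ∂(surfaceMeasure Ω) ≤
      ∫ y in G.base x₀ r, G.jac y * f (G.graph y) := by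
  have hi : Integrable f ((G.areaMeasure (G.base x₀ r)).map G.graph) := by
    rw [G.measurableEmbedding_graph.integrable_map_iff, integrable_areaMeasure_iff]
    exact integrableOn_jac_mul hf
  refine (integral_mono_measure (hG.surfaceMeasure_restrict_le hΩ hr)
    (Eventually.of_forall hf0) hi).trans_eq ?_
  rw [G.measurableEmbedding_graph.integral_map, areaMeasure,
    integral_withDensity_eq_integral_toReal_smul G.measurable_jac.ennreal_ofReal
      (Eventually.of_forall fun _ => ENNReal.ofReal_lt_top)]
  simp only [smul_eq_mul, ENNReal.toReal_ofReal (zero_le_one.trans (G.one_le_jac _))]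

end GraphChart

namespace BoundaryAtlas

variable {m : ℕ} {Ω : Set (E (m + 1))} {I : Type} [Fintype I] (A : BoundaryAtlas Ω I)

/-- The ball of a chart in which the boundary is parametrised by the base. -/
def ball (i : I) : Set (E (m + 1)) := Metric.ball (A.center i) (3 * A.radius i / 4)

/-- The base of a chart. -/
def base (i : I) : Set (E m) := (A.chart i).base (A.center i) (A.radius i)

theorem weight₀_eq_zero (hΩ : IsOpen Ω) {x : E (m + 1)} (hx : x ∈ frontier Ω) :
    A.weight₀ x = 0 :=
  image_eq_zero_of_notMem_tsupport fun h => by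
    rw [hΩ.frontier_eq] at hx
    exact hx.2 (A.tsupport_subset₀ h)

theorem sum_weight_eq_one (hΩ : IsOpen Ω) {x : E (m + 1)} (hx : x ∈ frontier Ω) :
    ∑ i, A.weight i x = 1 := by
  rw [← A.sum_eq x (frontier_subset_closure hx), A.weight₀_eq_zero hΩ hx, zero_add]

theorem weight_eq_zero {i : I} {x : E (m + 1)} (hx : x ∉ A.ball i) : A.weight i x = 0 :=
  image_eq_zero_of_notMem_tsupport fun h => hx
    (Metric.ball_subset_ball (by linarith [A.radius_pos i]) (A.tsupport_subset i h))

theorem frontier_subset (hΩ : IsOpen Ω) : frontier Ω ⊆ ⋃ i, A.ball i := by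
  intro x hx
  by_contra hcon
  have h1 := A.sum_weight_eq_one hΩ hx
  rw [Finset.sum_eq_zero fun i _ => A.weight_eq_zero fun h => hcon (Set.mem_iUnion.2 ⟨i, h⟩)] at h1
  exact zero_ne_one h1

theorem restrict_surfaceMeasure (hΩ : IsOpen Ω) :
    (surfaceMeasure Ω).restrict (⋃ i, A.ball i) = surfaceMeasure Ω := by
  have hm : MeasurableSet (⋃ i, A.ball i) := MeasurableSet.iUnion fun i => measurableSet_ball
  rw [surfaceMeasure, Measure.restrict_restrict hm,
    Set.inter_eq_right.2 (A.frontier_subset hΩ)]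

theorem ae_surfaceMeasure (hΩ : IsOpen Ω) {P : E (m + 1) → Prop}
    (h : ∀ i, ∀ᵐ y ∂(volume.restrict (A.base i)), P ((A.chart i).graph y)) :
    ∀ᵐ x ∂(surfaceMeasure Ω), P x := by
  rw [← A.restrict_surfaceMeasure hΩ, ae_restrict_iUnion_iff]
  exact fun i => (A.isChart i).ae_surfaceMeasure hΩ (A.radius_pos i) (h i)

theorem integrable_surfaceMeasure (hΩ : IsOpen Ω) {f : E (m + 1) → ℝ}
    (h : ∀ i, IntegrableOn (fun y => f ((A.chart i).graph y)) (A.base i)) :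
    Integrable f (surfaceMeasure Ω) := by
  rw [← A.restrict_surfaceMeasure hΩ]
  exact integrableOn_finite_iUnion.2 fun i =>
    (A.isChart i).integrableOn_ball hΩ (A.radius_pos i) (h i)

theorem measure_base_ne_top (i : I) : volume (A.base i) ≠ ⊤ :=
  ((A.chart i).isBounded_base _ _).measure_lt_top.ne

theorem isFiniteMeasure_surfaceMeasure (A : BoundaryAtlas Ω I) (hΩ : IsOpen Ω) :
    IsFiniteMeasure (surfaceMeasure Ω) := by
  have h : Integrable (fun _ => (1 : ℝ)) (surfaceMeasure Ω) :=
    A.integrable_surfaceMeasure hΩ fun i => integrableOn_const (A.measure_base_ne_top i)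
  exact (integrable_const_iff_isFiniteMeasure one_ne_zero).1 h

/-- The weights prevent double counting where charts overlap, and are the same as in the boundary
term of the calibration, so that the two can be compared chart by chart. -/
theorem integral_surfaceMeasure_le (hΩ : IsOpen Ω) {f : E (m + 1) → ℝ} (hf0 : ∀ x, 0 ≤ f x)
    (h : ∀ i, IntegrableOn (fun y => f ((A.chart i).graph y)) (A.base i)) :
    ∫ x, f x ∂(surfaceMeasure Ω) ≤ ∑ i, ∫ y in A.base i,
      (A.chart i).jac y * (A.weight i ((A.chart i).graph y) * f ((A.chart i).graph y)) := by
  have hfi := A.integrable_surfaceMeasure hΩ h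
  have hwi : ∀ i, Integrable (fun x => A.weight i x * f x) (surfaceMeasure Ω) := fun i =>
    Integrable.bdd_mul (c := 1) hfi (A.contDiff i).continuous.aestronglyMeasurable
      (Eventually.of_forall fun x => by
        rw [Real.norm_eq_abs, abs_of_nonneg (A.nonneg i x)]; exact A.weight_le_one i x)
  have e1 : ∫ x, f x ∂(surfaceMeasure Ω) = ∑ i, ∫ x, A.weight i x * f x ∂(surfaceMeasure Ω) := by
    rw [← integral_finsetSum _ fun i _ => hwi i]
    refine integral_congr_ae ?_
    filter_upwards [ae_restrict_mem isClosed_frontier.measurableSet] with x hx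
    rw [← Finset.sum_mul, A.sum_weight_eq_one hΩ hx, one_mul]
  rw [e1]
  refine Finset.sum_le_sum fun i _ => ?_
  rw [← setIntegral_eq_integral_of_forall_compl_eq_zero (s := A.ball i) fun x hx => by
    rw [A.weight_eq_zero hx, zero_mul]]
  refine (A.isChart i).setIntegral_ball_le hΩ (A.radius_pos i)
    (fun x => mul_nonneg (A.nonneg i x) (hf0 x)) ?_
  refine Integrable.bdd_mul (c := 1) (h i)
    ((A.contDiff i).continuous.comp (A.chart i).continuous_graph).aestronglyMeasurable
      (Eventually.of_forall fun x => ?_)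
  rw [Real.norm_eq_abs, abs_of_nonneg (A.nonneg i _)]
  exact A.weight_le_one i _

end BoundaryAtlas

end Capillary

/-! ### Wetting and potential energy of the truncation, and comparison of energies -/

namespace Capillary

namespace BoundaryAtlas

variable {m : ℕ} {Ω : Set (E (m + 1))} {I : Type} [Fintype I] (A : BoundaryAtlas Ω I)

theorem ae_hasTrace (hΩ : IsOpen Ω) {v : E (m + 1) → ℝ} (hv : IntegrableOn v Ω) {T α : I → E m → ℝ}
    (hT : ∀ i, (A.chart i).HasChartTrace (A.base i) (A.radius i / 4) v (T i) (α i)) (i : I) :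
    ∀ᵐ y ∂(volume.restrict (A.base i)), HasTrace Ω v ((A.chart i).graph y) (T i y) :=
  (hT i).hasTrace hΩ hv (A.radius_pos i) (A.isChart i)

theorem integrable_trace (hΩ : IsOpen Ω) {v : E (m + 1) → ℝ} (hv : IntegrableOn v Ω)
    {T α : I → E m → ℝ}
    (hT : ∀ i, (A.chart i).HasChartTrace (A.base i) (A.radius i / 4) v (T i) (α i)) :
    Integrable (trace Ω v) (surfaceMeasure Ω) := by
  refine A.integrable_surfaceMeasure hΩ fun i => (hT i).integrable.congr ?_
  filter_upwards [A.ae_hasTrace hΩ hv hT i] with y hy using (hy.trace_eq hv).symm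

theorem ae_trace_min (hΩ : IsOpen Ω) (hb : Bornology.IsBounded Ω) {v : E (m + 1) → ℝ}
    (hv : IntegrableOn v Ω) {T α : I → E m → ℝ}
    (hT : ∀ i, (A.chart i).HasChartTrace (A.base i) (A.radius i / 4) v (T i) (α i))
    {ψ : E (m + 1) → ℝ} (hψ : Continuous ψ) : ∀ᵐ x ∂(surfaceMeasure Ω),
      trace Ω (fun x => min (v x) (ψ x)) x = trace Ω v x - max (trace Ω v x - ψ x) 0 := by
  refine A.ae_surfaceMeasure hΩ fun i => ?_
  filter_upwards [A.ae_hasTrace hΩ hv hT i] with y hy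
  rw [(hy.min_continuous hv hψ).trace_eq (integrableOn_min hb hv hψ), hy.trace_eq hv]
  rcases le_total (T i y) (ψ ((A.chart i).graph y)) with h | h
  · rw [min_eq_left h, max_eq_right (by linarith), sub_zero]
  · rw [min_eq_right h, max_eq_left (by linarith)]; ring

/-- The wetting energy of the truncation of `v` by a continuous function. -/
theorem wettingEnergy_min_le (hΩ : IsOpen Ω) (hb : Bornology.IsBounded Ω) {v : E (m + 1) → ℝ}
    (hv : IntegrableOn v Ω) {T α : I → E m → ℝ}
    (hT : ∀ i, (A.chart i).HasChartTrace (A.base i) (A.radius i / 4) v (T i) (α i))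
    {ψ : E (m + 1) → ℝ} (hψ : Continuous ψ) {β : E (m + 1) → ℝ} {b : ℝ} (hb0 : 0 ≤ b)
    (hβm : AEStronglyMeasurable β (surfaceMeasure Ω))
    (hβ : ∀ᵐ x ∂(surfaceMeasure Ω), |β x| ≤ b) :
    wettingEnergy Ω β (fun x => min (v x) (ψ x)) ≤ wettingEnergy Ω β v + b * ∑ i, ∫ y in A.base i,
      (A.chart i).jac y * (A.weight i ((A.chart i).graph y) *
        max (T i y - ψ ((A.chart i).graph y)) 0) := by
  have hfm := A.isFiniteMeasure_surfaceMeasure hΩ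
  have htr := A.integrable_trace hΩ hv hT
  set δ : E (m + 1) → ℝ := fun x => max (trace Ω v x - ψ x) 0 with hδ
  have hψi : Integrable ψ (surfaceMeasure Ω) := A.integrable_surfaceMeasure hΩ fun i =>
    integrableOn_of_continuous ((A.chart i).isBounded_base _ _)
      (hψ.comp (A.chart i).continuous_graph)
  have hδi : Integrable δ (surfaceMeasure Ω) :=
    Integrable.sup (htr.sub hψi) (integrable_zero _ _ _)
  have hβδ : Integrable (fun x => β x * δ x) (surfaceMeasure Ω) := hδi.bdd_mul hβm hβ
  have hβt : Integrable (fun x => β x * (1 - trace Ω v x)) (surfaceMeasure Ω) :=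
    ((integrable_const 1).sub htr).bdd_mul hβm hβ
  have e1 : wettingEnergy Ω β (fun x => min (v x) (ψ x)) =
      wettingEnergy Ω β v - ∫ x, β x * δ x ∂(surfaceMeasure Ω) := by
    rw [wettingEnergy, wettingEnergy, ← neg_add', ← integral_add hβt hβδ]
    congr 1
    refine integral_congr_ae ?_
    filter_upwards [A.ae_trace_min hΩ hb hv hT hψ] with x hx
    rw [hx]; ring
  have e2 : -(b * ∫ x, δ x ∂(surfaceMeasure Ω)) ≤ ∫ x, β x * δ x ∂(surfaceMeasure Ω) := by
    rw [← integral_const_mul, ← integral_neg]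
    refine integral_mono_ae (hδi.const_mul b).neg hβδ ?_
    filter_upwards [hβ] with x hx
    have h1 : 0 ≤ δ x := le_max_right _ _
    have h2 := neg_le_of_abs_le hx
    nlinarith
  have hδg : ∀ i, ∀ᵐ y ∂(volume.restrict (A.base i)), δ ((A.chart i).graph y) =
      max (T i y - ψ ((A.chart i).graph y)) 0 := fun i => by
    filter_upwards [A.ae_hasTrace hΩ hv hT i] with y hy
    simp only [hδ, hy.trace_eq hv]
  have e3 : ∫ x, δ x ∂(surfaceMeasure Ω) ≤ ∑ i, ∫ y in A.base i, (A.chart i).jac y *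
      (A.weight i ((A.chart i).graph y) * max (T i y - ψ ((A.chart i).graph y)) 0) := by
    refine (A.integral_surfaceMeasure_le hΩ (fun x => le_max_right _ _) fun i => ?_).trans_eq ?_
    · refine Integrable.congr ?_ ((hδg i).mono fun y hy => hy.symm)
      exact Integrable.sup ((hT i).integrable.sub (integrableOn_of_continuous
        ((A.chart i).isBounded_base _ _) (hψ.comp (A.chart i).continuous_graph)))
        (integrable_zero _ _ _)
    · refine Finset.sum_congr rfl fun i _ => integral_congr_ae ?_
      filter_upwards [hδg i] with y hy
      rw [← hy]
  have := mul_le_mul_of_nonneg_left e3 hb0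
  linarith

end BoundaryAtlas

theorem integral_log_nonneg {t : ℝ} (ht : 0 ≤ t) : 0 ≤ ∫ h in (1 : ℝ)..t, Real.log h := by
  rw [integral_log]
  rcases ht.eq_or_lt with rfl | ht
  · simp
  · have h1 := mul_le_mul_of_nonneg_left (Real.one_sub_inv_le_log_of_pos ht) ht.le
    rw [mul_sub, mul_inv_cancel₀ ht.ne'] at h1
    simp only [Real.log_one]
    linarith

/-- On the interval from `s` to `t` the integrand `log` is at least `log k`. In closed form this is
`log (t / s) ≥ 1 - s / t`. -/
theorem integral_log_min_add_le {k s t : ℝ} (hk : 1 ≤ k) (hs : k ≤ s) :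
    (∫ h in (1 : ℝ)..min t s, Real.log h) + Real.log k * max (t - s) 0 ≤
      ∫ h in (1 : ℝ)..t, Real.log h := by
  rcases le_total t s with h | h
  · rw [min_eq_left h, max_eq_right (by linarith), mul_zero, add_zero]
  · have hs0 : 0 < s := by linarith
    have ht0 : 0 < t := by linarith
    rw [min_eq_right h, max_eq_left (by linarith), integral_log, integral_log]
    have h1 := mul_le_mul_of_nonneg_left (Real.one_sub_inv_le_log_of_pos (div_pos ht0 hs0)) ht0.le
    rw [Real.log_div ht0.ne' hs0.ne', mul_sub, inv_div, mul_div_cancel₀ _ ht0.ne'] at h1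
    have h2 : Real.log k ≤ Real.log s := Real.log_le_log (by linarith) hs
    have h3 := mul_le_mul_of_nonneg_right h2 (sub_nonneg.2 h)
    simp only [Real.log_one]
    linarith

/-- The potential energy of the truncation of `v` from above. -/
theorem potentialEnergy_min_add_le {n : ℕ} {Ω : Set (E n)} (hb : Bornology.IsBounded Ω)
    {v : E n → ℝ} (hv : IntegrableOn v Ω)
    (hv0 : ∀ᵐ x ∂(volume.restrict Ω), 0 ≤ v x) {ψ : E n → ℝ} (hψ : Continuous ψ) {k : ℝ}
    (hk : 1 ≤ k) (hψk : ∀ x, k ≤ ψ x) :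
    potentialEnergy Ω (fun x => min (v x) (ψ x)) +
      ENNReal.ofReal (Real.log k * ∫ x in Ω, max (v x - ψ x) 0) ≤ potentialEnergy Ω v := by
  have hf := integrableOn_excess hb hv hψ
  have hlog : 0 ≤ Real.log k := Real.log_nonneg hk
  have e1 : ENNReal.ofReal (Real.log k * ∫ x in Ω, max (v x - ψ x) 0) =
      ∫⁻ x in Ω, ENNReal.ofReal (Real.log k * max (v x - ψ x) 0) := by
    rw [← integral_const_mul, ofReal_integral_eq_lintegral_ofReal (hf.const_mul _)]
    exact Eventually.of_forall fun x => mul_nonneg hlog (le_max_right _ _)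
  rw [e1, potentialEnergy, potentialEnergy,
    ← lintegral_add_right' _ (hf.const_mul _).aestronglyMeasurable.aemeasurable.ennreal_ofReal]
  refine lintegral_mono_ae ?_
  filter_upwards [hv0] with x hx
  have h1 : 0 ≤ min (v x) (ψ x) := le_min hx (by linarith [hψk x])
  rw [← ENNReal.ofReal_add (integral_log_nonneg h1) (mul_nonneg hlog (le_max_right _ _))]
  exact ENNReal.ofReal_le_ofReal (integral_log_min_add_le hk (hψk x))

theorem zero_isTestField {n : ℕ} (Ω : Set (E n)) : IsTestField Ω (fun _ => 0) (fun _ => 0) :=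
  ⟨contDiff_const, contDiff_const, HasCompactSupport.zero, HasCompactSupport.zero, by
    rw [show (fun _ : E n => (0 : E n)) = 0 from rfl, tsupport_zero]; exact Set.empty_subset _, by
    rw [show (fun _ : E n => (0 : ℝ)) = 0 from rfl, tsupport_zero]; exact Set.empty_subset _,
    by simp⟩

theorem surfaceEnergy_nonneg {n : ℕ} (Ω : Set (E n)) (v : E n → ℝ) : 0 ≤ surfaceEnergy Ω v := by
  refine le_iSup_of_le (fun _ => 0) (le_iSup_of_le (fun _ => 0)
    (le_iSup_of_le (zero_isTestField Ω) ?_))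
  have : ∀ x : E n, divg (fun _ : E n => (0 : E n)) x = 0 := fun x => by simp [divg]
  simp [this]

theorem IsTestField.abs_le_one {n : ℕ} {Ω : Set (E n)} {g : E n → E n} {g₀ : E n → ℝ}
    (h : IsTestField Ω g g₀) (x : E n) : |g₀ x| ≤ 1 :=
  abs_le_one_iff_mul_self_le_one.2 (by nlinarith [h.sq_le_one x, sq_nonneg ‖g x‖])

/-- The two functionals differ only in the zero-order term of the test, so one is finite exactly
when the other is. Membership in `BV` can thus be read off from the surface energy. -/
theorem abs_integral_area_sub_le {n : ℕ} {Ω : Set (E n)} (hb : Bornology.IsBounded Ω) {u : E n → ℝ}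
    (hu : IntegrableOn u Ω) {g : E n → E n} {g₀ : E n → ℝ} (h : IsTestField Ω g g₀) :
    |(∫ x in Ω, (g₀ x + u x * divg g x)) - ∫ x in Ω, u x * (g₀ x + divg g x)| ≤
      volume.real Ω + ∫ x in Ω, |u x| := by
  have hfin : volume Ω ≠ ⊤ := hb.measure_lt_top.ne
  have hdc := continuous_divg h.contDiff
  obtain ⟨C, hC⟩ := hdc.bounded_above_of_compact_support (hasCompactSupport_divg h.hasCompactSupport)
  have i1 : IntegrableOn g₀ Ω := integrableOn_of_continuous hb h.contDiff₀.continuous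
  have i2 : IntegrableOn (fun x => u x * divg g x) Ω :=
    Integrable.mul_bdd hu hdc.aestronglyMeasurable (Eventually.of_forall hC)
  have i3 : IntegrableOn (fun x => u x * g₀ x) Ω :=
    Integrable.mul_bdd (c := 1) hu h.contDiff₀.continuous.aestronglyMeasurable
      (Eventually.of_forall h.abs_le_one)
  have i4 : IntegrableOn (fun x => u x * (g₀ x + divg g x)) Ω := by
    simp only [mul_add]; exact i3.add i2
  have i5 : IntegrableOn (fun x => g₀ x + u x * divg g x) Ω := i1.add i2
  have i7 : IntegrableOn (fun _ : E n => (1 : ℝ)) Ω := integrableOn_const hfin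
  have i6 : IntegrableOn (fun x => 1 + |u x|) Ω := i7.add hu.abs
  rw [← integral_sub i5 i4, ← Real.norm_eq_abs]
  have e : volume.real Ω + ∫ x in Ω, |u x| = ∫ x in Ω, (1 + |u x|) := by
    rw [integral_add i7 hu.abs, setIntegral_const, smul_eq_mul, mul_one]
  rw [e]
  refine norm_integral_le_of_norm_le i6 (Eventually.of_forall fun x => ?_)
  have e1 : g₀ x + u x * divg g x - u x * (g₀ x + divg g x) = g₀ x - u x * g₀ x := by ring
  rw [e1, Real.norm_eq_abs]
  refine (abs_sub _ _).trans (add_le_add (h.abs_le_one x) ?_)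
  rw [abs_mul]
  exact mul_le_of_le_one_right (abs_nonneg _) (h.abs_le_one x)

theorem exists_surfaceEnergy_eq {n : ℕ} {Ω : Set (E n)} (hb : Bornology.IsBounded Ω) {u : E n → ℝ}
    (hu : u ∈ BV Ω) : ∃ c : ℝ, surfaceEnergy Ω u = c := by
  obtain ⟨hui, hua⟩ := hu
  have h1 : ∃ a : ℝ, area Ω u ≤ a := by
    induction h : area Ω u with
    | bot => exact ⟨0, bot_le⟩
    | coe a => exact ⟨a, le_rfl⟩
    | top => rw [h] at hua; exact absurd hua (lt_irrefl _)
  obtain ⟨a, ha⟩ := h1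
  have h2 : surfaceEnergy Ω u ≤ ((a + (volume.real Ω + ∫ x in Ω, |u x|) : ℝ) : EReal) := by
    refine iSup_le fun g => iSup_le fun g₀ => iSup_le fun ht => EReal.coe_le_coe_iff.2 ?_
    have h3 : ((∫ x in Ω, (g₀ x + u x * divg g x) : ℝ) : EReal) ≤ a :=
      (le_trans (by exact le_iSup_of_le g (le_iSup_of_le g₀ (le_iSup_of_le ht le_rfl))) ha)
    have h4 := (abs_le.1 (abs_integral_area_sub_le hb hui ht)).1
    have h5 := EReal.coe_le_coe_iff.1 h3
    linarith
  refine ⟨(surfaceEnergy Ω u).toReal, (EReal.coe_toReal ?_ ?_).symm⟩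
  · exact (h2.trans_lt (EReal.coe_lt_top _)).ne
  · exact (EReal.bot_lt_zero.trans_le (surfaceEnergy_nonneg Ω u)).ne'

theorem mem_BV_of_surfaceEnergy_le {n : ℕ} {Ω : Set (E n)} (hb : Bornology.IsBounded Ω)
    {u : E n → ℝ} (hu : IntegrableOn u Ω) {c : ℝ} (hc : surfaceEnergy Ω u ≤ c) : u ∈ BV Ω := by
  refine ⟨hu, lt_of_le_of_lt (b := ((c + (volume.real Ω + ∫ x in Ω, |u x|) : ℝ) : EReal)) ?_
    (EReal.coe_lt_top _)⟩
  refine iSup_le fun g => iSup_le fun g₀ => iSup_le fun ht => EReal.coe_le_coe_iff.2 ?_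
  have h3 : ((∫ x in Ω, u x * (g₀ x + divg g x) : ℝ) : EReal) ≤ c :=
    le_trans (by exact le_iSup_of_le g (le_iSup_of_le g₀ (le_iSup_of_le ht le_rfl))) hc
  have h4 := (abs_le.1 (abs_integral_area_sub_le hb hu ht)).2
  have h5 := EReal.coe_le_coe_iff.1 h3
  linarith

theorem surfaceEnergy_zero {n : ℕ} (Ω : Set (E n)) : surfaceEnergy Ω (fun _ => 0) = 0 := by
  refine le_antisymm ?_ (surfaceEnergy_nonneg Ω _)
  refine iSup_le fun g => iSup_le fun g₀ => iSup_le fun ht => ?_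
  simp

/-- The zero function is a competitor of finite energy. Finiteness allows the potential energies to
be cancelled as real numbers. -/
theorem IsMinimiser.potentialEnergy_ne_top {n : ℕ} {Ω : Set (E n)} (hb : Bornology.IsBounded Ω)
    {β v : E n → ℝ} (h : IsMinimiser Ω β v) : potentialEnergy Ω v ≠ ⊤ := by
  intro htop
  have h0 : (fun _ : E n => (0 : ℝ)) ∈ BVPlus Ω :=
    ⟨mem_BV_of_surfaceEnergy_le hb (integrable_zero _ _ _) (c := 0) (surfaceEnergy_zero Ω).le,
      Eventually.of_forall fun _ => le_rfl⟩
  have h1 := h.2 _ h0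
  have hfin : potentialEnergy Ω (fun _ => 0) ≠ ⊤ := by
    rw [potentialEnergy, setLIntegral_const]
    exact ENNReal.mul_ne_top ENNReal.ofReal_ne_top hb.measure_lt_top.ne
  have e1 : J₁ Ω β v = ⊤ := by
    obtain ⟨c, hc⟩ := exists_surfaceEnergy_eq hb h.1.1
    rw [J₁, hc, htop, EReal.coe_ennreal_top, EReal.coe_add_top, EReal.top_add_coe]
  rw [e1, J₁, surfaceEnergy_zero, zero_add, top_le_iff] at h1
  lift potentialEnergy Ω (fun _ => 0) to ℝ≥0 using hfin with p
  have e2 : ((p : ℝ≥0∞) : EReal) = ((p : ℝ) : EReal) := rfl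
  rw [e2, ← EReal.coe_add] at h1
  exact EReal.coe_ne_top _ h1

/-- The energy inequality for a minimiser and a competitor, in real numbers. -/
theorem IsMinimiser.energy_le {n : ℕ} {Ω : Set (E n)} (hb : Bornology.IsBounded Ω)
    {β v w : E n → ℝ} (h : IsMinimiser Ω β v) (hw : w ∈ BVPlus Ω) {c d L : ℝ}
    (hc : surfaceEnergy Ω v = c) (hd : surfaceEnergy Ω w ≤ d) (hL : 0 ≤ L)
    (hP : potentialEnergy Ω w + ENNReal.ofReal L ≤ potentialEnergy Ω v) :
    c + L + wettingEnergy Ω β v ≤ d + wettingEnergy Ω β w := by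
  have hpv := h.potentialEnergy_ne_top hb
  have hpw : potentialEnergy Ω w ≠ ⊤ :=
    ((le_self_add.trans hP).trans_lt (lt_top_iff_ne_top.2 hpv)).ne
  have h1 := h.2 w hw
  rw [J₁, J₁, hc] at h1
  generalize potentialEnergy Ω v = pv at *
  generalize potentialEnergy Ω w = pw at *
  lift pv to ℝ≥0 using hpv
  lift pw to ℝ≥0 using hpw
  have e1 : ∀ p : ℝ≥0, ((p : ℝ≥0∞) : EReal) = ((p : ℝ) : EReal) := fun _ => rfl
  have h2 : ((c : EReal) + ((pv : ℝ≥0∞) : EReal) + (wettingEnergy Ω β v : EReal)) ≤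
      (d : EReal) + ((pw : ℝ≥0∞) : EReal) + (wettingEnergy Ω β w : EReal) :=
    h1.trans (add_le_add (add_le_add hd le_rfl) le_rfl)
  rw [e1, e1, ← EReal.coe_add, ← EReal.coe_add, ← EReal.coe_add, ← EReal.coe_add,
    EReal.coe_le_coe_iff] at h2
  have h3 : (pw : ℝ) + L ≤ pv := by
    have := ENNReal.toReal_mono ENNReal.coe_ne_top hP
    rwa [ENNReal.toReal_add ENNReal.coe_ne_top ENNReal.ofReal_ne_top, ENNReal.toReal_ofReal hL,
      ENNReal.coe_toReal, ENNReal.coe_toReal] at this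
  linarith

end Capillary

/-! ### The barrier and the upper bound -/

namespace Capillary

/-- The condition `b < 1` is what makes the slope finite: `l = b / √(1 - b²)`. -/
theorem exists_slope {b : ℝ} (hb0 : 0 ≤ b) (hb1 : b < 1) :
    ∃ l : ℝ, 0 ≤ l ∧ b = (√(1 + l ^ 2))⁻¹ * l := by
  have h1 : 0 < 1 - b ^ 2 := by nlinarith
  have h2 : 0 < √(1 - b ^ 2) := Real.sqrt_pos.2 h1
  have h3 : √(1 - b ^ 2) ^ 2 = 1 - b ^ 2 := Real.sq_sqrt h1.le
  refine ⟨b / √(1 - b ^ 2), by positivity, ?_⟩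
  have e : 1 + (b / √(1 - b ^ 2)) ^ 2 = (√(1 - b ^ 2))⁻¹ ^ 2 := by
    rw [div_pow, inv_pow, h3]; field_simp; ring
  rw [e, Real.sqrt_sq (by positivity), inv_inv]
  field_simp

theorem grad_const_mul {n : ℕ} {F : E n → ℝ} (hF : Differentiable ℝ F) (l : ℝ) (x : E n) :
    grad (fun x => l * F x) x = l • grad F x := by
  rw [grad, grad, fderiv_const_mul (hF x), map_smul]

/-- The logarithm of the barrier. -/
noncomputable def logBarrier {n : ℕ} (Ω : Set (E n)) (R l : ℝ) (j : ℕ) (x : E n) : ℝ :=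
  l / (2 * R) * smoothSqDist Ω R j x

section barrier

variable {m : ℕ} {Ω : Set (E (m + 1))} {R l : ℝ}

theorem contDiff_logBarrier (Ω : Set (E (m + 1))) (R l : ℝ) (j : ℕ) :
    ContDiff ℝ 2 (logBarrier Ω R l j) :=
  contDiff_const.mul (contDiff_smoothSqDist Ω R j)

/-- The factor `l / (2 * R)` normalises the limiting gradient, of length `2 * R`, to length `l`.
`G.jac y` is the length of the conormal. -/
theorem GraphChart.IsChartOf.tendsto_inner_unitField {G : GraphChart m} {x₀ : E (m + 1)} {r : ℝ}
    (hG : G.IsChartOf Ω x₀ r) (hΩ : IsOpen Ω) (hR : 0 < R) (hsph : InteriorSphereCondition Ω R)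
    {y : E m} (hy : G.graph y ∈ Metric.ball x₀ r) (hp : DifferentiableAt ℝ G.p y) (hl : 0 ≤ l) :
    Tendsto (fun j => inner ℝ (G.conormal y) (unitField (logBarrier Ω R l j) (G.graph y))) atTop
      (𝓝 (-((√(1 + l ^ 2))⁻¹ * l * G.jac y))) := by
  obtain ⟨h1, h2⟩ := hG.tendsto_inner_grad_smoothSqDist hΩ hsph hy hp hR
  have hg : ∀ j, grad (logBarrier Ω R l j) (G.graph y) =
      (l / (2 * R)) • grad (smoothSqDist Ω R j) (G.graph y) := fun j =>
    grad_const_mul ((contDiff_smoothSqDist Ω R j).differentiable (by norm_num)) _ _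
  have h3 : Tendsto (fun j => (√(1 + (l / (2 * R) * ‖grad (smoothSqDist Ω R j) (G.graph y)‖) ^ 2))⁻¹)
      atTop (𝓝 (√(1 + (l / (2 * R) * (2 * R)) ^ 2))⁻¹) := by
    have hc : Continuous fun t : ℝ => (√(1 + (l / (2 * R) * t) ^ 2))⁻¹ :=
      Continuous.inv₀ (by fun_prop) fun t => (sqrt_one_add_sq_pos _).ne'
    exact (hc.tendsto _).comp h2
  have h4 := (h3.mul_const (l / (2 * R))).mul h1
  have e1 : (√(1 + (l / (2 * R) * (2 * R)) ^ 2))⁻¹ * (l / (2 * R)) * -(2 * R * G.jac y) =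
      -((√(1 + l ^ 2))⁻¹ * l * G.jac y) := by
    rw [div_mul_cancel₀ l (by positivity)]
    field_simp
  rw [e1] at h4
  refine h4.congr fun j => ?_
  rw [unitField, hg, inner_smul_right, inner_smul_right, norm_smul, Real.norm_eq_abs,
    abs_of_nonneg (by positivity), real_inner_comm, mul_assoc]

/-- The positive part measures how far the boundary flux of the field falls short of absorbing the
wetting term. It tends to zero almost everywhere and is bounded, so dominated convergence applies
against the integrable trace. -/
theorem BoundaryAtlas.tendsto_integral_defect {I : Type} [Fintype I] (A : BoundaryAtlas Ω I)
    (hΩ : IsOpen Ω) (hR : 0 < R) (hsph : InteriorSphereCondition Ω R) (hl : 0 ≤ l) {i : I}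
    {T : E m → ℝ} (hT : IntegrableOn T (A.base i)) :
    Tendsto (fun j => ∫ y in A.base i, |T y| * max (inner ℝ ((A.chart i).conormal y)
      (unitField (logBarrier Ω R l j) ((A.chart i).graph y)) +
        (√(1 + l ^ 2))⁻¹ * l * (A.chart i).jac y) 0) atTop (𝓝 0) := by
  set G := A.chart i with hG
  set b := (√(1 + l ^ 2))⁻¹ * l with hb
  have hb0 : 0 ≤ b := by positivity
  have hmeas : ∀ j, Measurable fun y => max (inner ℝ (G.conormal y)
      (unitField (logBarrier Ω R l j) (G.graph y)) + b * G.jac y) 0 := fun j =>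
    ((G.measurable_conormal.inner ((contDiff_unitField (contDiff_logBarrier Ω R l j)).continuous.comp
      G.continuous_graph).measurable).add (G.measurable_jac.const_mul b)).max measurable_const
  have hbd : ∀ j y, |max (inner ℝ (G.conormal y)
      (unitField (logBarrier Ω R l j) (G.graph y)) + b * G.jac y) 0| ≤ (1 + G.K) + b * (1 + G.K) := by
    intro j y
    rw [abs_of_nonneg (le_max_right _ _)]
    have h1 := (le_abs_self _).trans (A.abs_inner_conormal_le i
      (norm_unitField_le (logBarrier Ω R l j) (G.graph y)) y)
    have h2 := mul_le_mul_of_nonneg_left (G.jac_le y) hb0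
    exact max_le (add_le_add h1 h2) (by positivity)
  suffices h : Tendsto (fun j => ∫ y in A.base i, |T y| * max (inner ℝ (G.conormal y)
      (unitField (logBarrier Ω R l j) (G.graph y)) + b * G.jac y) 0) atTop
      (𝓝 (∫ y in A.base i, |T y| * 0)) by
    rwa [show (∫ y in A.base i, |T y| * 0) = 0 by simp] at h
  refine tendsto_integral_of_dominated_convergence
    (fun y => |T y| * ((1 + G.K) + b * (1 + G.K))) (fun j => ?_) (hT.abs.mul_const _)
    (fun j => Eventually.of_forall fun y => ?_) ?_
  · exact hT.abs.aestronglyMeasurable.mul (hmeas j).aestronglyMeasurable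
  · rw [norm_mul, Real.norm_eq_abs, Real.norm_eq_abs, abs_abs]
    exact mul_le_mul_of_nonneg_left (hbd j y) (abs_nonneg _)
  · filter_upwards [ae_restrict_of_ae (G.lipschitz.ae_differentiableAt (μ := volume)),
      ae_restrict_mem (G.isOpen_base (A.center i) (A.radius i)).measurableSet] with y hp hy
    have hyb : G.graph y ∈ Metric.ball (A.center i) (A.radius i) :=
      Metric.ball_subset_ball (by linarith [A.radius_pos i]) hy
    have h1 := (A.isChart i).tendsto_inner_unitField hΩ hR hsph hyb hp hl
    have h2 := ((h1.add_const (b * G.jac y)).max (tendsto_const_nhds (x := (0 : ℝ)))).const_mul |T y|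
    rw [neg_add_cancel, max_self] at h2
    exact h2

/-- The part of a minimiser above the barrier is controlled by the boundary defect. -/
theorem IsMinimiser.integral_excess_le {I : Type} [Fintype I] (A : BoundaryAtlas Ω I)
    (hΩ : IsOpen Ω) (hbd : Bornology.IsBounded Ω) (hR : 0 < R) (hne : (centers Ω R).Nonempty)
    (hl : 0 ≤ l) {β v : E (m + 1) → ℝ} (hv : IsMinimiser Ω β v)
    (hβm : AEStronglyMeasurable β (surfaceMeasure Ω))
    (hβ : ∀ᵐ x ∂(surfaceMeasure Ω), |β x| ≤ (√(1 + l ^ 2))⁻¹ * l) {T α : I → E m → ℝ}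
    (hT : ∀ i, (A.chart i).HasChartTrace (A.base i) (A.radius i / 4) v (T i) (α i)) (j : ℕ) :
    ∫ x in Ω, max (v x - Real.exp (l / R * (m + 1) + 1) * Real.exp (logBarrier Ω R l j x)) 0 ≤
      ∑ i, ∫ y in A.base i, |T i y| * max (inner ℝ ((A.chart i).conormal y)
        (unitField (logBarrier Ω R l j) ((A.chart i).graph y)) +
          (√(1 + l ^ 2))⁻¹ * l * (A.chart i).jac y) 0 := by
  set b := (√(1 + l ^ 2))⁻¹ * l with hb
  have hb0 : 0 ≤ b := by positivity
  set φ := logBarrier Ω R l j with hφ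
  have hφ2 : ContDiff ℝ 2 φ := contDiff_logBarrier Ω R l j
  have hφ0 : ∀ x, 0 ≤ φ x := fun x =>
    mul_nonneg (by positivity) (smoothSqDist_nonneg Ω R j x)
  set C := l / R * (m + 1) with hC
  have hC0 : 0 ≤ C := by positivity
  -- The logarithm of `k` beats the divergence bound `C` by `1`, which is the coefficient left in
  -- front of the integral of the excess.
  set k := Real.exp (C + 1) with hk
  have hk1 : 1 ≤ k := Real.one_le_exp (by linarith)
  set ψ : E (m + 1) → ℝ := fun x => k * Real.exp (φ x) with hψ
  have hψ1 : ContDiff ℝ 1 ψ := contDiff_const.mul (hφ2.of_le (by norm_num)).exp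
  have hψk : ∀ x, k ≤ ψ x := fun x =>
    le_mul_of_one_le_right (by linarith) (Real.one_le_exp (hφ0 x))
  obtain ⟨⟨hvBV, hv0⟩, hmin⟩ := hv
  have hvi := hvBV.1
  obtain ⟨c, hc⟩ := exists_surfaceEnergy_eq hbd hvBV
  have hsc : Semiconcave (l / R) φ := by
    have h := (semiconcave_smoothSqDist hne j).const_mul (l := l / (2 * R)) (by positivity)
    have e : l / (2 * R) * 2 = l / R := by field_simp
    rwa [e] at h
  have hdiv : ∀ x, divg (unitField φ) x ≤ C := fun x => by
    have h := divg_unitField_le hφ2 (by positivity) hsc x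
    push_cast at h
    exact h
  have hE := A.surfaceEnergy_min_le hΩ hbd hvi hc.le hT hψ1 (contDiff_unitField hφ2)
    (z₀ := fun x => (√(1 + ‖grad φ x‖ ^ 2))⁻¹) (fun x => by positivity)
    (fun x => (norm_unitField_sq_add φ x).le)
    (fun x p q hpq => unitField_calibration hφ2 (by linarith) x p hpq) hC0 hdiv
  set f : E (m + 1) → ℝ := fun x => max (v x - ψ x) 0 with hf
  have hf0 : 0 ≤ ∫ x in Ω, f x := integral_nonneg fun x => le_max_right _ _
  have hwi := integrableOn_min hbd hvi hψ1.continuous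
  have hw : (fun x => min (v x) (ψ x)) ∈ BVPlus Ω := by
    refine ⟨mem_BV_of_surfaceEnergy_le hbd hwi hE, ?_⟩
    filter_upwards [hv0] with x hx using le_min hx (by linarith [hψk x])
  have hP := potentialEnergy_min_add_le hbd hvi hv0 hψ1.continuous hk1 hψk
  have hlog : Real.log k = C + 1 := Real.log_exp _
  have hJ := IsMinimiser.energy_le hbd ⟨⟨hvBV, hv0⟩, hmin⟩ hw hc hE
    (mul_nonneg (Real.log_nonneg hk1) hf0) hP
  have hW := A.wettingEnergy_min_le hΩ hbd hvi hT hψ1.continuous hb0 hβm hβ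
  rw [hlog] at hJ
  set F : I → E m → ℝ := fun i y => max (T i y - ψ ((A.chart i).graph y)) 0 with hF
  have hFi : ∀ i, IntegrableOn (F i) (A.base i) := fun i =>
    Integrable.sup ((hT i).integrable.sub (integrableOn_of_continuous
      ((A.chart i).isBounded_base _ _) (hψ1.continuous.comp (A.chart i).continuous_graph)))
      (integrable_zero _ _ _)
  have hZc := (contDiff_unitField hφ2).continuous
  have hbound : ∀ i, (∫ y in A.base i, F i y * (A.weight i ((A.chart i).graph y) *
        inner ℝ ((A.chart i).conormal y) (unitField φ ((A.chart i).graph y)))) +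
      b * (∫ y in A.base i, (A.chart i).jac y * (A.weight i ((A.chart i).graph y) * F i y)) ≤
      ∫ y in A.base i, |T i y| * max (inner ℝ ((A.chart i).conormal y)
        (unitField φ ((A.chart i).graph y)) + b * (A.chart i).jac y) 0 := by
    intro i
    have hwm := ((A.contDiff i).continuous.comp (A.chart i).continuous_graph).measurable
    have him : Measurable fun y => (inner ℝ ((A.chart i).conormal y)
        (unitField φ ((A.chart i).graph y)) : ℝ) :=
      (A.chart i).measurable_conormal.inner (hZc.comp (A.chart i).continuous_graph).measurable
    have hib := fun y => A.abs_inner_conormal_le i (norm_unitField_le φ ((A.chart i).graph y)) y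
    have i1 : IntegrableOn (fun y => F i y * (A.weight i ((A.chart i).graph y) *
        inner ℝ ((A.chart i).conormal y) (unitField φ ((A.chart i).graph y)))) (A.base i) := by
      refine Integrable.mul_bdd (c := 1 + (A.chart i).K) (hFi i) (hwm.mul him).aestronglyMeasurable
        (Eventually.of_forall fun y => ?_)
      rw [norm_mul, Real.norm_eq_abs, Real.norm_eq_abs,
        abs_of_nonneg (A.nonneg i _)]
      exact (mul_le_of_le_one_left (abs_nonneg _) (A.weight_le_one i _)).trans (hib y)
    have i2 : IntegrableOn (fun y => (A.chart i).jac y *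
        (A.weight i ((A.chart i).graph y) * F i y)) (A.base i) := by
      refine GraphChart.integrableOn_jac_mul (Integrable.bdd_mul (c := 1) (hFi i)
        hwm.aestronglyMeasurable (Eventually.of_forall fun y => ?_))
      rw [Real.norm_eq_abs, abs_of_nonneg (A.nonneg i _)]
      exact A.weight_le_one i _
    have i3 : IntegrableOn (fun y => |T i y| * max (inner ℝ ((A.chart i).conormal y)
        (unitField φ ((A.chart i).graph y)) + b * (A.chart i).jac y) 0) (A.base i) := by
      refine Integrable.mul_bdd (c := (1 + (A.chart i).K) + b * (1 + (A.chart i).K))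
        (hT i).integrable.abs ((him.add ((A.chart i).measurable_jac.const_mul b)).max
          measurable_const).aestronglyMeasurable (Eventually.of_forall fun y => ?_)
      rw [Real.norm_eq_abs, abs_of_nonneg (le_max_right _ _)]
      exact max_le (add_le_add ((le_abs_self _).trans (hib y))
        (mul_le_mul_of_nonneg_left ((A.chart i).jac_le y) hb0)) (by positivity)
    rw [← integral_const_mul, ← integral_add i1 (i2.const_mul b)]
    -- Both boundary terms carry the same nonnegative factor, weight times excess. It is at most `|T
    -- i y|`, a majorant that does not depend on the barrier.
    refine integral_mono (i1.add (i2.const_mul b)) i3 fun y => ?_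
    set s : ℝ := inner ℝ ((A.chart i).conormal y) (unitField φ ((A.chart i).graph y))
    set J := (A.chart i).jac y
    have hF0 : 0 ≤ F i y := le_max_right _ _
    have hFT : F i y ≤ |T i y| :=
      max_le ((sub_le_self _ (by linarith [hψk ((A.chart i).graph y)])).trans (le_abs_self _))
        (abs_nonneg _)
    have hW0 := A.nonneg i ((A.chart i).graph y)
    have hW1 := A.weight_le_one i ((A.chart i).graph y)
    have hm0 : 0 ≤ max (s + b * J) 0 := le_max_right _ _
    have e : F i y * (A.weight i ((A.chart i).graph y) * s) +
        b * (J * (A.weight i ((A.chart i).graph y) * F i y)) =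
        (A.weight i ((A.chart i).graph y) * F i y) * (s + b * J) := by ring
    change F i y * (A.weight i ((A.chart i).graph y) * s) +
        b * (J * (A.weight i ((A.chart i).graph y) * F i y)) ≤ |T i y| * max (s + b * J) 0
    rw [e]
    refine (mul_le_mul_of_nonneg_left (le_max_left _ 0) (mul_nonneg hW0 hF0)).trans ?_
    exact mul_le_mul_of_nonneg_right ((mul_le_of_le_one_left hF0 hW1).trans hFT) hm0
  have hsum := Finset.sum_le_sum fun i (_ : i ∈ Finset.univ) => hbound i
  rw [Finset.sum_add_distrib, ← Finset.mul_sum] at hsum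
  refine le_trans ?_ hsum
  have e1 : c + (C + 1) * (∫ x in Ω, f x) ≤ c + C * (∫ x in Ω, f x) +
      (∑ i, ∫ y in A.base i, F i y * (A.weight i ((A.chart i).graph y) *
        inner ℝ ((A.chart i).conormal y) (unitField φ ((A.chart i).graph y)))) +
      b * ∑ i, ∫ y in A.base i, (A.chart i).jac y *
        (A.weight i ((A.chart i).graph y) * F i y) := by
    have h1 := hJ.trans (add_le_add_right hW _)
    have h2 : ∀ p q r s t : ℝ, p + q + r ≤ s + (r + t) → p + q ≤ s + t := fun p q r s t h => by
      linarith
    exact h2 _ _ _ _ _ h1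
  change ∫ x in Ω, f x ≤ _
  linarith

end barrier

/-- Minimisers are essentially bounded above. -/
theorem IsMinimiser.exists_bound {m : ℕ} {Ω : Set (E (m + 1))} (hΩ : IsOpen Ω)
    (hbd : Bornology.IsBounded Ω) (hlip : HasLipschitzBoundary Ω) {R : ℝ} (hR : 0 < R)
    (hsph : InteriorSphereCondition Ω R) {β : E (m + 1) → ℝ} {a : ℝ} (ha : 0 < a)
    (hβm : AEStronglyMeasurable β (surfaceMeasure Ω))
    (hβ : ∀ᵐ x ∂(surfaceMeasure Ω), |β x| ≤ 1 - a) {v : E (m + 1) → ℝ} (hv : IsMinimiser Ω β v) :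
    ∃ M : ℝ, ∀ᵐ x ∂(volume.restrict Ω), v x ≤ M := by
  have hne : Ωᶜ.Nonempty := by
    rw [Set.nonempty_compl]
    rintro rfl
    exact NormedSpace.unbounded_univ ℝ (E (m + 1)) hbd
  -- Without boundary points the sphere condition provides no centres, but then `Ω` is open and
  -- closed, and being bounded it is empty.
  rcases (frontier Ω).eq_empty_or_nonempty with h0 | ⟨x₀, hx₀⟩
  · have hcl := isClopen_iff_frontier_eq_empty.2 h0
    rcases isClopen_iff.1 hcl with rfl | rfl
    · exact ⟨0, by simp⟩
    · simp at hne
  have hcen : (centers Ω R).Nonempty := by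
    obtain ⟨c, hc, -⟩ := hsph x₀ hx₀
    exact ⟨c, hc⟩
  obtain ⟨N, ⟨A⟩⟩ := hlip.exists_boundaryAtlas hΩ hbd
  obtain ⟨c, hc⟩ := exists_surfaceEnergy_eq hbd hv.1.1
  have hvi := hv.1.1.1
  choose T α hT using fun i =>
    GraphChart.exists_hasChartTrace hΩ hbd hne hvi hc.le (A.radius_pos i) (A.isChart i)
  -- The maximum with `0` covers `a > 1`, where `1 - a` is negative.
  obtain ⟨l, hl, hbl⟩ := exists_slope (le_max_right (1 - a) 0) (max_lt (by linarith) one_pos)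
  have hβ' : ∀ᵐ x ∂(surfaceMeasure Ω), |β x| ≤ (√(1 + l ^ 2))⁻¹ * l := by
    filter_upwards [hβ] with x hx
    rw [← hbl]
    exact hx.trans (le_max_left _ _)
  -- A bound uniform in `j` puts all barriers below the one constant `M` on `Ω`.
  obtain ⟨D, hD⟩ := exists_smoothSqDist_le hbd hcen
  set k := Real.exp (l / R * (m + 1) + 1) with hk
  set M := k * Real.exp (l / (2 * R) * D) with hM
  have hfM := integrableOn_excess hbd hvi (ψ := fun _ => M) continuous_const
  refine ⟨M, ?_⟩
  have hle : ∀ j, ∫ x in Ω, max (v x - M) 0 ≤ ∑ i, ∫ y in A.base i, |T i y| *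
      max (inner ℝ ((A.chart i).conormal y)
        (unitField (logBarrier Ω R l j) ((A.chart i).graph y)) +
          (√(1 + l ^ 2))⁻¹ * l * (A.chart i).jac y) 0 := by
    intro j
    refine le_trans ?_ (hv.integral_excess_le A hΩ hbd hR hcen hl hβm hβ' hT j)
    refine setIntegral_mono_on hfM (integrableOn_excess hbd hvi (continuous_const.mul
      (Real.continuous_exp.comp (contDiff_logBarrier Ω R l j).continuous))) hΩ.measurableSet
      fun x hx => ?_
    refine max_le_max (sub_le_sub_left ?_ _) le_rfl
    refine mul_le_mul_of_nonneg_left (Real.exp_le_exp.2 ?_) (Real.exp_pos _).le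
    exact mul_le_mul_of_nonneg_left (hD j x hx) (by positivity)
  have hlim := tendsto_finsetSum Finset.univ fun i _ =>
    A.tendsto_integral_defect (i := i) hΩ hR hsph hl (hT i).integrable
  rw [Finset.sum_const_zero] at hlim
  -- The left side no longer depends on `j`, while the defect on the right tends to zero.
  have h1 : ∫ x in Ω, max (v x - M) 0 ≤ 0 := ge_of_tendsto' hlim hle
  have h2 : ∫ x in Ω, max (v x - M) 0 = 0 :=
    le_antisymm h1 (integral_nonneg fun x => le_max_right _ _)
  have h3 := (integral_eq_zero_iff_of_nonneg (fun x => le_max_right _ _) hfM).1 h2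
  filter_upwards [h3] with x hx
  have h4 : max (v x - M) 0 = 0 := hx
  linarith [le_max_left (v x - M) 0]

end Capillary
theorem mainTheorem3 (n : ℕ) (hn : 1 ≤ n) (Ω : Set (Capillary.E n))
    (hΩ_open : IsOpen Ω) (hΩ_bdd : Bornology.IsBounded Ω)
    (hΩ_lip : Capillary.HasLipschitzBoundary Ω)
    (R : ℝ) (hR : 0 < R) (hΩ_sphere : Capillary.InteriorSphereCondition Ω R)
    (β : Capillary.E n → ℝ) (a : ℝ) (ha : 0 < a)
    (hβ_meas : AEStronglyMeasurable β (Capillary.surfaceMeasure Ω))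
    (hβ : ∀ᵐ x ∂(Capillary.surfaceMeasure Ω), |β x| ≤ 1 - a)
    (v : Capillary.E n → ℝ) (hv : Capillary.IsMinimiser Ω β v) :
    ∃ M : ℝ, ∀ᵐ x ∂(volume.restrict Ω), v x ≤ M := by
  obtain ⟨m, rfl⟩ : ∃ m, n = m + 1 := ⟨n - 1, by omega⟩
  exact Capillary.IsMinimiser.exists_bound hΩ_open hΩ_bdd hΩ_lip hR hΩ_sphere ha hβ_meas hβ hv
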